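/- Identify $\mathbb R^3$ with the imaginary quaternions, let $\widehat{\mathbb R}^3=\mathbb R^3\cup\{\infty\}$, and call spheres and planes (planes together with $\infty$) M-spheres. Möbius transformations are the elements of the group generated by inversions in spheres. A Dupin cyclidic (DC) system is a rational map $F=UW^{-1}$ from $(\mathbb{RP}^1)^3$ to $\widehat{\mathbb R}^3$ (with value $\infty$ where $W=0\neq U$, and undefined where $U=W=0$), where $U,W$ are polynomials in $s,t,u$ with quaternion coefficients, of degree at most one in each variable, with $\mathrm{Re}(U\overline W)=0$, such that $\partial_sF,\partial_tF,\partial_uF$ are mutually orthogonal and the Jacobian of $F$ is not identically zero. (Derivatives at points with value $\infty$ are computed after the inversion in the unit sphere.) Its singular locus $\mathrm{Sing}(F)\subset\widehat{\mathbb R}^3$ is the image of the points of the domain at which the Jacobian vanishes. Its coordinate surfaces are the images of the slices $s=\mathrm{const}$, $t=\mathrm{const}$, $u=\mathrm{const}$, which form three families; $F$ is spherical if, in at least one family, every coordinate surface lies on an M-sphere. DC systems $F,F'$ are Möbius equivalent if $F'=\mu\circ F\circ\rho$ with a Möbius transformation $\mu$ and an automorphism $\rho$ of $(\mathbb{RP}^1)^3$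 composed of projective transformations of the factors and a permutation of them. An M-sphere $S$ is an M-sphere of symmetry of $F$ if the inversion $\iota_S$ in $S$ (the reflection, if $S$ is a plane) satisfies $\iota_S\circ F=F\circ\rho$ for some such $\rho$. **Theorem.** Let $F$ be a non-spherical DC system with three M-spheres of symmetry $S_1,S_2,S_3$ that are coordinate surfaces of the first, second and third family of $F$ respectively, and suppose that some point of $S_1\cap S_2\cap S_3$ is regular, i.e. does not lie in $\mathrm{Sing}(F)$. Then there are $a,b,c\in\mathbb R$ such that $F$ is Möbius equivalent to the canonical form $$F_{a,b,c}(s,t,u)=\big((a+b+c)stu+s\mathbf i+t\mathbf j+u\mathbf k\big)\big(1-btu\,\mathbf i-csu\,\mathbf j-ast\,\mathbf k\big)^{-1},$$ and $\mathrm{Sing}(F_{a,b,c})$ is one of the following, where for $K,M,N\in\mathbb R$ and $\delta=\pm1$ the curves $$\mathcal B_1^\delta:\ z=0,\ (x^2+y^2)^2-2Kx^2+2My^2+\delta=0,$$ $$\mathcal B_2^\delta:\ y=0,\ (x^2+z^2)^2-2Mz^2+2Nx^2+\delta=0,$$ $$\mathcal B_3^\delta:\ x=0,\ (y^2+z^2)^2-2Ny^2+2Kz^2+\delta=0$$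 are called focal bicircular quartics if $KM+MN+NK+\delta=0$, and an oval is a simple closed curve: * (A1) the union of three focal bicircular quartics $\mathcal B_1^{-1},\mathcal B_2^{-1},\mathcal B_3^{-1}$, each of which consists of one oval; * (A2) the union of two of three focal bicircular quartics $\mathcal B_1^{+1},\mathcal B_2^{+1},\mathcal B_3^{+1}$, where each of these two consists of two disjoint ovals and the third curve has no real points; * (A3) the union of $\{\infty\}$ with a focal ellipse and hyperbola on two different coordinate planes, i.e., for some permutation $(\xi,\eta,\zeta)$ of the coordinates $(x,y,z)$ and some $\alpha,\beta,\gamma>0$ with $\alpha^2=\beta^2+\gamma^2$, the ellipse $\zeta=0,\ \xi^2/\alpha^2+\eta^2/\beta^2=1$ and the hyperbola $\eta=0,\ \xi^2/\gamma^2-\zeta^2/\beta^2=1$. -/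

import Mathlib

open scoped OnePoint

namespace DupinCyclidic

/-- Euclidean 3-space; the imaginary quaternion `x i + y j + z k` is the point `(x, y, z)`. -/
abbrev E3 : Type := EuclideanSpace ℝ (Fin 3)

/-- The imaginary part of a quaternion, as a point of Euclidean 3-space. -/
noncomputable def imPart (q : Quaternion ℝ) : E3 := !₂[q.imI, q.imJ, q.imK]

/-! ### Inversions, Möbius transformations, M-spheres -/

open Classical in
/-- The inversion of the extended space `OnePoint E3` in the sphere with centre `c` and radius `r`;
it exchanges `c` and the point at infinity. -/
noncomputable def sphereInversion (c : E3) (r : ℝ) (p : OnePoint E3) : OnePoint E3 :=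
  p.elim (c : OnePoint E3)
    (fun x => if x = c then ∞ else ((EuclideanGeometry.inversion c r x : E3) : OnePoint E3))

theorem sphereInversion_involutive (c : E3) {r : ℝ} (hr : r ≠ 0) :
    Function.Involutive (sphereInversion c r) := by
  intro p
  induction p using OnePoint.rec with
  | infty => simp [sphereInversion]
  | coe x =>
    by_cases hx : x = c
    · simp [sphereInversion, hx]
    · have h : EuclideanGeometry.inversion c r x ≠ c := fun h =>
        hx ((EuclideanGeometry.inversion_eq_center hr).1 h)
      simp [sphereInversion, hx, h, EuclideanGeometry.inversion_inversion c hr x]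

/-- The inversion in a sphere of non-zero radius as a permutation of the extended space. -/
noncomputable def sphereInversionPerm (c : E3) (r : ℝ) (hr : r ≠ 0) :
    Equiv.Perm (OnePoint E3) :=
  (sphereInversion_involutive c hr).toPerm (sphereInversion c r)

/-- The group of Möbius transformations: the group generated by the inversions. -/
noncomputable def moebiusGroup : Subgroup (Equiv.Perm (OnePoint E3)) :=
  Subgroup.closure {μ | ∃ (c : E3) (r : ℝ) (hr : r ≠ 0), μ = sphereInversionPerm c r hr}

/-- An M-sphere: a sphere, or a plane `⟪n, x⟫ = k`. -/
inductive MSphere : Type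
  | sphere (c : E3) (r : ℝ) (hr : 0 < r) : MSphere
  | plane (n : E3) (k : ℝ) (hn : n ≠ 0) : MSphere

/-- The points of an M-sphere in the extended space; planes contain the point at infinity. -/
def MSphere.carrier : MSphere → Set (OnePoint E3)
  | .sphere c r _ => (fun x : E3 => (x : OnePoint E3)) '' Metric.sphere c r
  | .plane n k _ => insert ∞ ((fun x : E3 => (x : OnePoint E3)) '' {x | inner ℝ n x = k})

/-- The inversion with respect to an M-sphere (the reflection, if it is a plane). -/
noncomputable def MSphere.inversion : MSphere → OnePoint E3 → OnePoint E3
  | .sphere c r _ => sphereInversion c r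
  | .plane n k _ => OnePoint.map (fun x : E3 => x - (2 * (inner ℝ n x - k) / ‖n‖ ^ 2) • n)

/-! ### Trilinear quaternionic fractions

A point of `(ℝP¹)³` is given by homogeneous coordinates `v : Fin 3 → Fin 2 → ℝ` with `v i ≠ 0` for
all `i`; the affine parameters are `s = v 0 1 / v 0 0`, `t = v 1 1 / v 1 0`, `u = v 2 1 / v 2 0`. -/

/-- A pair of quaternionic polynomials `U, W` in `s, t, u`, of degree at most one in each variable,
given by the coefficients `coeffU e`, `coeffW e` of the monomial `s ^ e 0 * t ^ e 1 * u ^ e 2`. -/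
structure TrilinearPair where
  coeffU : (Fin 3 → Fin 2) → Quaternion ℝ
  coeffW : (Fin 3 → Fin 2) → Quaternion ℝ

/-- An automorphism of `(ℝP¹)³` composed of projective transformations of the three lines and a
permutation of them. -/
structure ParamAut where
  proj : Fin 3 → ((Fin 2 → ℝ) ≃ₗ[ℝ] (Fin 2 → ℝ))
  perm : Equiv.Perm (Fin 3)

/-- The action of an automorphism on homogeneous coordinates. -/
def ParamAut.act (ρ : ParamAut) (v : Fin 3 → Fin 2 → ℝ) : Fin 3 → Fin 2 → ℝ :=
  fun i => ρ.proj i (v (ρ.perm i))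

namespace TrilinearPair

variable (F : TrilinearPair)

/-- The numerator, in homogeneous coordinates. -/
noncomputable def U (v : Fin 3 → Fin 2 → ℝ) : Quaternion ℝ :=
  ∑ e : Fin 3 → Fin 2, (∏ i, v i (e i)) • F.coeffU e

/-- The denominator, in homogeneous coordinates. -/
noncomputable def W (v : Fin 3 → Fin 2 → ℝ) : Quaternion ℝ :=
  ∑ e : Fin 3 → Fin 2, (∏ i, v i (e i)) • F.coeffW e

/-- The points of `(ℝP¹)³` (in homogeneous coordinates) at which the rational map is defined: those
where `U` and `W` do not both vanish. -/
def domain : Set (Fin 3 → Fin 2 → ℝ) :=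
  {v | (∀ i, v i ≠ 0) ∧ (F.U v ≠ 0 ∨ F.W v ≠ 0)}

open Classical in
/-- The value `U W⁻¹` of the map in the extended space; it is `∞` where `W = 0`. -/
noncomputable def eval (v : Fin 3 → Fin 2 → ℝ) : OnePoint E3 :=
  if F.W v = 0 then ∞ else ((imPart (F.U v * (F.W v)⁻¹) : E3) : OnePoint E3)

/-- The value does not depend on the choice of homogeneous coordinates. -/
theorem eval_smul (c : Fin 3 → ℝ) (hc : ∀ i, c i ≠ 0) (v : Fin 3 → Fin 2 → ℝ) :
    F.eval (fun i => c i • v i) = F.eval v := by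
  have hp : (∏ i, c i) ≠ 0 := Finset.prod_ne_zero_iff.2 fun i _ => hc i
  have hU : F.U (fun i => c i • v i) = (∏ i, c i) • F.U v := by
    simp [U, Finset.smul_sum, Finset.prod_mul_distrib, smul_smul]
  have hW : F.W (fun i => c i • v i) = (∏ i, c i) • F.W v := by
    simp [W, Finset.smul_sum, Finset.prod_mul_distrib, smul_smul]
  by_cases h : F.W v = 0
  · simp [eval, hW, h]
  · have h' : F.W (fun i => c i • v i) ≠ 0 := by
      rw [hW]; exact smul_ne_zero hp h
    have key : F.U (fun i => c i • v i) * (F.W (fun i => c i • v i))⁻¹ =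
        F.U v * (F.W v)⁻¹ := by
      have hinv : ((∏ i, c i) • F.W v)⁻¹ = (∏ i, c i)⁻¹ • (F.W v)⁻¹ := by
        symm
        apply eq_inv_of_mul_eq_one_left
        rw [smul_mul_smul_comm, inv_mul_cancel₀ hp, inv_mul_cancel₀ h, one_smul]
      rw [hU, hW, hinv, smul_mul_smul_comm, mul_inv_cancel₀ hp, one_smul]
    simp only [eval, if_neg h, if_neg h', key]

open Classical in
/-- The map near the parameter point `v₀`, in a chart of the extended space around the value at
`v₀`: the map itself if that value is finite, and the map followed by the unit inversion
`p ↦ -p⁻¹` if that value is `∞`. -/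
noncomputable def chartEval (v₀ v : Fin 3 → Fin 2 → ℝ) : E3 :=
  if F.W v₀ = 0 then imPart (-(F.W v * (F.U v)⁻¹)) else imPart (F.U v * (F.W v)⁻¹)

/-- The partial derivative in the `i`-th parameter at `v`: the derivative along the curve
`τ ↦ v i + τ • (-(v i 1), v i 0)`, which passes through the point `v i` of `ℝP¹` with non-zero
speed. It is a non-zero multiple of the partial derivative in any local coordinate of `ℝP¹`. -/
noncomputable def pderiv (v : Fin 3 → Fin 2 → ℝ) (i : Fin 3) : E3 :=
  deriv (fun τ : ℝ =>
    F.chartEval v (Function.update v i (v i + τ • ![-(v i 1), v i 0]))) 0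

/-- The Jacobian determinant (up to a non-zero factor depending on the local coordinates). -/
noncomputable def jacobian (v : Fin 3 → Fin 2 → ℝ) : ℝ :=
  Matrix.det (Matrix.of fun i j : Fin 3 => F.pderiv v i j)

/-- Dupin cyclidic systems: `F = U W⁻¹` takes imaginary values (`(U, W)` lies on the Study quadric
`(U W̄ + W Ū) / 2 = Re (U W̄) = 0`), the three partial derivatives are mutually orthogonal, and the
Jacobian does not vanish identically. -/
structure IsDCSystem : Prop where
  study : ∀ v : Fin 3 → Fin 2 → ℝ, (F.U v * star (F.W v)).re = 0
  orthogonal : ∀ v ∈ F.domain, ∀ i j : Fin 3, i ≠ j → inner ℝ (F.pderiv v i) (F.pderiv v j) = 0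
  jacobian_ne_zero : ∃ v ∈ F.domain, F.jacobian v ≠ 0

/-- The singular locus: the image of the points where the Jacobian vanishes. -/
def singularLocus : Set (OnePoint E3) :=
  {p | ∃ v ∈ F.domain, F.jacobian v = 0 ∧ F.eval v = p}

/-- The coordinate surface of the `i`-th family on which the `i`-th parameter is `r ∈ ℝP¹`. -/
def coordSurface (i : Fin 3) (r : Fin 2 → ℝ) : Set (OnePoint E3) :=
  {p | ∃ v ∈ F.domain, v i = r ∧ F.eval v = p}

/-- Spherical systems: one of the three families consists of M-spheres, that is, each of its
surfaces lies on an M-sphere (single members may degenerate to circles or points). -/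
def IsSpherical : Prop :=
  ∃ i : Fin 3, ∀ r : Fin 2 → ℝ, r ≠ 0 → ∃ S : MSphere, F.coordSurface i r ⊆ S.carrier

/-- The M-sphere `S` is a coordinate surface of the `i`-th family. -/
def HasMSphere (i : Fin 3) (S : MSphere) : Prop :=
  ∃ r : Fin 2 → ℝ, r ≠ 0 ∧ F.coordSurface i r = S.carrier

/-- `F' = μ ∘ F ∘ ρ` as rational maps. -/
def IsTransform (F F' : TrilinearPair) (μ : OnePoint E3 → OnePoint E3) (ρ : ParamAut) : Prop :=
  ∀ v : Fin 3 → Fin 2 → ℝ, (v ∈ F'.domain ↔ ρ.act v ∈ F.domain) ∧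
    (v ∈ F'.domain → F'.eval v = μ (F.eval (ρ.act v)))

/-- Möbius equivalence of systems. -/
def MoebiusEquivalent (F F' : TrilinearPair) : Prop :=
  ∃ μ ∈ moebiusGroup, ∃ ρ : ParamAut, IsTransform F F' μ ρ

/-- `S` is an M-sphere of symmetry: the inversion in `S` maps the system to itself, up to a
reparametrization. -/
def IsSymmetrySphere (S : MSphere) : Prop :=
  ∃ ρ : ParamAut, IsTransform F F S.inversion ρ

end TrilinearPair

/-- The canonical form with `U = (a + b + c) s t u + s i + t j + u k` and
`W = 1 - b t u i - c s u j - a s t k`. -/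
noncomputable def canonicalPair (a b c : ℝ) : TrilinearPair where
  coeffU e := ⟨if e = ![1, 1, 1] then a + b + c else 0, if e = ![1, 0, 0] then 1 else 0,
    if e = ![0, 1, 0] then 1 else 0, if e = ![0, 0, 1] then 1 else 0⟩
  coeffW e := ⟨if e = ![0, 0, 0] then 1 else 0, if e = ![0, 1, 1] then -b else 0,
    if e = ![1, 0, 1] then -c else 0, if e = ![1, 1, 0] then -a else 0⟩

theorem univ_eq_exponents : (Finset.univ : Finset (Fin 3 → Fin 2)) =
    {![0, 0, 0], ![1, 0, 0], ![0, 1, 0], ![0, 0, 1], ![1, 1, 0], ![1, 0, 1], ![0, 1, 1],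
      ![1, 1, 1]} := by
  decide

theorem canonicalPair_U (a b c s t u : ℝ) :
    (canonicalPair a b c).U ![![1, s], ![1, t], ![1, u]] =
      ⟨(a + b + c) * s * t * u, s, t, u⟩ := by
  ext <;> simp [TrilinearPair.U, univ_eq_exponents, Fin.prod_univ_three] <;>
    simp [canonicalPair] <;> ring

theorem canonicalPair_W (a b c s t u : ℝ) :
    (canonicalPair a b c).W ![![1, s], ![1, t], ![1, u]] =
      ⟨1, -b * t * u, -c * s * u, -a * s * t⟩ := by
  ext <;> simp [TrilinearPair.W, univ_eq_exponents, Fin.prod_univ_three] <;>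
    simp [canonicalPair] <;> ring

/-! ### Focal curves -/

/-- The three bicircular quartics on the planes `z = 0`, `y = 0`, `x = 0` with parameters `K, M, N`
and `δ = ± 1`. They are focal when `K M + M N + N K + δ = 0`. -/
def quartic (δ K M N : ℝ) : Fin 3 → Set E3 :=
  ![{p | p 2 = 0 ∧ (p 0 ^ 2 + p 1 ^ 2) ^ 2 - 2 * K * p 0 ^ 2 + 2 * M * p 1 ^ 2 + δ = 0},
    {p | p 1 = 0 ∧ (p 0 ^ 2 + p 2 ^ 2) ^ 2 - 2 * M * p 2 ^ 2 + 2 * N * p 0 ^ 2 + δ = 0},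
    {p | p 0 = 0 ∧ (p 1 ^ 2 + p 2 ^ 2) ^ 2 - 2 * N * p 1 ^ 2 + 2 * K * p 2 ^ 2 + δ = 0}]

/-- The curve consists of one oval (simple closed curve). -/
def IsOneOval (C : Set E3) : Prop := Nonempty (C ≃ₜ Circle)

/-- The curve consists of two disjoint ovals. -/
def IsTwoOval (C : Set E3) : Prop :=
  ∃ C₁ C₂ : Set E3, IsOneOval C₁ ∧ IsOneOval C₂ ∧ Disjoint C₁ C₂ ∧ C = C₁ ∪ C₂

/-- Type (A1): the set is the union of three focal 1-oval bicircular quartics. -/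
def IsThreeFocalOneOval (Z : Set (OnePoint E3)) : Prop :=
  ∃ K M N : ℝ, K * M + M * N + N * K + (-1) = 0 ∧
    (∀ i, IsOneOval (quartic (-1) K M N i)) ∧
    Z = (fun x : E3 => (x : OnePoint E3)) '' (⋃ i, quartic (-1) K M N i)

/-- Type (A2): the set is the union of two 2-oval bicircular quartics that belong to a focal triple
whose third member has no real points. -/
def IsTwoFocalTwoOval (Z : Set (OnePoint E3)) : Prop :=
  ∃ K M N : ℝ, K * M + M * N + N * K + 1 = 0 ∧
    (∃ i, quartic 1 K M N i = ∅ ∧ ∀ j, j ≠ i → IsTwoOval (quartic 1 K M N j)) ∧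
    Z = (fun x : E3 => (x : OnePoint E3)) '' (⋃ i, quartic 1 K M N i)

/-- Type (A3): the set is the union of an ellipse with semi-axes `α > β` and a hyperbola with
semi-axes `γ, β` on two different coordinate planes, with common axis and `α ^ 2 = β ^ 2 + γ ^ 2`
(each passes through the foci of the other), and of the point `∞`, where the hyperbola closes up. -/
def IsFocalEllipseHyperbola (Z : Set (OnePoint E3)) : Prop :=
  ∃ (σ : Equiv.Perm (Fin 3)) (α β γ : ℝ), 0 < α ∧ 0 < β ∧ 0 < γ ∧ α ^ 2 = β ^ 2 + γ ^ 2 ∧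
    Z = insert ∞ ((fun x : E3 => (x : OnePoint E3)) ''
      ({p | p (σ 2) = 0 ∧ p (σ 0) ^ 2 / α ^ 2 + p (σ 1) ^ 2 / β ^ 2 = 1} ∪
       {p | p (σ 1) = 0 ∧ p (σ 0) ^ 2 / γ ^ 2 - p (σ 2) ^ 2 / β ^ 2 = 1}))

end DupinCyclidic

open scoped OnePoint

namespace DupinCyclidic

open scoped Quaternion

/-! ### Trilinear quaternionic forms -/

/-! For a pair with Re(U W̄) = 0, the derivative of U W⁻¹ along a parameter line is |W|⁻⁴ · W θ W̄,
where θ = W̄U′ + ŪW′ is imaginary. Conjugation by W is a similarity, so orthogonality of the partial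
derivatives and vanishing of the Jacobian become polynomial conditions on θ that also make sense
over ∞ (`IsOrth`, `jacobian_eq_zero_iff`). An inversion acts linearly on (U, W) from the left and
only rescales θ, so every Möbius transformation lifts to pairs (`exists_isLift`).

Reduction to canonical form. The map need not be injective, so the three M-spheres through the
regular point p might be swept out over three different parameter points. This is excluded by a
pencil argument. The parameter lines of one family map to circles orthogonal to the M-sphere in that
family. Once it is flattened to a plane, orthogonality of the whole system forces the second
intersections of these circles with the plane to occur at one common parameter. Hence every surface
of the family through a regular point of the M-sphere lies on it (`plane_of_regular`,
`surface_subset_of_regular`). The three surfaces through one parameter point over p then lie on the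
M-spheres, which are mutually orthogonal (`normals_orthogonal`) and can be moved to the coordinate
planes, with p at the origin. A right factor and projective changes of the parameters normalize the
constant and linear coefficients to 0, i, j, k over 1, 0, 0, 0. The plane, Study and orthogonality
conditions leave just three free numbers (`eq_canonicalPair`).

Singular locus. For a canonical pair, the i-th θ is a real factor times the i-th quaternion unit,
and the factor does not involve the i-th parameter (`theta_canonicalPair`). Where it vanishes, a
whole parameter line collapses to one point, which can be read off in the slice where that parameter
is 0, that is, in a coordinate plane. Eliminating the two remaining parameters gives a plane
quartic, and every real point of it lifts back (`mem_singularLocus_iff`).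

Classification. Non-sphericity excludes a + b = 0, b + c = 0 and c + a = 0; regularity of the origin
then excludes a + b + c = 0. If abc = 0, the quartics degenerate to focal conics. Otherwise a
rescaling gives a + b + c = ±abc, hence δ = ∓1. In polar coordinates the quartics are quadratic in
r², and for δ = −1 each has exactly one positive root per direction. For δ = 1, focality gives K² −
1 = (K + M)(K + N), and the same for M and N. These products are positive, since the sums are
nonzero squares over the common denominator 2abc, and the signs of K, M, N decide which curve is
empty. -/

/-- The trilinear form with the given coefficients, as a multilinear map. -/
noncomputable def triM (c : (Fin 3 → Fin 2) → Quaternion ℝ) :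
    MultilinearMap ℝ (fun _ : Fin 3 => Fin 2 → ℝ) (Quaternion ℝ) :=
  ∑ e, (MultilinearMap.mkPiRing ℝ (Fin 3) (c e)).compLinearMap (fun i => LinearMap.proj (e i))

theorem triM_apply (c : (Fin 3 → Fin 2) → Quaternion ℝ) (v : Fin 3 → Fin 2 → ℝ) :
    triM c v = ∑ e : Fin 3 → Fin 2, (∏ i, v i (e i)) • c e := by
  simp [triM]

/-- The standard basis of `ℝ²`, as a family of vectors. -/
def stdVec (k : Fin 2) : Fin 2 → ℝ := Pi.single k 1

theorem sum_stdVec (x : Fin 2 → ℝ) : ∑ k, x k • stdVec k = x := by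
  ext k; fin_cases k <;> simp [stdVec]

/-- Expanding each argument in the standard basis shows that the coefficients of a substituted form
are its values at the images of basis vectors. This is what `reparam` uses. -/
theorem triM_comp (c : (Fin 3 → Fin 2) → Quaternion ℝ)
    (L : Fin 3 → (Fin 2 → ℝ) →ₗ[ℝ] (Fin 2 → ℝ)) (v : Fin 3 → Fin 2 → ℝ) :
    triM (fun e => triM c (fun i => L i (stdVec (e i)))) v = triM c (fun i => L i (v i)) := by
  have h : (fun i => L i (v i)) = fun i => ∑ k, v i k • L i (stdVec k) := by
    funext i
    conv_lhs => rw [← sum_stdVec (v i)]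
    simp only [map_sum, map_smul]
  rw [h, MultilinearMap.map_sum, triM_apply]
  refine Finset.sum_congr rfl fun e _ => ?_
  rw [MultilinearMap.map_smul_univ]

theorem triM_mul_right (c : (Fin 3 → Fin 2) → Quaternion ℝ) (w : Quaternion ℝ)
    (v : Fin 3 → Fin 2 → ℝ) : triM (fun e => c e * w) v = triM c v * w := by
  simp [triM_apply, Finset.sum_mul]

theorem triM_lin (c d : (Fin 3 → Fin 2) → Quaternion ℝ) (p q : Quaternion ℝ)
    (v : Fin 3 → Fin 2 → ℝ) :
    triM (fun e => p * c e + q * d e) v = p * triM c v + q * triM d v := by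
  simp [triM_apply, Finset.mul_sum, Finset.sum_add_distrib]

theorem triM_update_lin (c : (Fin 3 → Fin 2) → Quaternion ℝ) (v : Fin 3 → Fin 2 → ℝ) (i : Fin 3)
    (x y : Fin 2 → ℝ) (a b : ℝ) :
    triM c (Function.update v i (a • x + b • y)) =
      a • triM c (Function.update v i x) + b • triM c (Function.update v i y) := by
  rw [MultilinearMap.map_update_add, MultilinearMap.map_update_smul,
    MultilinearMap.map_update_smul]

theorem triM_eq_zero (c : (Fin 3 → Fin 2) → Quaternion ℝ) (v : Fin 3 → Fin 2 → ℝ) (i : Fin 3)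
    (h : v i = 0) : triM c v = 0 := MultilinearMap.map_coord_zero _ i h

theorem analytic_triM (c : (Fin 3 → Fin 2) → Quaternion ℝ) :
    AnalyticOnNhd ℝ (fun v => triM c v) Set.univ := by
  intro v _
  simp only [triM_apply]
  have h1 (i : Fin 3) (k : Fin 2) : AnalyticAt ℝ (fun v : Fin 3 → Fin 2 → ℝ => v i k) v :=
    (LinearMap.toContinuousLinearMap ((LinearMap.proj k : (Fin 2 → ℝ) →ₗ[ℝ] ℝ) ∘ₗ
      (LinearMap.proj i : (Fin 3 → Fin 2 → ℝ) →ₗ[ℝ] (Fin 2 → ℝ)))).analyticAt v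
  exact Finset.analyticAt_fun_sum _ fun e _ =>
    (Finset.analyticAt_fun_prod _ fun i _ => h1 i (e i)).smul analyticAt_const

/-- The direction orthogonal to `x`. -/
def rot (x : Fin 2 → ℝ) : Fin 2 → ℝ := ![-(x 1), x 0]

/-- The vectors `x` and `rot x` are orthogonal of equal length. Since `theta` vanishes on the radial
direction `v i`, only the `rot` component of a direction matters later. -/
theorem exists_eq_rot {x : Fin 2 → ℝ} (hx : x ≠ 0) (w : Fin 2 → ℝ) :
    ∃ a b : ℝ, w = a • x + b • rot x := by
  have h : x 0 ^ 2 + x 1 ^ 2 ≠ 0 := by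
    intro h
    apply hx
    ext k
    fin_cases k <;> simp <;> nlinarith [sq_nonneg (x 0), sq_nonneg (x 1)]
  refine ⟨(x 0 * w 0 + x 1 * w 1) / (x 0 ^ 2 + x 1 ^ 2),
    (x 0 * w 1 - x 1 * w 0) / (x 0 ^ 2 + x 1 ^ 2), ?_⟩
  ext k
  fin_cases k <;> simp [rot] <;> field_simp <;> ring

/-! ### The Study condition and the numerator of the derivative -/

namespace TrilinearPair

variable (F : TrilinearPair)

theorem U_eq (v) : F.U v = triM F.coeffU v := (triM_apply _ _).symm
theorem W_eq (v) : F.W v = triM F.coeffW v := (triM_apply _ _).symm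

theorem U_update (v : Fin 3 → Fin 2 → ℝ) (i : Fin 3) (x y : Fin 2 → ℝ) (a b : ℝ) :
    F.U (Function.update v i (a • x + b • y)) =
      a • F.U (Function.update v i x) + b • F.U (Function.update v i y) := by
  simp only [U_eq, triM_update_lin]

theorem W_update (v : Fin 3 → Fin 2 → ℝ) (i : Fin 3) (x y : Fin 2 → ℝ) (a b : ℝ) :
    F.W (Function.update v i (a • x + b • y)) =
      a • F.W (Function.update v i x) + b • F.W (Function.update v i y) := by
  simp only [W_eq, triM_update_lin]

theorem U_eq_zero {v : Fin 3 → Fin 2 → ℝ} {i : Fin 3} (h : v i = 0) : F.U v = 0 := by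
  rw [U_eq, triM_eq_zero _ _ i h]
theorem W_eq_zero {v : Fin 3 → Fin 2 → ℝ} {i : Fin 3} (h : v i = 0) : F.W v = 0 := by
  rw [W_eq, triM_eq_zero _ _ i h]

/-- The pair takes imaginary values. -/
def IsStudy : Prop := ∀ v : Fin 3 → Fin 2 → ℝ, (F.U v * star (F.W v)).re = 0

/-- The numerator of the directional derivative in the `i`-th parameter. -/
noncomputable def theta (v : Fin 3 → Fin 2 → ℝ) (i : Fin 3) (w : Fin 2 → ℝ) : Quaternion ℝ :=
  star (F.W v) * F.U (Function.update v i w) + star (F.U v) * F.W (Function.update v i w)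

theorem theta_lin (v : Fin 3 → Fin 2 → ℝ) (i : Fin 3) (x y : Fin 2 → ℝ) (a b : ℝ) :
    F.theta v i (a • x + b • y) = a • F.theta v i x + b • F.theta v i y := by
  simp only [theta, U_update, W_update, mul_add, mul_smul_comm, smul_add]
  abel

variable {F}

/-- Along one parameter the Study condition is a quadratic form that vanishes identically, so its
polar form vanishes too. -/
theorem IsStudy.polar (hF : F.IsStudy) (v : Fin 3 → Fin 2 → ℝ) (i : Fin 3) (x y : Fin 2 → ℝ) :
    (F.U (Function.update v i x) * star (F.W (Function.update v i y)) +
      F.U (Function.update v i y) * star (F.W (Function.update v i x))).re = 0 := by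
  have h1 := hF (Function.update v i ((1 : ℝ) • x + (1 : ℝ) • y))
  have h2 := hF (Function.update v i x)
  have h3 := hF (Function.update v i y)
  rw [U_update, W_update] at h1
  simp only [one_smul, star_add, add_mul, mul_add, Quaternion.re_add] at h1 ⊢
  linarith

theorem IsStudy.polar' (hF : F.IsStudy) (v : Fin 3 → Fin 2 → ℝ) (i : Fin 3) (x : Fin 2 → ℝ) :
    (F.U v * star (F.W (Function.update v i x)) +
      F.U (Function.update v i x) * star (F.W v)).re = 0 := by
  simpa using hF.polar v i (v i) x

theorem IsStudy.theta_re (hF : F.IsStudy) (v : Fin 3 → Fin 2 → ℝ) (i : Fin 3) (w : Fin 2 → ℝ) :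
    (F.theta v i w).re = 0 := by
  have h := hF.polar' v i w
  simp only [theta, Quaternion.re_add, Quaternion.re_mul, Quaternion.re_star, Quaternion.imI_star,
    Quaternion.imJ_star, Quaternion.imK_star] at h ⊢
  linarith

/-- Moving `v i` along itself does not change the point of the projective line. -/
theorem IsStudy.theta_self (hF : F.IsStudy) (v : Fin 3 → Fin 2 → ℝ) (i : Fin 3) :
    F.theta v i (v i) = 0 := by
  have h := hF v
  simp only [theta, Function.update_eq_self]
  ext <;> simp at h ⊢ <;> linarith

theorem theta_eq_zero_of_coord {v : Fin 3 → Fin 2 → ℝ} {j : Fin 3} (h : v j = 0) (i : Fin 3)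
    (w : Fin 2 → ℝ) : F.theta v i w = 0 := by
  simp [theta, F.U_eq_zero h, F.W_eq_zero h]

/-- Algebraic form of the orthogonality of the partial derivatives. -/
def IsOrth (F : TrilinearPair) : Prop :=
  ∀ (v : Fin 3 → Fin 2 → ℝ) (i j : Fin 3), i ≠ j → ∀ x y : Fin 2 → ℝ,
    (F.theta v i x * star (F.theta v j y)).re = 0

end TrilinearPair

/-- `imPart` as a continuous linear map. -/
noncomputable def imPartL : Quaternion ℝ →L[ℝ] E3 :=
  LinearMap.toContinuousLinearMap
    { toFun := imPart
      map_add' := fun p q => by ext k; fin_cases k <;> simp [imPart]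
      map_smul' := fun a q => by ext k; fin_cases k <;> simp [imPart] }

@[simp] theorem imPartL_apply (q : Quaternion ℝ) : imPartL q = imPart q := rfl

theorem imPart_smul (a : ℝ) (q : Quaternion ℝ) : imPart (a • q) = a • imPart q :=
  imPartL.map_smul a q

theorem quaternion_inv_eq (q : Quaternion ℝ) : q⁻¹ = (Quaternion.normSq q)⁻¹ • star q := by
  rfl

theorem mul_inv_eq_smul (p q : Quaternion ℝ) :
    p * q⁻¹ = (Quaternion.normSq q)⁻¹ • (p * star q) := by
  rw [quaternion_inv_eq, mul_smul_comm]

theorem normSq_def4 (q : Quaternion ℝ) :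
    Quaternion.normSq q = q.re ^ 2 + q.imI ^ 2 + q.imJ ^ 2 + q.imK ^ 2 :=
  Quaternion.normSq_def' q

theorem mul_star_eq_smul_one (W : Quaternion ℝ) :
    W * star W = Quaternion.normSq W • (1 : Quaternion ℝ) := by
  rw [Quaternion.self_mul_star, ← Quaternion.coe_mul_eq_smul, mul_one]

theorem star_mul_add_star_mul (W W' : Quaternion ℝ) :
    star W * W' = (2 * (W * star W').re) • (1 : Quaternion ℝ) - star W' * W := by
  ext <;> simp <;> ring

theorem mul_star_antisymm {U W : Quaternion ℝ} (h : (U * star W).re = 0) :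
    W * star U = -(U * star W) := by
  simp at h
  ext <;> simp <;> linarith

/-- The right-hand side is the numerator given by the quotient rule for (U W̄)/|W|²; antisymmetry of
U W̄ regroups it as a conjugate of `theta` by `W`. -/
theorem mul_theta_mul_star {U U' W W' : Quaternion ℝ} (h : (U * star W).re = 0) :
    W * (star W * U' + star U * W') * star W =
      Quaternion.normSq W • (U * star W' + U' * star W) - (2 * (W * star W').re) • (U * star W) :=
        by
  calc W * (star W * U' + star U * W') * star W
      = (W * star W) * U' * star W + (W * star U) * W' * star W := by noncomm_ring
    _ = (W * star W) * U' * star W - U * (star W * W') * star W := by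
        rw [mul_star_antisymm h]; noncomm_ring
    _ = (W * star W) * U' * star W + U * star W' * (W * star W) -
          (2 * (W * star W').re) • (U * star W) := by
        rw [star_mul_add_star_mul, mul_sub, sub_mul, mul_smul_comm, mul_one, smul_mul_assoc]
        noncomm_ring
    _ = _ := by
        rw [mul_star_eq_smul_one]
        simp only [smul_mul_assoc, one_mul, mul_smul_comm, mul_one, smul_add]
        abel

theorem deriv_imPart_mul_inv (U U' W W' : Quaternion ℝ) (hW : W ≠ 0)
    (h : (U * star W).re = 0) :
    deriv (fun τ : ℝ => imPart ((U + τ • U') * (W + τ • W')⁻¹)) 0 =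
      ((Quaternion.normSq W)⁻¹) ^ 2 • imPart (W * (star W * U' + star U * W') * star W) := by
  have hn : Quaternion.normSq W ≠ 0 := by simpa using hW
  set n1 : ℝ := 2 * (W * star W').re with hn1
  -- Replacing q⁻¹ by q̄/|q|² gives a real quadratic denominator under a quaternionic quadratic
  -- numerator, and only the coefficients up to τ count at 0.
  have e : (fun τ : ℝ => imPart ((U + τ • U') * (W + τ • W')⁻¹)) = fun τ : ℝ =>
      imPartL ((Quaternion.normSq W + τ * n1 + τ ^ 2 * Quaternion.normSq W')⁻¹ •
        (U * star W + τ • (U * star W' + U' * star W) + τ ^ 2 • (U' * star W'))) := by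
    funext τ
    rw [mul_inv_eq_smul, imPartL_apply]
    congr 3
    · simp only [normSq_def4, hn1]
      simp
      ring
    · simp only [star_add, Quaternion.star_smul, mul_add, add_mul, smul_mul_assoc, mul_smul_comm,
        smul_add,
        smul_smul]
      rw [pow_two]
      abel
  rw [e]
  have d1 : HasDerivAt (fun τ : ℝ => Quaternion.normSq W + τ * n1 + τ ^ 2 * Quaternion.normSq W')
      n1 0 := by
    have := (((hasDerivAt_id (0 : ℝ)).mul_const n1).const_add (Quaternion.normSq W)).fun_add
      (((hasDerivAt_id (0 : ℝ)).pow 2).mul_const (Quaternion.normSq W'))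
    simpa using this
  have d2 : HasDerivAt (fun τ : ℝ => U * star W + τ • (U * star W' + U' * star W) +
      τ ^ 2 • (U' * star W')) (U * star W' + U' * star W) 0 := by
    have := (((hasDerivAt_id (0 : ℝ)).smul_const (U * star W' + U' * star W)).const_add
      (U * star W)).fun_add (((hasDerivAt_id (0 : ℝ)).pow 2).smul_const (U' * star W'))
    simpa using this
  have d3 := (d1.inv (by simpa using hW)).smul d2
  have d4 := (imPartL.hasFDerivAt.comp_hasDerivAt (0 : ℝ) d3).deriv
  simp only [Function.comp_def] at d4
  refine Eq.trans d4 ?_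
  rw [imPartL_apply, ← imPart_smul]
  congr 1
  rw [mul_theta_mul_star h, smul_sub, smul_smul, smul_smul]
  simp only [Pi.inv_apply, zero_mul, zero_smul, add_zero, ne_eq, OfNat.ofNat_ne_zero,
    not_false_eq_true, zero_pow]
  rw [sub_eq_add_neg, ← neg_smul]
  congr 2
  · field_simp
  · rw [hn1]; field_simp

/-! ### Orthogonality and the Jacobian expressed by `theta` -/

namespace TrilinearPair

variable {F : TrilinearPair}

theorem pderiv_of_W_ne_zero (hF : F.IsStudy) {v : Fin 3 → Fin 2 → ℝ} (hW : F.W v ≠ 0)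
    (i : Fin 3) : F.pderiv v i = ((Quaternion.normSq (F.W v))⁻¹) ^ 2 •
      imPart (F.W v * F.theta v i (rot (v i)) * star (F.W v)) := by
  have hU := fun τ : ℝ => F.U_update v i (v i) (rot (v i)) 1 τ
  have hW' := fun τ : ℝ => F.W_update v i (v i) (rot (v i)) 1 τ
  simp only [one_smul, Function.update_eq_self] at hU hW'
  rw [theta, ← deriv_imPart_mul_inv _ _ _ _ hW (hF v)]
  simp only [pderiv, chartEval, if_neg hW, ← hU, ← hW']
  rfl

/-- The chart at ∞ exchanges the roles of U and W up to sign, and `theta` is symmetric in them, so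
the same numerator appears over ∞. -/
theorem pderiv_of_W_eq_zero {v : Fin 3 → Fin 2 → ℝ} (hW : F.W v = 0)
    (hU : F.U v ≠ 0) (i : Fin 3) : F.pderiv v i = -(((Quaternion.normSq (F.U v))⁻¹) ^ 2 •
      imPart (F.U v * F.theta v i (rot (v i)) * star (F.U v))) := by
  have hU' := fun τ : ℝ => F.U_update v i (v i) (rot (v i)) 1 τ
  have hW' := fun τ : ℝ => F.W_update v i (v i) (rot (v i)) 1 τ
  simp only [one_smul, Function.update_eq_self] at hU' hW'
  have h := deriv_imPart_mul_inv (F.W v) (F.W (Function.update v i (rot (v i)))) (F.U v)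
    (F.U (Function.update v i (rot (v i)))) hU (by simp [hW])
  have e : F.pderiv v i = -deriv (fun τ : ℝ => imPart ((F.W v + τ •
      F.W (Function.update v i (rot (v i)))) * (F.U v + τ •
      F.U (Function.update v i (rot (v i))))⁻¹)) 0 := by
    rw [← deriv.fun_neg]
    simp only [pderiv, chartEval, if_pos hW, ← hU', ← hW']
    congr 1
    funext τ
    exact imPartL.map_neg _
  rw [e, h, theta, add_comm]

theorem inner_imPart (p q : Quaternion ℝ) :
    inner ℝ (imPart p) (imPart q) = p.imI * q.imI + p.imJ * q.imJ + p.imK * q.imK := by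
  simp [imPart, PiLp.inner_apply, Fin.sum_univ_three]
  ring

/-- p ↦ W p W̄ is a rotation of imaginary quaternions followed by scaling by |W|². -/
theorem inner_imPart_conj (W p q : Quaternion ℝ) (hp : p.re = 0) (hq : q.re = 0) :
    inner ℝ (imPart (W * p * star W)) (imPart (W * q * star W)) =
      Quaternion.normSq W ^ 2 * (p * star q).re := by
  rw [inner_imPart, normSq_def4]
  simp [hp, hq]
  ring

theorem imPart_eq_zero {q : Quaternion ℝ} (h : q.re = 0) : imPart q = 0 ↔ q = 0 := by
  constructor
  · intro h'
    have h0 := congrArg (fun x : E3 => x 0) h'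
    have h1 := congrArg (fun x : E3 => x 1) h'
    have h2 := congrArg (fun x : E3 => x 2) h'
    simp [imPart] at h0 h1 h2
    ext <;> assumption
  · rintro rfl
    ext k; fin_cases k <;> simp [imPart]

theorem conj_re (W p : Quaternion ℝ) (hp : p.re = 0) : (W * p * star W).re = 0 := by
  simp [hp]; ring

theorem pderiv_inner (hF : F.IsStudy) {v : Fin 3 → Fin 2 → ℝ} (hv : v ∈ F.domain) (i j : Fin 3) :
    ∃ c : ℝ, c ≠ 0 ∧ inner ℝ (F.pderiv v i) (F.pderiv v j) =
      c * (F.theta v i (rot (v i)) * star (F.theta v j (rot (v j)))).re := by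
  have key : ∀ q : Quaternion ℝ, q ≠ 0 → ((Quaternion.normSq q)⁻¹) ^ 2 ≠ 0 := by
    intro q hq
    simpa using hq
  by_cases hW : F.W v = 0
  · have hU : F.U v ≠ 0 := hv.2.resolve_right (not_not.2 hW)
    refine ⟨_, key _ hU, ?_⟩
    rw [pderiv_of_W_eq_zero hW hU, pderiv_of_W_eq_zero hW hU, inner_neg_neg, inner_smul_left,
      inner_smul_right, inner_imPart_conj _ _ _ (hF.theta_re v _ _) (hF.theta_re v _ _)]
    have : Quaternion.normSq (F.U v) ≠ 0 := by simpa using hU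
    simp only [conj_trivial]
    field_simp
  · refine ⟨_, key _ hW, ?_⟩
    rw [pderiv_of_W_ne_zero hF hW, pderiv_of_W_ne_zero hF hW, inner_smul_left,
      inner_smul_right, inner_imPart_conj _ _ _ (hF.theta_re v _ _) (hF.theta_re v _ _)]
    have : Quaternion.normSq (F.W v) ≠ 0 := by simpa using hW
    simp only [conj_trivial]
    field_simp

theorem re_mul_star_self (q : Quaternion ℝ) : (q * star q).re = Quaternion.normSq q := by
  rw [normSq_def4]; simp; ring

theorem pderiv_eq_zero (hF : F.IsStudy) {v : Fin 3 → Fin 2 → ℝ} (hv : v ∈ F.domain) (i : Fin 3) :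
    F.pderiv v i = 0 ↔ F.theta v i (rot (v i)) = 0 := by
  obtain ⟨c, hc, h⟩ := pderiv_inner hF hv i i
  rw [re_mul_star_self] at h
  rw [← inner_self_eq_zero (𝕜 := ℝ), h, mul_eq_zero, or_iff_right hc]
  simp

/-- Off the domain, either a coordinate vanishes or U = W = 0, and `theta` is zero. On the domain
the radial components contribute nothing by `theta_self`. -/
theorem isOrth_of_orthogonal (hF : F.IsStudy)
    (h : ∀ v ∈ F.domain, ∀ i j : Fin 3, i ≠ j → inner ℝ (F.pderiv v i) (F.pderiv v j) = 0) :
    F.IsOrth := by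
  intro v i j hij x y
  by_cases h0 : ∃ k, v k = 0
  · obtain ⟨k, hk⟩ := h0
    simp [theta_eq_zero_of_coord hk]
  push Not at h0
  by_cases hUW : F.U v ≠ 0 ∨ F.W v ≠ 0
  · have hv : v ∈ F.domain := ⟨h0, hUW⟩
    obtain ⟨a, b, rfl⟩ := exists_eq_rot (h0 i) x
    obtain ⟨a', b', rfl⟩ := exists_eq_rot (h0 j) y
    obtain ⟨c, hc, e⟩ := pderiv_inner hF hv i j
    rw [h v hv i j hij] at e
    have e' := (mul_eq_zero.1 e.symm).resolve_left hc
    rw [theta_lin, theta_lin, hF.theta_self, hF.theta_self]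
    simp only [smul_zero, zero_add, Quaternion.star_smul, smul_mul_assoc, mul_smul_comm,
      Quaternion.re_smul, e']
  · push Not at hUW
    simp [theta, hUW.1, hUW.2]

theorem orthogonal_of_isOrth (hF : F.IsStudy) (h : F.IsOrth) :
    ∀ v ∈ F.domain, ∀ i j : Fin 3, i ≠ j → inner ℝ (F.pderiv v i) (F.pderiv v j) = 0 := by
  intro v hv i j hij
  obtain ⟨c, hc, e⟩ := pderiv_inner hF hv i j
  rw [e, h v i j hij, mul_zero]

/-- The rows of the Jacobian matrix are orthogonal, so its Gram matrix is diagonal and the squared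
determinant is the product of the squared lengths. -/
theorem jacobian_eq_zero_iff (hF : F.IsStudy) (ho : F.IsOrth) {v : Fin 3 → Fin 2 → ℝ}
    (hv : v ∈ F.domain) :
    F.jacobian v = 0 ↔ ∃ i, F.theta v i (rot (v i)) = 0 := by
  have h := orthogonal_of_isOrth hF ho v hv
  have e : F.jacobian v ^ 2 = ∏ i, inner ℝ (F.pderiv v i) (F.pderiv v i) := by
    have h2 : F.jacobian v ^ 2 = ((Matrix.of fun i j : Fin 3 => F.pderiv v i j) *
        (Matrix.of fun i j : Fin 3 => F.pderiv v i j).transpose).det := by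
      rw [Matrix.det_mul, Matrix.det_transpose, jacobian, pow_two]
    have h3 : (Matrix.of fun i j : Fin 3 => F.pderiv v i j) *
        (Matrix.of fun i j : Fin 3 => F.pderiv v i j).transpose =
        Matrix.diagonal fun i => inner ℝ (F.pderiv v i) (F.pderiv v i) := by
      ext i j
      have h4 : ((Matrix.of fun i j : Fin 3 => F.pderiv v i j) *
        (Matrix.of fun i j : Fin 3 => F.pderiv v i j).transpose) i j =
          inner ℝ (F.pderiv v j) (F.pderiv v i) := by
        simp [Matrix.mul_apply, PiLp.inner_apply]
      rw [h4]
      by_cases hij : i = j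
      · subst hij; simp
      · rw [Matrix.diagonal_apply_ne _ hij, h j i (Ne.symm hij)]
    rw [h2, h3, Matrix.det_diagonal]
  rw [← pow_eq_zero_iff (n := 2) two_ne_zero, e, Finset.prod_eq_zero_iff]
  simp only [Finset.mem_univ, true_and, inner_self_eq_zero]
  exact exists_congr fun i => pderiv_eq_zero hF hv i

end TrilinearPair

/-! ### Möbius transformations acting on pairs -/

theorem sphereInversionPerm_mem (c : E3) (r : ℝ) (hr : r ≠ 0) :
    sphereInversionPerm c r hr ∈ moebiusGroup := Subgroup.subset_closure ⟨c, r, hr, rfl⟩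

/-- The generators are involutions, so closure under left multiplication by them suffices. -/
theorem moebius_induction {p : Equiv.Perm (OnePoint E3) → Prop} (one : p 1)
    (mul : ∀ (c : E3) (r : ℝ) (hr : r ≠ 0) (μ : Equiv.Perm (OnePoint E3)), p μ →
      p (sphereInversionPerm c r hr * μ)) {μ : Equiv.Perm (OnePoint E3)} (hμ : μ ∈ moebiusGroup) :
    p μ := by
  refine Subgroup.closure_induction_left (p := fun μ _ => p μ) one ?_ ?_ hμ
  · rintro _ ⟨c, r, hr, rfl⟩ y _ hy
    exact mul c r hr y hy
  · rintro _ ⟨c, r, hr, rfl⟩ y _ hy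
    have : (sphereInversionPerm c r hr)⁻¹ = sphereInversionPerm c r hr := by
      ext x; rfl
    rw [this]
    exact mul c r hr y hy

/-- The imaginary quaternion of a point of `E3`. -/
def toQ (x : E3) : Quaternion ℝ := ⟨0, x 0, x 1, x 2⟩

@[simp] theorem toQ_re (x : E3) : (toQ x).re = 0 := rfl
@[simp] theorem toQ_imI (x : E3) : (toQ x).imI = x 0 := rfl
@[simp] theorem toQ_imJ (x : E3) : (toQ x).imJ = x 1 := rfl
@[simp] theorem toQ_imK (x : E3) : (toQ x).imK = x 2 := rfl

@[simp] theorem imPart_toQ (x : E3) : imPart (toQ x) = x := by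
  ext k; fin_cases k <;> simp [imPart]

theorem toQ_imPart {q : Quaternion ℝ} (h : q.re = 0) : toQ (imPart q) = q := by
  ext <;> simp [imPart, h]

theorem toQ_sub (x y : E3) : toQ (x - y) = toQ x - toQ y := by ext <;> simp
theorem toQ_add (x y : E3) : toQ (x + y) = toQ x + toQ y := by ext <;> simp
theorem toQ_smul (a : ℝ) (x : E3) : toQ (a • x) = a • toQ x := by ext <;> simp
theorem toQ_injective : Function.Injective toQ := fun x y h => by
  rw [← imPart_toQ x, h, imPart_toQ]

theorem norm_sq_eq (x : E3) : ‖x‖ ^ 2 = x 0 ^ 2 + x 1 ^ 2 + x 2 ^ 2 := by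
  rw [EuclideanSpace.norm_sq_eq]; simp [Fin.sum_univ_three]

theorem toQ_mul_self (x : E3) : toQ x * toQ x = (-‖x‖ ^ 2 : ℝ) • (1 : Quaternion ℝ) := by
  rw [norm_sq_eq]; ext <;> simp <;> ring

namespace TrilinearPair

variable {F : TrilinearPair}

theorem eval_eq_infty {v : Fin 3 → Fin 2 → ℝ} : F.eval v = ∞ ↔ F.W v = 0 := by
  by_cases h : F.W v = 0 <;> simp [eval, h]

theorem IsStudy.eval_eq_coe (hF : F.IsStudy) {v : Fin 3 → Fin 2 → ℝ} {x : E3} :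
    F.eval v = (x : OnePoint E3) ↔ F.W v ≠ 0 ∧ F.U v = toQ x * F.W v := by
  by_cases h : F.W v = 0
  · simp [eval, h]
  · have hre : (F.U v * (F.W v)⁻¹).re = 0 := by
      rw [mul_inv_eq_smul, Quaternion.re_smul, hF v, smul_zero]
    simp only [eval, h, if_false, OnePoint.coe_eq_coe, ne_eq, not_false_eq_true, true_and]
    rw [← toQ_injective.eq_iff, toQ_imPart hre, mul_inv_eq_iff_eq_mul₀ h]

theorem IsStudy.U_eq_toQ (hF : F.IsStudy) {v : Fin 3 → Fin 2 → ℝ} (h : F.W v ≠ 0) :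
    ∃ x : E3, F.eval v = (x : OnePoint E3) ∧ F.U v = toQ x * F.W v := by
  have h1 : F.eval v ≠ ∞ := fun h' => h (eval_eq_infty.1 h')
  obtain ⟨x, hx⟩ := OnePoint.ne_infty_iff_exists.1 h1
  exact ⟨x, hx.symm, (hF.eval_eq_coe.1 hx.symm).2⟩

/-- The pair `F'` is obtained from `F` by applying `μ`. -/
structure IsLift (F F' : TrilinearPair) (μ : OnePoint E3 → OnePoint E3) : Prop where
  study : F'.IsStudy
  domain : F'.domain = F.domain
  eval : ∀ v ∈ F.domain, F'.eval v = μ (F.eval v)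
  theta : ∃ ε : ℝ, ε ≠ 0 ∧ ∀ v i w, F'.theta v i w = ε • F.theta v i w

/-- The pair of the map followed by an inversion. -/
noncomputable def invert (F : TrilinearPair) (c : E3) (r : ℝ) : TrilinearPair where
  coeffU e := toQ c * F.coeffU e + ((‖c‖ ^ 2 - r ^ 2 : ℝ) • (1 : Quaternion ℝ)) * F.coeffW e
  coeffW e := 1 * F.coeffU e + (-toQ c) * F.coeffW e

/-- For imaginary q one has q/|q|² = −q⁻¹, so the inversion is x ↦ c − r²(x − c)⁻¹. With x = U W⁻¹
this is the fraction of c(U − cW) − r²W by U − cW. -/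
theorem invert_U (F : TrilinearPair) (c : E3) (r : ℝ) (v) : (F.invert c r).U v =
    toQ c * (F.U v - toQ c * F.W v) - r ^ 2 • F.W v := by
  rw [U_eq, invert, triM_lin, ← U_eq, ← W_eq, mul_sub, ← mul_assoc, toQ_mul_self]
  simp only [sub_smul, neg_smul, sub_mul, neg_mul, smul_mul_assoc, one_mul]
  abel

theorem invert_W (F : TrilinearPair) (c : E3) (r : ℝ) (v) : (F.invert c r).W v =
    F.U v - toQ c * F.W v := by
  rw [W_eq, invert, triM_lin, ← U_eq, ← W_eq, one_mul, neg_mul, sub_eq_add_neg]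

/-- Since c̄ = −c, all terms with c cancel in `theta`, which is thus multiplied by the constant −r².
-/
theorem isLift_invert (hF : F.IsStudy) (c : E3) (r : ℝ) (hr : r ≠ 0) :
    F.IsLift (F.invert c r) (sphereInversion c r) := by
  have hst : (F.invert c r).IsStudy := by
    intro v
    have h := hF v
    rw [invert_U, invert_W]
    simp at h ⊢
    linear_combination (-r ^ 2) * h
  refine ⟨hst, ?_, ?_, ⟨-r ^ 2, neg_ne_zero.2 (pow_ne_zero 2 hr), ?_⟩⟩
  · ext v
    simp only [domain, Set.mem_ofPred_eq, invert_U, invert_W]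
    refine and_congr_right fun _ => ?_
    rw [← not_and_or, ← not_and_or, not_iff_not]
    constructor
    · rintro ⟨h1, h2⟩
      rw [h2, mul_zero, zero_sub, neg_eq_zero, smul_eq_zero] at h1
      have h3 := h1.resolve_left (pow_ne_zero 2 hr)
      rw [h3, mul_zero, sub_zero] at h2
      exact ⟨h2, h3⟩
    · rintro ⟨h1, h2⟩
      simp [h1, h2]
  · intro v hv
    by_cases hW : F.W v = 0
    · have hU : F.U v ≠ 0 := hv.2.resolve_right (not_not.2 hW)
      rw [eval_eq_infty.2 hW]
      simp only [sphereInversion, OnePoint.elim_infty]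
      rw [hst.eval_eq_coe, invert_U, invert_W, hW]
      simpa using hU
    · obtain ⟨x, hx, hU⟩ := hF.U_eq_toQ hW
      have e : F.U v - toQ c * F.W v = toQ (x - c) * F.W v := by
        rw [hU, toQ_sub, sub_mul]
      rw [hx]
      simp only [sphereInversion, OnePoint.elim_some]
      split_ifs with hxc
      · rw [eval_eq_infty, invert_W, e, hxc]
        ext <;> simp
      · have hd : ‖x - c‖ ^ 2 ≠ 0 := by
          simpa [sub_eq_zero] using hxc
        rw [hst.eval_eq_coe, invert_U, invert_W, e]
        constructor
        · refine mul_ne_zero (fun h => ?_) hW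
          have := congrArg imPart h
          rw [imPart_toQ, imPart_eq_zero (by simp) |>.2 rfl, sub_eq_zero] at this
          exact hxc this
        · rw [EuclideanGeometry.inversion, dist_eq_norm, vsub_eq_sub, vadd_eq_add, toQ_add,
            add_mul, toQ_smul, smul_mul_assoc, ← mul_assoc (toQ (x - c)), toQ_mul_self,
            smul_mul_assoc, one_mul, smul_smul, div_pow, sub_eq_add_neg, add_comm, ← neg_smul]
          congr 2
          have hd' : ‖x - c‖ ≠ 0 := fun h => hd (by rw [h]; norm_num)
          field_simp
  · intro v i w
    simp only [theta, invert_U, invert_W]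
    have hc : star (toQ c) = -toQ c := by ext <;> simp
    simp only [star_sub, star_mul, Quaternion.star_smul, hc, mul_sub, sub_mul, mul_neg, neg_mul,
      smul_mul_assoc, mul_smul_comm, smul_add, smul_sub, smul_neg, neg_smul, mul_assoc]
    abel

theorem exists_isLift (hF : F.IsStudy) {μ : Equiv.Perm (OnePoint E3)} (hμ : μ ∈ moebiusGroup) :
    ∃ F', F.IsLift F' μ := by
  refine moebius_induction (p := fun μ => ∃ F', F.IsLift F' μ) ?_ ?_ hμ
  · exact ⟨F, hF, rfl, fun v _ => rfl, 1, one_ne_zero, fun v i w => (one_smul _ _).symm⟩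
  · rintro c r hr μ ⟨F', h1, h2, h3, ε, h4, h5⟩
    obtain ⟨g1, g2, g3, ε', g4, g5⟩ := isLift_invert h1 c r hr
    refine ⟨F'.invert c r, g1, g2.trans h2, fun v hv => ?_, ε' * ε, mul_ne_zero g4 h4,
      fun v i w => ?_⟩
    · rw [g3 v (h2 ▸ hv), h3 v hv]; rfl
    · rw [g5, h5, smul_smul]

theorem IsLift.isOrth {F' : TrilinearPair} {μ : OnePoint E3 → OnePoint E3} (h : F.IsLift F' μ)
    (hF : F.IsOrth) : F'.IsOrth := by
  obtain ⟨ε, hε, e⟩ := h.theta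
  intro v i j hij x y
  rw [e, e, Quaternion.star_smul, smul_mul_smul_comm, Quaternion.re_smul, hF v i j hij, smul_zero]

theorem IsLift.theta_eq_zero {F' : TrilinearPair} {μ : OnePoint E3 → OnePoint E3}
    (h : F.IsLift F' μ) {v i w} : F'.theta v i w = 0 ↔ F.theta v i w = 0 := by
  obtain ⟨ε, hε, e⟩ := h.theta
  rw [e, smul_eq_zero, or_iff_right hε]

end TrilinearPair

/-! ### Generalized spheres -/

/-- The zero set of `α ‖x‖² + ⟪β, x⟫ + γ` in the extended space. -/
def genSphere (α : ℝ) (β : E3) (γ : ℝ) : Set (OnePoint E3) :=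
  {p | p.elim (α = 0) (fun x => α * ‖x‖ ^ 2 + inner ℝ β x + γ = 0)}

@[simp] theorem infty_mem_genSphere {α : ℝ} {β : E3} {γ : ℝ} :
    ∞ ∈ genSphere α β γ ↔ α = 0 := Iff.rfl

@[simp] theorem coe_mem_genSphere {α : ℝ} {β : E3} {γ : ℝ} {x : E3} :
    (x : OnePoint E3) ∈ genSphere α β γ ↔ α * ‖x‖ ^ 2 + inner ℝ β x + γ = 0 := Iff.rfl

theorem inner_eq (x y : E3) : inner ℝ x y = x 0 * y 0 + x 1 * y 1 + x 2 * y 2 := by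
  simp [PiLp.inner_apply, Fin.sum_univ_three]; ring

theorem mem_sphere_iff {c : E3} {r : ℝ} (hr : 0 < r) (p : OnePoint E3) :
    p ∈ (MSphere.sphere c r hr).carrier ↔ p ∈ genSphere 1 (-(2 : ℝ) • c) (‖c‖ ^ 2 - r ^ 2) := by
  induction p using OnePoint.rec with
  | infty => simp [MSphere.carrier]
  | coe x =>
    simp only [MSphere.carrier, Set.mem_image, OnePoint.coe_eq_coe, exists_eq_right,
      mem_sphere_iff_norm, coe_mem_genSphere]
    have : ‖x - c‖ = r ↔ ‖x - c‖ ^ 2 = r ^ 2 :=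
      (sq_eq_sq₀ (norm_nonneg _) hr.le).symm
    rw [this]
    simp only [norm_sq_eq, inner_eq]
    simp
    constructor <;> intro h <;> linarith

theorem mem_plane_iff {n : E3} {k : ℝ} (hn : n ≠ 0) (p : OnePoint E3) :
    p ∈ (MSphere.plane n k hn).carrier ↔ p ∈ genSphere 0 n (-k) := by
  induction p using OnePoint.rec with
  | infty => simp [MSphere.carrier]
  | coe x =>
    simp [MSphere.carrier]
    rw [add_neg_eq_zero]

/-- Degenerate equations are harmless: with α ≠ 0 and no positive squared radius at most the centre
remains, and with α = β = 0 at most ∞ remains. Any M-sphere through that point will do. -/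
theorem genSphere_subset {α : ℝ} {β : E3} {γ : ℝ} (h : ¬(α = 0 ∧ β = 0 ∧ γ = 0)) :
    ∃ S : MSphere, genSphere α β γ ⊆ S.carrier := by
  by_cases hα : α = 0
  · by_cases hβ : β = 0
    · have he : (EuclideanSpace.single 0 1 : E3) ≠ 0 := by simp
      refine ⟨.plane _ 0 he, fun p hp => ?_⟩
      have hγ : γ ≠ 0 := fun hγ => h ⟨hα, hβ, hγ⟩
      induction p using OnePoint.rec with
      | infty => simp [MSphere.carrier]
      | coe x => simp [hα, hβ, hγ] at hp
    · refine ⟨.plane β (-γ) hβ, fun p hp => ?_⟩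
      rw [mem_plane_iff, neg_neg]
      rwa [hα] at hp
  · set c : E3 := (-(1 / (2 * α))) • β with hc
    set ρ : ℝ := ‖c‖ ^ 2 - γ / α with hρ
    have key : ∀ x : E3, (x : OnePoint E3) ∈ genSphere α β γ → ‖x - c‖ ^ 2 = ρ := by
      intro x hx
      simp only [coe_mem_genSphere] at hx
      simp only [hρ, norm_sq_eq, inner_eq, hc] at hx ⊢
      simp
      field_simp
      linear_combination (4 * α) * hx
    have hinf : ∞ ∉ genSphere α β γ := by simpa using hα
    by_cases h0 : 0 < ρ
    · refine ⟨.sphere c (√ρ) (Real.sqrt_pos.2 h0), fun p hp => ?_⟩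
      induction p using OnePoint.rec with
      | infty => exact absurd hp hinf
      | coe x =>
        simp only [MSphere.carrier, Set.mem_image, OnePoint.coe_eq_coe, exists_eq_right,
          mem_sphere_iff_norm]
        rw [← key x hp, Real.sqrt_sq (norm_nonneg _)]
    · refine ⟨.sphere (c + EuclideanSpace.single 0 1) 1 one_pos, fun p hp => ?_⟩
      induction p using OnePoint.rec with
      | infty => exact absurd hp hinf
      | coe x =>
        have h1 : ‖x - c‖ ^ 2 = 0 := le_antisymm ((key x hp).trans_le (not_lt.1 h0)) (sq_nonneg _)
        have h2 : x = c := by simpa [sub_eq_zero] using h1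
        simp [MSphere.carrier, h2]

theorem exists_genSphere (S : MSphere) : ∃ (α : ℝ) (β : E3) (γ : ℝ),
    ¬(α = 0 ∧ β = 0 ∧ γ = 0) ∧ ∀ p, p ∈ S.carrier ↔ p ∈ genSphere α β γ := by
  cases S with
  | sphere c r hr => exact ⟨_, _, _, fun h => one_ne_zero h.1, mem_sphere_iff hr⟩
  | plane n k hn => exact ⟨_, _, _, fun h => hn h.2.1, mem_plane_iff hn⟩

/-- Substitute the inversion and clear denominators. The new leading coefficient is the old
polynomial evaluated at the centre `c`, so M-spheres through `c` become planes. -/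
theorem mem_genSphere_iff_sphereInversion (α : ℝ) (β : E3) (γ : ℝ) (c : E3) {r : ℝ} (hr : r ≠ 0)
    (p : OnePoint E3) : p ∈ genSphere α β γ ↔ sphereInversion c r p ∈
      genSphere (γ + inner ℝ β c + α * ‖c‖ ^ 2)
        (r ^ 2 • (β + (2 * α) • c) - (2 * (γ + inner ℝ β c + α * ‖c‖ ^ 2)) • c)
        (α * r ^ 4 + (γ + inner ℝ β c + α * ‖c‖ ^ 2) * ‖c‖ ^ 2 -
          r ^ 2 * inner ℝ (β + (2 * α) • c) c) := by
  induction p using OnePoint.rec with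
  | infty =>
    simp only [sphereInversion, OnePoint.elim_infty, infty_mem_genSphere, coe_mem_genSphere]
    have : α = 0 ↔ α * r ^ 4 = 0 := by simp [hr]
    refine this.trans (Eq.congr_left ?_)
    simp only [norm_sq_eq, inner_eq]
    simp
    ring
  | coe x =>
    simp only [sphereInversion, OnePoint.elim_some]
    split_ifs with h
    · simp only [coe_mem_genSphere, infty_mem_genSphere, h]
      ring_nf
    · have hd : ‖x - c‖ ^ 2 ≠ 0 := by simpa [sub_eq_zero] using h
      have hd' : ‖x - c‖ ≠ 0 := fun h => hd (by rw [h]; norm_num)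
      simp only [coe_mem_genSphere, EuclideanGeometry.inversion, dist_eq_norm, vsub_eq_sub,
        vadd_eq_add, div_pow]
      have h4 : r ^ 4 / ‖x - c‖ ^ 2 ≠ 0 := div_ne_zero (pow_ne_zero 4 hr) hd
      rw [← mul_right_inj' h4, mul_zero]
      refine Eq.congr_left ?_
      rw [norm_sq_eq (x - c)] at hd ⊢
      simp only [norm_sq_eq, inner_eq]
      simp at hd ⊢
      field_simp
      ring

theorem exists_MSphere_sphereInversion (S : MSphere) (c : E3) {r : ℝ} (hr : r ≠ 0) :
    ∃ S' : MSphere, ∀ p ∈ S.carrier, sphereInversion c r p ∈ S'.carrier := by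
  obtain ⟨α, β, γ, h, e⟩ := exists_genSphere S
  obtain ⟨S', hS'⟩ := genSphere_subset (α := γ + inner ℝ β c + α * ‖c‖ ^ 2)
    (β := r ^ 2 • (β + (2 * α) • c) - (2 * (γ + inner ℝ β c + α * ‖c‖ ^ 2)) • c)
    (γ := α * r ^ 4 + (γ + inner ℝ β c + α * ‖c‖ ^ 2) * ‖c‖ ^ 2 -
          r ^ 2 * inner ℝ (β + (2 * α) • c) c) (by
      rintro ⟨h1, h2, h3⟩
      have h2' : β + (2 * α) • c = 0 := by
        rw [h1, mul_zero, zero_smul, sub_zero, smul_eq_zero] at h2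
        exact h2.resolve_left (pow_ne_zero 2 hr)
      have h3' : α = 0 := by simpa [h1, h2', hr] using h3
      have h4 : β = 0 := by simpa [h3'] using h2'
      exact h ⟨h3', h4, by simpa [h3', h4] using h1⟩)
  exact ⟨S', fun p hp => hS' ((mem_genSphere_iff_sphereInversion α β γ c hr p).1 ((e p).1 hp))⟩

theorem exists_MSphere_image {μ : Equiv.Perm (OnePoint E3)} (hμ : μ ∈ moebiusGroup)
    (S : MSphere) : ∃ S' : MSphere, ∀ p ∈ S.carrier, μ p ∈ S'.carrier := by
  refine moebius_induction (p := fun μ => ∃ S' : MSphere, ∀ p ∈ S.carrier, μ p ∈ S'.carrier)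
    ⟨S, fun p hp => hp⟩ ?_ hμ
  rintro c r hr μ ⟨S', h⟩
  obtain ⟨S'', h'⟩ := exists_MSphere_sphereInversion S' c hr
  exact ⟨S'', fun p hp => h' _ (h p hp)⟩

/-- A Möbius transformation moving a given point to infinity turns M-spheres through the point
into planes. -/
theorem exists_moebius_plane (p : OnePoint E3) : ∃ μ ∈ moebiusGroup, μ p = ∞ ∧
    ∀ S : MSphere, p ∈ S.carrier → ∃ (n : E3) (k : ℝ), n ≠ 0 ∧
      ∀ q, μ q ∈ genSphere 0 n (-k) ↔ q ∈ S.carrier := by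
  induction p using OnePoint.rec with
  | infty =>
    refine ⟨1, one_mem _, rfl, fun S hS => ?_⟩
    cases S with
    | sphere c r hr => simp [MSphere.carrier] at hS
    | plane n k hn => exact ⟨n, k, hn, fun q => (mem_plane_iff hn q).symm⟩
  | coe c =>
    refine ⟨_, sphereInversionPerm_mem c 1 one_ne_zero, ?_, fun S hS => ?_⟩
    · change sphereInversion c 1 c = ∞
      simp [sphereInversion]
    · have main : ∀ α β γ, (∀ q, q ∈ S.carrier ↔ q ∈ genSphere α β γ) → β + (2 * α) • c ≠ 0 →
          ∃ (n : E3) (k : ℝ), n ≠ 0 ∧ ∀ q, sphereInversion c 1 q ∈ genSphere 0 n (-k) ↔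
            q ∈ S.carrier := by
        intro α β γ h hn
        have h0 : γ + inner ℝ β c + α * ‖c‖ ^ 2 = 0 := by
          have := (h c).1 hS
          rw [coe_mem_genSphere] at this
          linarith
        refine ⟨β + (2 * α) • c, -(α - inner ℝ (β + (2 * α) • c) c), hn, fun q => ?_⟩
        rw [h, mem_genSphere_iff_sphereInversion α β γ c one_ne_zero q, h0]
        simp
      cases S with
      | sphere a r hr =>
        refine main _ _ _ (mem_sphere_iff hr) fun h => ?_
        have h1 : c = a := by
          rw [neg_smul, mul_one, ← sub_eq_neg_add, ← smul_sub] at h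
          simpa [sub_eq_zero] using h
        simp [MSphere.carrier, h1, hr.ne] at hS
      | plane n k hn =>
        exact main _ _ _ (mem_plane_iff hn) (by simpa using hn)

/-! ### Isometries as Möbius transformations -/

theorem inversion_eq (c : E3) (R : ℝ) (x : E3) :
    EuclideanGeometry.inversion c R x = (R ^ 2 / ‖x - c‖ ^ 2) • (x - c) + c := by
  rw [EuclideanGeometry.inversion, dist_eq_norm, vsub_eq_sub, vadd_eq_add, div_pow]

/-- The inversion about c + n with radius √2 carries the unit sphere about c to the plane through c
with normal n: it sends c + n to ∞ and c − n to c. Conjugating the inversion in that sphere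
therefore yields the reflection in the plane. -/
theorem exists_moebius_reflection {n : E3} (hn : ‖n‖ = 1) (c : E3) : ∃ μ ∈ moebiusGroup,
    μ ∞ = ∞ ∧ ∀ x : E3, μ x = ((x - (2 * inner ℝ n (x - c)) • n : E3) : OnePoint E3) := by
  have h2 : √2 ≠ 0 := by norm_num
  have hn' : n ≠ 0 := by rintro rfl; simp at hn
  refine ⟨sphereInversionPerm (c + n) (√2) h2 * sphereInversionPerm c 1 one_ne_zero *
    sphereInversionPerm (c + n) (√2) h2, mul_mem (mul_mem (sphereInversionPerm_mem _ _ _)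
    (sphereInversionPerm_mem _ _ _)) (sphereInversionPerm_mem _ _ _), ?_, fun x => ?_⟩
  · change sphereInversion (c + n) (√2) (sphereInversion c 1 (sphereInversion (c + n) (√2) ∞)) = ∞
    simp [sphereInversion, hn', inversion_eq, hn, add_comm]
  · change sphereInversion (c + n) (√2) (sphereInversion c 1 (sphereInversion (c + n) (√2) x)) = _
    by_cases hx : x = c + n
    · subst hx
      simp [sphereInversion, hn', inversion_eq, hn]
      module
    · have hnn : inner ℝ n n = (1 : ℝ) := by rw [real_inner_self_eq_norm_sq, hn, one_pow]
      obtain ⟨X, rfl⟩ : ∃ X, x = c + n + X := ⟨x - (c + n), by abel⟩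
      have hX : X ≠ 0 := by simpa using hx
      have hXX : inner ℝ X X ≠ (0 : ℝ) := by simpa using hX
      set d : ℝ := inner ℝ X X with hd
      set h : ℝ := inner ℝ n X with hh
      have hXn : inner ℝ X n = h := real_inner_comm _ _
      have e1 : sphereInversion (c + n) (√2) ((c + n + X : E3) : OnePoint E3) =
          ((c + (n + (2 / d) • X) : E3) : OnePoint E3) := by
        simp only [sphereInversion, OnePoint.elim_some, if_neg hx, inversion_eq,
          add_sub_cancel_left, ← real_inner_self_eq_norm_sq, ← hd]
        norm_num
        abel
      rw [e1]
      have e2 : (inner ℝ (n + (2 / d) • X) (n + (2 / d) • X) : ℝ) = (d + 4 * h + 4) / d := by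
        simp only [inner_add_left, inner_add_right, inner_smul_left, inner_smul_right, hnn, hXn,
          ← hh, ← hd, conj_trivial]
        field_simp
        ring
      -- In this case the first inversion sends the point to `c`, the centre of the middle one; the
      -- point is c − n.
      by_cases h0 : n + (2 / d) • X = 0
      · rw [h0]
        have h1 : d + 4 * h + 4 = 0 := by
          rw [h0, inner_zero_left] at e2
          field_simp at e2
          linarith
        have h3 : (inner ℝ n (n + (2 / d) • X) : ℝ) = 0 := by rw [h0, inner_zero_right]
        simp only [inner_add_right, inner_smul_right, hnn, ← hh] at h3
        field_simp at h3
        have hd4 : d = 4 := by linarith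
        have hh2 : h = -2 := by linarith
        have hXe : X = -(2 : ℝ) • n := by
          rw [hd4] at h0
          have : X = (2 : ℝ) • (n + (2 / (4 : ℝ)) • X) - (2 : ℝ) • n := by module
          rw [this, h0]; module
        have e0 : (inner ℝ n (c + n + X - c) : ℝ) = -1 := by
          rw [hXe, show c + n + -(2 : ℝ) • n - c = -n by module, inner_neg_right, hnn]
        rw [e0, hXe]
        simp [sphereInversion]
      · have hpos : d + 4 * h + 4 ≠ 0 := by
          intro h1
          rw [h1, zero_div, inner_self_eq_zero] at e2
          exact h0 e2
        have e3 : sphereInversion c 1 ((c + (n + (2 / d) • X) : E3) : OnePoint E3) =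
            ((c + n + (2 / (d + 4 * h + 4)) • (X - (2 * (1 + h)) • n) : E3) : OnePoint E3) := by
          have hne : c + (n + (2 / d) • X) ≠ c := by simpa using h0
          simp only [sphereInversion, OnePoint.elim_some, if_neg hne, inversion_eq,
            add_sub_cancel_left, ← real_inner_self_eq_norm_sq, e2]
          rw [OnePoint.coe_eq_coe]
          match_scalars <;> field_simp <;> ring
        rw [e3]
        have e4 : (inner ℝ (X - (2 * (1 + h)) • n) (X - (2 * (1 + h)) • n) : ℝ) =
            d + 4 * h + 4 := by
          simp only [inner_sub_left, inner_sub_right, inner_smul_left, inner_smul_right, hnn, hXn,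
            ← hh, ← hd, conj_trivial]
          ring
        have hne : c + n + (2 / (d + 4 * h + 4)) • (X - (2 * (1 + h)) • n) ≠ c + n := by
          intro hne
          rw [add_eq_left, smul_eq_zero] at hne
          rcases hne with hne | hne
          · exact div_ne_zero two_ne_zero hpos hne
          · rw [hne, inner_zero_left] at e4; exact hpos e4.symm
        simp only [sphereInversion, OnePoint.elim_some, if_neg hne, inversion_eq,
          add_sub_cancel_left, norm_smul, mul_pow, ← real_inner_self_eq_norm_sq (X - _), e4,
          smul_smul]
        congr 1
        have e5 : (√2 ^ 2 / (‖2 / (d + 4 * h + 4)‖ ^ 2 * (d + 4 * h + 4)) * (2 / (d + 4 * h + 4)) :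
          ℝ)
            = 1 := by
          rw [Real.norm_eq_abs, sq_abs]
          norm_num
          field_simp
        rw [e5, one_smul]
        have e6 : (inner ℝ n (c + n + X - c) : ℝ) = 1 + h := by
          rw [add_assoc, add_sub_cancel_left, inner_add_right, hnn]
        rw [e6]
        abel

theorem exists_moebius_linearIsometry (L : E3 ≃ₗᵢ[ℝ] E3) : ∃ μ ∈ moebiusGroup,
    μ ∞ = ∞ ∧ ∀ x : E3, μ x = ((L x : E3) : OnePoint E3) := by
  obtain ⟨l, -, rfl⟩ := L.reflections_generate_dim
  induction l with
  | nil => exact ⟨1, one_mem _, rfl, fun x => rfl⟩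
  | cons v l ih =>
    obtain ⟨μ, hμ, h1, h2⟩ := ih
    obtain ⟨ν, hν, g1, g2⟩ : ∃ ν ∈ moebiusGroup, ν ∞ = ∞ ∧ ∀ x : E3,
        ν x = (((ℝ ∙ v)ᗮ.reflection x : E3) : OnePoint E3) := by
      by_cases hv : v = 0
      · refine ⟨1, one_mem _, rfl, fun x => ?_⟩
        rw [Submodule.reflection_orthogonal_apply, Submodule.reflection_singleton_apply, hv]
        simp
      · obtain ⟨ν, hν, g1, g2⟩ := exists_moebius_reflection (n := (‖v‖⁻¹ : ℝ) • v)
          (by rw [norm_smul, norm_inv, norm_norm, inv_mul_cancel₀ (norm_ne_zero_iff.2 hv)]) 0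
        refine ⟨ν, hν, g1, fun x => ?_⟩
        rw [g2, Submodule.reflection_orthogonal_apply, Submodule.reflection_singleton_apply]
        congr 1
        rw [sub_zero, inner_smul_left, smul_smul, neg_sub, two_smul, ← add_smul]
        congr 2
        have : ‖v‖ ≠ 0 := norm_ne_zero_iff.2 hv
        simp
        field_simp
        ring
    refine ⟨ν * μ, mul_mem hν hμ, ?_, fun x => ?_⟩
    · rw [Equiv.Perm.mul_apply, h1, g1]
    · rw [Equiv.Perm.mul_apply, h2, g2]; simp

/-- A product of reflections in two parallel planes at distance ‖w‖/2. -/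
theorem exists_moebius_translation (w : E3) : ∃ μ ∈ moebiusGroup,
    μ ∞ = ∞ ∧ ∀ x : E3, μ x = ((x + w : E3) : OnePoint E3) := by
  by_cases hw : w = 0
  · exact ⟨1, one_mem _, rfl, fun x => by simp [hw]⟩
  · have hw' : ‖w‖ ≠ 0 := norm_ne_zero_iff.2 hw
    have hn : ‖(‖w‖⁻¹ : ℝ) • w‖ = 1 := by
      rw [norm_smul, norm_inv, norm_norm, inv_mul_cancel₀ hw']
    obtain ⟨μ, hμ, h1, h2⟩ := exists_moebius_reflection hn 0
    obtain ⟨ν, hν, g1, g2⟩ := exists_moebius_reflection hn ((1 / 2 : ℝ) • w)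
    refine ⟨ν * μ, mul_mem hν hμ, ?_, fun x => ?_⟩
    · rw [Equiv.Perm.mul_apply, h1, g1]
    · rw [Equiv.Perm.mul_apply, h2, g2, OnePoint.coe_eq_coe]
      simp only [inner_sub_right, inner_smul_left, inner_smul_right, real_inner_self_eq_norm_sq,
        conj_trivial, sub_zero]
      match_scalars <;> field_simp <;> ring

/-- A product of two concentric inversions with radii 1 and l. -/
theorem exists_moebius_scaling {l : ℝ} (hl : l ≠ 0) : ∃ μ ∈ moebiusGroup,
    μ ∞ = ∞ ∧ ∀ x : E3, μ x = ((l ^ 2 • x : E3) : OnePoint E3) := by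
  refine ⟨sphereInversionPerm 0 l hl * sphereInversionPerm 0 1 one_ne_zero,
    mul_mem (sphereInversionPerm_mem _ _ _) (sphereInversionPerm_mem _ _ _), ?_, fun x => ?_⟩
  · change sphereInversion 0 l (sphereInversion 0 1 ∞) = ∞
    simp [sphereInversion]
  · change sphereInversion 0 l (sphereInversion 0 1 x) = _
    by_cases hx : x = 0
    · simp [sphereInversion, hx]
    · have hx' : ‖x‖ ≠ 0 := norm_ne_zero_iff.2 hx
      have e1 : sphereInversion 0 1 (x : OnePoint E3) = ((1 / ‖x‖ ^ 2) • x : E3) := by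
        simp [sphereInversion, hx, inversion_eq]
      have h2 : (1 / ‖x‖ ^ 2) • x ≠ 0 := smul_ne_zero (by positivity) hx
      rw [e1]
      simp only [sphereInversion, OnePoint.elim_some, if_neg h2, inversion_eq, sub_zero, add_zero,
        smul_smul, norm_smul, norm_div, norm_pow, norm_norm, norm_one]
      congr 2
      field_simp

/-- The coordinate planes, with the point at infinity. -/
def coordPlane (i : Fin 3) : Set (OnePoint E3) := {p | p.elim True (fun x => x i = 0)}

@[simp] theorem infty_mem_coordPlane (i : Fin 3) : ∞ ∈ coordPlane i := trivial
@[simp] theorem coe_mem_coordPlane {i : Fin 3} {x : E3} :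
    (x : OnePoint E3) ∈ coordPlane i ↔ x i = 0 := Iff.rfl

theorem sphereInversion_mem_coordPlane (i : Fin 3) (p : OnePoint E3) :
    sphereInversion 0 1 p ∈ coordPlane i ↔ p ∈ coordPlane i := by
  induction p using OnePoint.rec with
  | infty => simp [sphereInversion]
  | coe x =>
    by_cases hx : x = 0
    · simp [sphereInversion, hx]
    · simp [sphereInversion, hx, inversion_eq]

theorem exists_orthonormalBasis_normalize (n : Fin 3 → E3) (h0 : ∀ i, n i ≠ 0)
    (h : ∀ i j, i ≠ j → inner ℝ (n i) (n j) = 0) :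
    ∃ b : OrthonormalBasis (Fin 3) ℝ E3, ∀ i, b i = (‖n i‖⁻¹ : ℝ) • n i := by
  have ho : Orthonormal ℝ (Set.domRestrict Set.univ fun i => (‖n i‖⁻¹ : ℝ) • n i) := by
    constructor
    · rintro ⟨i, -⟩
      simp [norm_smul, inv_mul_cancel₀ (norm_ne_zero_iff.2 (h0 i))]
    · rintro ⟨i, hi⟩ ⟨j, hj⟩ hij
      have hij' : i ≠ j := fun e => hij (by subst e; rfl)
      simp [inner_smul_left, inner_smul_right, h i j hij']
  obtain ⟨b, hb⟩ := ho.exists_orthonormalBasis_extension_of_card_eq (by simp)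
  exact ⟨b, fun i => hb i (Set.mem_univ i)⟩

/-- Three mutually orthogonal planes can be moved to the coordinate planes, with the point at
infinity going to the origin. -/
theorem exists_moebius_coordPlanes (n : Fin 3 → E3) (k : Fin 3 → ℝ) (h0 : ∀ i, n i ≠ 0)
    (h : ∀ i j, i ≠ j → inner ℝ (n i) (n j) = 0) : ∃ μ ∈ moebiusGroup,
    μ ∞ = ((0 : E3) : OnePoint E3) ∧
      ∀ i q, μ q ∈ coordPlane i ↔ q ∈ genSphere 0 (n i) (-(k i)) := by
  have hn : ∀ i, ‖n i‖ ≠ 0 := fun i => norm_ne_zero_iff.2 (h0 i)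
  obtain ⟨b, hb⟩ := exists_orthonormalBasis_normalize n h0 h
  obtain ⟨μ, hμ, h1, h2⟩ := exists_moebius_linearIsometry b.repr
  -- The sum is the common finite point of the three planes. After it is moved to 0 and the normals
  -- to the axes, the unit inversion exchanges 0 and ∞ and preserves the coordinate planes.
  obtain ⟨ν, hν, g1, g2⟩ := exists_moebius_translation (-∑ i, (k i / ‖n i‖ ^ 2) • n i)
  refine ⟨sphereInversionPerm 0 1 one_ne_zero * (μ * ν), mul_mem (sphereInversionPerm_mem _ _ _)
    (mul_mem hμ hν), ?_, fun i q => ?_⟩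
  · rw [Equiv.Perm.mul_apply, Equiv.Perm.mul_apply, g1, h1]
    change sphereInversion 0 1 ∞ = _
    simp [sphereInversion]
  · rw [Equiv.Perm.mul_apply, Equiv.Perm.mul_apply]
    change sphereInversion 0 1 _ ∈ _ ↔ _
    rw [sphereInversion_mem_coordPlane]
    induction q using OnePoint.rec with
    | infty => simp [g1, h1]
    | coe x =>
      rw [g2, h2, coe_mem_coordPlane, coe_mem_genSphere, OrthonormalBasis.repr_apply_apply,
        hb i, inner_smul_left, inner_add_right, inner_neg_right, inner_sum]
      have : ∑ j, inner ℝ (n i) ((k j / ‖n j‖ ^ 2) • n j) = k i := by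
        rw [Finset.sum_eq_single i]
        · rw [inner_smul_right, real_inner_self_eq_norm_sq]
          field_simp [hn i]
        · intro j _ hj
          rw [inner_smul_right, h i j hj.symm, mul_zero]
        · simp
      rw [this]
      simp [hn i]

theorem exists_moebius_coordPlane {n : E3} (k : ℝ) (h0 : n ≠ 0) : ∃ μ ∈ moebiusGroup,
    μ ∞ = ((0 : E3) : OnePoint E3) ∧ ∀ q, μ q ∈ coordPlane 0 ↔ q ∈ genSphere 0 n (-k) := by
  have hn : ‖n‖ ≠ 0 := norm_ne_zero_iff.2 h0
  have ho : Orthonormal ℝ (Set.domRestrict {(0 : Fin 3)} fun _ => (‖n‖⁻¹ : ℝ) • n) := by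
    constructor
    · rintro ⟨i, -⟩
      simp [norm_smul, inv_mul_cancel₀ hn]
    · rintro ⟨i, hi⟩ ⟨j, hj⟩ hij
      exact absurd (Subtype.ext (hi.trans hj.symm)) hij
  obtain ⟨b, hb⟩ := ho.exists_orthonormalBasis_extension_of_card_eq (by simp)
  have hb0 : n = ‖n‖ • b 0 := by
    rw [hb 0 rfl, smul_smul, mul_inv_cancel₀ hn, one_smul]
  obtain ⟨μ, hμ, h1, h2⟩ := exists_moebius_coordPlanes (Function.update b 0 n) (fun _ => k)
    (by
      intro i
      by_cases hi : i = 0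
      · subst hi; simpa using h0
      · rw [Function.update_of_ne hi]; exact b.orthonormal.ne_zero i)
    (by
      intro i j hij
      have hbo := fun i j (h : i ≠ j) => b.orthonormal.2 h
      by_cases hi : i = 0
      · subst hi
        rw [Function.update_self, Function.update_of_ne (Ne.symm hij), hb0, inner_smul_left,
          hbo 0 j hij, mul_zero]
      · by_cases hj : j = 0
        · subst hj
          rw [Function.update_self, Function.update_of_ne hi, hb0, inner_smul_right,
            hbo i 0 hi, mul_zero]
        · rw [Function.update_of_ne hi, Function.update_of_ne hj, hbo i j hij])
  refine ⟨μ, hμ, h1, fun q => ?_⟩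
  simpa using h2 0 q

/-! ### Analytic functions of the parameters -/

/-- By the identity theorem on a connected space, a factor that is nonzero at a single point can be
cancelled everywhere. This removes genericity assumptions from the identities below. -/
theorem eq_zero_of_mul_eq_zero_of_analytic {f g : (Fin 3 → Fin 2 → ℝ) → ℝ}
    (hf : AnalyticOnNhd ℝ f Set.univ) (hg : AnalyticOnNhd ℝ g Set.univ)
    (h : ∀ v, f v * g v = 0) {v₀ : Fin 3 → Fin 2 → ℝ} (h₀ : g v₀ ≠ 0) (v) : f v = 0 := by
  have h1 : ∀ᶠ v in nhds v₀, g v ≠ 0 :=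
    (hg v₀ trivial).continuousAt.eventually_ne h₀
  have h2 : f =ᶠ[nhds v₀] fun _ => 0 :=
    h1.mono fun v hv => (mul_eq_zero.1 (h v)).resolve_right hv
  exact congrFun (hf.eq_of_eventuallyEq analyticOnNhd_const h2) v

/-- Conjugation as a continuous linear map. -/
noncomputable def starQ : Quaternion ℝ →L[ℝ] Quaternion ℝ := LinearMap.toContinuousLinearMap
  { toFun := star, map_add' := star_add, map_smul' := Quaternion.star_smul }

theorem analytic_star {f : (Fin 3 → Fin 2 → ℝ) → Quaternion ℝ} (hf : AnalyticOnNhd ℝ f Set.univ) :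
    AnalyticOnNhd ℝ (fun v => star (f v)) Set.univ := fun v hv =>
  (starQ.analyticAt _).fun_comp (hf v hv)

/-- The components of a quaternion as continuous linear maps. -/
noncomputable def reL : Quaternion ℝ →L[ℝ] ℝ := LinearMap.toContinuousLinearMap
  { toFun := fun q => q.re, map_add' := fun _ _ => rfl, map_smul' := fun _ _ => rfl }

/-- A component of a quaternion as a continuous linear map. -/
noncomputable def imIL : Quaternion ℝ →L[ℝ] ℝ := LinearMap.toContinuousLinearMap
  { toFun := fun q => q.imI, map_add' := fun _ _ => rfl, map_smul' := fun _ _ => rfl }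

/-- A component of a quaternion as a continuous linear map. -/
noncomputable def imJL : Quaternion ℝ →L[ℝ] ℝ := LinearMap.toContinuousLinearMap
  { toFun := fun q => q.imJ, map_add' := fun _ _ => rfl, map_smul' := fun _ _ => rfl }

/-- A component of a quaternion as a continuous linear map. -/
noncomputable def imKL : Quaternion ℝ →L[ℝ] ℝ := LinearMap.toContinuousLinearMap
  { toFun := fun q => q.imK, map_add' := fun _ _ => rfl, map_smul' := fun _ _ => rfl }

theorem analytic_re {f : (Fin 3 → Fin 2 → ℝ) → Quaternion ℝ} (hf : AnalyticOnNhd ℝ f Set.univ) :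
    AnalyticOnNhd ℝ (fun v => (f v).re) Set.univ := fun v hv =>
  (reL.analyticAt _).fun_comp (hf v hv)

theorem analytic_imI {f : (Fin 3 → Fin 2 → ℝ) → Quaternion ℝ} (hf : AnalyticOnNhd ℝ f Set.univ) :
    AnalyticOnNhd ℝ (fun v => (f v).imI) Set.univ := fun v hv =>
  (imIL.analyticAt _).fun_comp (hf v hv)

theorem analytic_imJ {f : (Fin 3 → Fin 2 → ℝ) → Quaternion ℝ} (hf : AnalyticOnNhd ℝ f Set.univ) :
    AnalyticOnNhd ℝ (fun v => (f v).imJ) Set.univ := fun v hv =>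
  (imJL.analyticAt _).fun_comp (hf v hv)

theorem analytic_imK {f : (Fin 3 → Fin 2 → ℝ) → Quaternion ℝ} (hf : AnalyticOnNhd ℝ f Set.univ) :
    AnalyticOnNhd ℝ (fun v => (f v).imK) Set.univ := fun v hv =>
  (imKL.analyticAt _).fun_comp (hf v hv)

theorem analytic_normSq {f : (Fin 3 → Fin 2 → ℝ) → Quaternion ℝ}
    (hf : AnalyticOnNhd ℝ f Set.univ) :
    AnalyticOnNhd ℝ (fun v => Quaternion.normSq (f v)) Set.univ := by
  have := analytic_re (hf.mul (analytic_star hf))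
  simpa only [TrilinearPair.re_mul_star_self, Pi.mul_apply] using this

/-! ### Pencils of circles orthogonal to a plane -/

section Pencil

/-- The parameter line is λ ↦ (A + λB)(C + λD)⁻¹, with its point λ = 0 on the plane `imI = 0`. The
vanishing of the j- and k-components of G = CθC̄ says that the line meets the plane at a right
angle. Everything follows by writing |C|²BC̄, |C|²AD̄ and |C|⁴BD̄ in terms of G, X = AC̄ and Y =
CD̄. Combining the first two identities, the ratio of the i-components of BD̄ and AD̄ + BC̄ is
Re(DC̄)/|C|². -/
theorem pencil_identities {A B C D : Quaternion ℝ} (s1 : (A * star C).re = 0)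
    (p1 : (A * star C).imI = 0) 
    (gj : (C * (star C * B + star A * D) * star C).imJ = 0)
    (gk : (C * (star C * B + star A * D) * star C).imK = 0)
    (s : (star C * B + star A * D).re = 0) :
    Quaternion.normSq C * (A * star D + B * star C).imI =
      (C * (star C * B + star A * D) * star C).imI ∧
    Quaternion.normSq C ^ 2 * (B * star D).imI =
      (C * (star C * B + star A * D) * star C).imI * (D * star C).re ∧
    (C * (star C * B + star A * D) * star C).imI * (D * star C).imI = 
      Quaternion.normSq C ^ 2 * (B * star D).re ∧
    Quaternion.normSq C ^ 2 * Quaternion.normSq (star C * B + star A * D) =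
      (C * (star C * B + star A * D) * star C).imI ^ 2 := by
  set X := A * star C with hX
  set Y := C * star D with hY
  set G := C * (star C * B + star A * D) * star C with hG
  have hY' : D * star C = star Y := by rw [hY]; simp
  have e0 : star X = -X := by ext <;> simp [s1, p1]
  have e1 : G = Quaternion.normSq C • (B * star C) - X * star Y := by
    have : G = (C * star C) * B * star C + star X * star Y := by
      rw [hG, hX, hY]; simp only [star_mul, star_star]; noncomm_ring
    rw [this, e0, mul_star_eq_smul_one]
    simp [sub_eq_add_neg]
  have e2 : Quaternion.normSq C • (A * star D) = X * Y := by
    rw [hX, hY, show A * star C * (C * star D) = A * (star C * C) * star D by noncomm_ring,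
      Quaternion.star_mul_self, ← Quaternion.coe_mul_eq_smul,
      (Quaternion.coe_commutes _ A).symm]
    noncomm_ring
  have e3 : Quaternion.normSq C ^ 2 • (B * star D) = (G + X * star Y) * Y := by
    rw [e1, sub_add_cancel, smul_mul_assoc, hY,
      show B * star C * (C * star D) = B * (star C * C) * star D by noncomm_ring,
      Quaternion.star_mul_self, ← Quaternion.coe_mul_eq_smul, ← Quaternion.coe_mul_eq_smul,
      (Quaternion.coe_commutes _ B).symm, pow_two, Quaternion.coe_mul]
    noncomm_ring
  have gr : G.re = 0 := TrilinearPair.conj_re _ _ s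
  have X0 : X.re = 0 := s1
  have X1 : X.imI = 0 := p1
  refine ⟨?_, ?_, ?_, ?_⟩
  · have h1 := congrArg (fun q => q.imI) e1
    have h2 := congrArg (fun q => q.imI) e2
    simp [-Quaternion.imI_mul] at h1 h2
    rw [Quaternion.imI_add, mul_add, h1, h2]
    simp [X0, X1]
    ring
  · have h1 := congrArg (fun q => q.imI) e3
    simp only [Quaternion.imI_smul, smul_eq_mul] at h1
    rw [hY', h1]
    simp [X0, X1, gr, gj, gk]
    ring
  · have h1 := congrArg (fun q => q.re) e3
    simp only [Quaternion.re_smul, smul_eq_mul] at h1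
    rw [hY', h1]
    simp [X0, X1, gr, gj, gk]
    ring
  · have h1 : Quaternion.normSq G = G.imI ^ 2 := by
      rw [normSq_def4, gr, gj, gk]; ring
    rw [← h1, hG]
    simp
    ring

/-- The core computation, with the value of the denominator normalized to `1`. -/
theorem pencil_deriv_normalized {A B D A' B' C' D' : Quaternion ℝ}
    (s1 : A.re = 0) (p1 : A.imI = 0)
    (s1' : (A' + A * star C').re = 0) (p1' : (A' + A * star C').imI = 0)
    (s2 : (A * star D + B).re = 0) (s3 : (B * star D).re = 0)
    (s2' : (A' * star D + A * star D' + B' + B * star C').re = 0)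
    (s3' : (B' * star D + B * star D').re = 0)
    (gj : (B + star A * D).imJ = 0) (gk : (B + star A * D).imK = 0)
    (gj' : (C' * (B + star A * D) + (star C' * B + B' + star A' * D + star A * D') +
      (B + star A * D) * star C').imJ = 0)
    (gk' : (C' * (B + star A * D) + (star C' * B + B' + star A' * D + star A * D') +
      (B + star A * D) * star C').imK = 0)
    (hl : (B + star A * D).imI ≠ 0)
    (o1 : ((B + star A * D) * star (B' + star D * A' + star A * D' + star B * C')).re = 0)
    (o2 : ((B + star A * D) * star (star D * B' + star B * D')).re = 0) :
    (D' + D * star C').re = 2 * D.re * C'.re := by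
  simp [s1, p1] at *
  generalize A.imJ = a2, A.imK = a3, B.re = b0, B.imI = b1, B.imJ = b2, B.imK = b3,
    D.re = d0, D.imI = d1, D.imJ = d2, D.imK = d3, A'.re = a0', A'.imI = a1', A'.imJ = a2',
    A'.imK = a3', B'.re = b0', B'.imI = b1', B'.imJ = b2', B'.imK = b3', C'.re = c0',
    C'.imI = c1', C'.imJ = c2', C'.imK = c3', D'.re = d0', D'.imI = d1', D'.imJ = d2',
    D'.imK = d3' at *
  obtain rfl : b2 = a2 * d0 + a3 * d1 := by linarith
  obtain rfl : b3 = a3 * d0 - a2 * d1 := by linarith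
  obtain rfl : b0 = -(a2 * d2 + a3 * d3) := by linarith
  -- `l` is the i-component of the tangent B + ĀD, the only component that does not vanish.
  obtain ⟨l, rfl⟩ : ∃ l, b1 = l + (a2 * d3 - a3 * d2) := ⟨b1 - (a2 * d3 - a3 * d2), by ring⟩
  have hl' : l ≠ 0 := by
    intro h; apply hl; rw [h]; ring
  -- The third identity of `pencil_identities` with C = 1: the product of `l` and the i-component of
  -- D is Re(BD̄) = 0.
  obtain rfl : d1 = 0 := by
    apply mul_left_cancel₀ hl'
    linarith
  obtain rfl : a0' = -(a2 * c2' + a3 * c3') := by linarith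
  obtain rfl : a1' = a2 * c3' - a3 * c2' := by linarith
  ring_nf at o1 o2 gj' gk' s2' s3'
  apply mul_left_cancel₀ hl'
  apply mul_left_cancel₀ hl'
  linear_combination d0 * o1 - o2 - l * d2 * gk' + l * d3 * gj'

end Pencil

/-- X ↦ q̄Xq scales the Euclidean inner product of quaternions by |q|⁴, so orthogonality survives
the normalization in `pencil_deriv`. -/
theorem re_mul_star_conj (q X Y : Quaternion ℝ) :
    ((star q * X * q) * star (star q * Y * q)).re = Quaternion.normSq q ^ 2 * (X * star Y).re := by
  have h : (star q * X * q) * star (star q * Y * q) =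
      Quaternion.normSq q • (star q * (X * star Y) * q) := by
    have : (star q * X * q) * star (star q * Y * q) =
        star q * X * (q * star q) * star Y * q := by
      simp only [star_mul, star_star]; noncomm_ring
    rw [this, mul_star_eq_smul_one]
    simp only [mul_smul_comm, smul_mul_assoc, mul_one, mul_assoc]
  rw [h, Quaternion.re_smul, normSq_def4]
  generalize X * star Y = Z
  simp
  ring

/-- Primes denote the derivative in another parameter. The conclusion reads p′N = pN′ for p =
Re(DC̄) and N = |C|², so p/N is stationary. Right multiplication of all entries by C⁻¹ leaves the
fraction unchanged and reduces to C = 1; each hypothesis is only scaled by a power of |C⁻¹|. -/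
theorem pencil_deriv {A B C D A' B' C' D' : Quaternion ℝ} (hC : C ≠ 0)
    (s1 : (A * star C).re = 0) (p1 : (A * star C).imI = 0)
    (s1' : (A' * star C + A * star C').re = 0) (p1' : (A' * star C + A * star C').imI = 0)
    (s2 : (A * star D + B * star C).re = 0) (s3 : (B * star D).re = 0)
    (s2' : (A' * star D + A * star D' + (B' * star C + B * star C')).re = 0)
    (s3' : (B' * star D + B * star D').re = 0)
    (gj : (C * (star C * B + star A * D) * star C).imJ = 0)
    (gk : (C * (star C * B + star A * D) * star C).imK = 0)
    (gj' : (C' * (star C * B + star A * D) * star C +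
      C * (star C' * B + star C * B' + (star A' * D + star A * D')) * star C +
      C * (star C * B + star A * D) * star C').imJ = 0)
    (gk' : (C' * (star C * B + star A * D) * star C +
      C * (star C' * B + star C * B' + (star A' * D + star A * D')) * star C +
      C * (star C * B + star A * D) * star C').imK = 0)
    (hl : (C * (star C * B + star A * D) * star C).imI ≠ 0)
    (o1 : ((star C * B + star A * D) *
      star (star C * B' + star D * A' + (star A * D' + star B * C'))).re = 0)
    (o2 : ((star C * B + star A * D) * star (star D * B' + star B * D')).re = 0) :
    (D' * star C + D * star C').re * Quaternion.normSq C =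
      2 * (D * star C).re * (C' * star C).re := by
  set q := C⁻¹ with hq
  have hCq : C * q = 1 := mul_inv_cancel₀ hC
  have hm : ∀ X Y : Quaternion ℝ, (X * q) * star (Y * q) = Quaternion.normSq q • (X * star Y) := by
    intro X Y
    rw [star_mul, show X * q * (star q * star Y) = X * (q * star q) * star Y by noncomm_ring,
      mul_star_eq_smul_one]
    simp only [mul_smul_comm, smul_mul_assoc, mul_one]
  have hs : ∀ X Y : Quaternion ℝ, star (X * q) * (Y * q) = star q * (star X * Y) * q := by
    intro X Y; rw [star_mul]; noncomm_ring
  have hc : ∀ X Y Z : Quaternion ℝ, (X * q) * (star q * Y * q) * star (Z * q) =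
      Quaternion.normSq q ^ 2 • (X * Y * star Z) := by
    intro X Y Z
    rw [star_mul, show X * q * (star q * Y * q) * (star q * star Z) =
      X * (q * star q) * Y * (q * star q) * star Z by noncomm_ring, mul_star_eq_smul_one]
    simp only [mul_smul_comm, smul_mul_assoc, mul_one, smul_smul, pow_two]
  have hst : star (C * q) = 1 := by rw [hCq, star_one]
  have hn : Quaternion.normSq q ≠ 0 := by simpa [hq] using hC
  have hθ : star (C * q) * (B * q) + star (A * q) * (D * q) =
      star q * (star C * B + star A * D) * q := by rw [hs, hs]; noncomm_ring
  have key := pencil_deriv_normalized (A := A * q) (B := B * q) (D := D * q) (A' := A' * q)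
    (B' := B' * q) (C' := C' * q) (D' := D' * q)
  have eB : B * q + star (A * q) * (D * q) = star q * (star C * B + star A * D) * q := by
    rw [← hθ, hst, one_mul]
  have r1 : ∀ X : Quaternion ℝ, X * q = (X * q) * star (C * q) := fun X => by rw [hst, mul_one]
  have l1 : ∀ X : Quaternion ℝ, X * q = star (C * q) * (X * q) := fun X => by rw [hst, one_mul]
  have c1 : ∀ X : Quaternion ℝ, X = (C * q) * X * star (C * q) := fun X => by
    rw [hst, hCq, mul_one, one_mul]
  have eD : star (C' * q) * (B * q) + B' * q + star (A' * q) * (D * q) +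
      star (A * q) * (D' * q) = star q * (star C' * B + star C * B' +
        (star A' * D + star A * D')) * q := by
    rw [l1 B', hs, hs, hs, hs]; noncomm_ring
  have eg : (C' * q) * (B * q + star (A * q) * (D * q)) +
      (star (C' * q) * (B * q) + B' * q + star (A' * q) * (D * q) + star (A * q) * (D' * q)) +
      (B * q + star (A * q) * (D * q)) * star (C' * q) = Quaternion.normSq q ^ 2 •
        (C' * (star C * B + star A * D) * star C +
      C * (star C' * B + star C * B' + (star A' * D + star A * D')) * star C +
      C * (star C * B + star A * D) * star C') := by
    rw [eB, eD, smul_add, smul_add, ← hc, ← hc, ← hc, hst, hCq, mul_one, mul_one, one_mul, one_mul]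
  have h := key
    (by rw [r1 A, hm, Quaternion.re_smul, s1, smul_zero])
    (by rw [r1 A, hm, Quaternion.imI_smul, p1, smul_zero])
    (by rw [r1 A', hm, hm, ← smul_add, Quaternion.re_smul, s1', smul_zero])
    (by rw [r1 A', hm, hm, ← smul_add, Quaternion.imI_smul, p1', smul_zero])
    (by rw [r1 B, hm, hm, ← smul_add, Quaternion.re_smul, s2, smul_zero])
    (by rw [hm, Quaternion.re_smul, s3, smul_zero])
    (by rw [r1 B', hm, hm, hm, hm, add_assoc, ← smul_add, ← smul_add, ← smul_add,
          Quaternion.re_smul, s2', smul_zero])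
    (by rw [hm, hm, ← smul_add, Quaternion.re_smul, s3', smul_zero])
    (by rw [eB, c1 (star q * _ * q), hc, Quaternion.imJ_smul, gj, smul_zero])
    (by rw [eB, c1 (star q * _ * q), hc, Quaternion.imK_smul, gk, smul_zero])
    (by rw [eg, Quaternion.imJ_smul, gj', smul_zero])
    (by rw [eg, Quaternion.imK_smul, gk', smul_zero])
    (by rw [eB, c1 (star q * _ * q), hc, Quaternion.imI_smul]
        exact smul_ne_zero (pow_ne_zero 2 hn) hl)
    (by
      have : B' * q + star (D * q) * (A' * q) + star (A * q) * (D' * q) + star (B * q) * (C' * q) =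
          star q * (star C * B' + star D * A' + (star A * D' + star B * C')) * q := by
        rw [l1 B', hs, hs, hs, hs]; noncomm_ring
      rw [eB, this, re_mul_star_conj, o1, mul_zero])
    (by
      have : star (D * q) * (B' * q) + star (B * q) * (D' * q) =
          star q * (star D * B' + star B * D') * q := by
        rw [hs, hs]; noncomm_ring
      rw [eB, this, re_mul_star_conj, o2, mul_zero])
  have e1 : (D * q).re = Quaternion.normSq q * (D * star C).re := by
    rw [r1 D, hm, Quaternion.re_smul, smul_eq_mul]
  have e2 : (C' * q).re = Quaternion.normSq q * (C' * star C).re := by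
    rw [r1 C', hm, Quaternion.re_smul, smul_eq_mul]
  rw [hm, r1 D', hm, ← smul_add, Quaternion.re_smul, smul_eq_mul, e1, e2] at h
  have hN : Quaternion.normSq q * Quaternion.normSq C = 1 := by
    rw [mul_comm, ← map_mul, hCq, map_one]
  linear_combination Quaternion.normSq C ^ 2 * h + (-(D' * star C + D * star C').re *
    Quaternion.normSq C + 2 * (D * star C).re * (C' * star C).re *
    (Quaternion.normSq q * Quaternion.normSq C + 1)) * hN

/-- Used with `coeff_one_eq_zero` to differentiate the right-angle condition: it is a polynomial
identity in τ, whose linear coefficient must vanish. -/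
theorem pencil_conj_expand (A B C D A' B' C' D' : Quaternion ℝ) : ∃ g2 g3 g4 : Quaternion ℝ,
    ∀ τ : ℝ, (C + τ • C') * (star (C + τ • C') * (B + τ • B') + star (A + τ • A') * (D + τ • D')) *
        star (C + τ • C') =
      C * (star C * B + star A * D) * star C + τ • (C' * (star C * B + star A * D) * star C +
      C * (star C' * B + star C * B' + (star A' * D + star A * D')) * star C +
      C * (star C * B + star A * D) * star C') + τ ^ 2 • g2 + τ ^ 3 • g3 + τ ^ 4 • g4 := by
  set t0 := star C * B + star A * D with h0
  set t1 := star C' * B + star C * B' + (star A' * D + star A * D') with h1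
  set t2 := star C' * B' + star A' * D' with h2
  refine ⟨C' * t1 * star C + C' * t0 * star C' + C * t2 * star C + C * t1 * star C',
    C' * t2 * star C + C' * t1 * star C' + C * t2 * star C', C' * t2 * star C', fun τ => ?_⟩
  have ht : star (C + τ • C') * (B + τ • B') + star (A + τ • A') * (D + τ • D') =
      t0 + τ • t1 + τ ^ 2 • t2 := by
    rw [h0, h1, h2]
    simp only [star_add, Quaternion.star_smul, add_mul, mul_add, smul_mul_assoc, mul_smul_comm,
      smul_add, smul_smul, pow_two]
    abel
  rw [ht]
  simp only [star_add, Quaternion.star_smul, add_mul, mul_add, smul_mul_assoc, mul_smul_comm,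
      smul_add]
  module

theorem coeff_one_eq_zero {x1 x2 x3 x4 : ℝ}
    (h : ∀ τ : ℝ, τ * x1 + τ ^ 2 * x2 + τ ^ 3 * x3 + τ ^ 4 * x4 = 0) : x1 = 0 := by
  have h1 := h 1
  have h2 := h (-1)
  have h3 := h 2
  have h4 := h (-2)
  linarith

theorem analytic_update {E : Type*} [NormedAddCommGroup E] [NormedSpace ℝ E]
    {f : (Fin 3 → Fin 2 → ℝ) → E}
    (hf : AnalyticOnNhd ℝ f Set.univ) (i : Fin 3) (r : Fin 2 → ℝ) :
    AnalyticOnNhd ℝ (fun v => f (Function.update v i r)) Set.univ := by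
  intro v _
  have h1 : AnalyticAt ℝ (fun v : Fin 3 → Fin 2 → ℝ => Function.update v i r) v := by
    rw [analyticAt_pi_iff]
    intro k
    by_cases hk : k = i
    · subst hk; simpa using analyticAt_const
    · simp only [Function.update_of_ne hk]
      exact (ContinuousLinearMap.proj (R := ℝ) (φ := fun _ : Fin 3 => Fin 2 → ℝ) k).analyticAt v
  exact (hf _ trivial).fun_comp h1

theorem exists_other_indices (i : Fin 3) : ∃ j k : Fin 3, j ≠ i ∧ k ≠ i ∧ j ≠ k ∧
    ∀ m, m = i ∨ m = j ∨ m = k := by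
  revert i; decide

/-- In a pencil of circles orthogonal to a plane that is part of an orthogonal system, the second
intersections of the circles with the plane have a common parameter. -/
theorem exists_pencil_ratio {A B C D : (Fin 3 → Fin 2 → ℝ) → Quaternion ℝ} {i : Fin 3}
    (aA : AnalyticOnNhd ℝ A Set.univ) (aB : AnalyticOnNhd ℝ B Set.univ)
    (aC : AnalyticOnNhd ℝ C Set.univ) (aD : AnalyticOnNhd ℝ D Set.univ)
    (lA : ∀ l ≠ i, ∀ v w (τ : ℝ), A (Function.update v l (v l + τ • w)) =
      A v + τ • A (Function.update v l w))
    (lB : ∀ l ≠ i, ∀ v w (τ : ℝ), B (Function.update v l (v l + τ • w)) =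
      B v + τ • B (Function.update v l w))
    (lC : ∀ l ≠ i, ∀ v w (τ : ℝ), C (Function.update v l (v l + τ • w)) =
      C v + τ • C (Function.update v l w))
    (lD : ∀ l ≠ i, ∀ v w (τ : ℝ), D (Function.update v l (v l + τ • w)) =
      D v + τ • D (Function.update v l w))
    (iC : ∀ v x, C (Function.update v i x) = C v) (iD : ∀ v x, D (Function.update v i x) = D v)
    (s1 : ∀ v, (A v * star (C v)).re = 0) (p1 : ∀ v, (A v * star (C v)).imI = 0)
    (s2 : ∀ v, (A v * star (D v) + B v * star (C v)).re = 0)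
    (s3 : ∀ v, (B v * star (D v)).re = 0)
    (s : ∀ v, (star (C v) * B v + star (A v) * D v).re = 0)
    (gj : ∀ v, (C v * (star (C v) * B v + star (A v) * D v) * star (C v)).imJ = 0)
    (gk : ∀ v, (C v * (star (C v) * B v + star (A v) * D v) * star (C v)).imK = 0)
    (o1 : ∀ l ≠ i, ∀ v w, ((star (C v) * B v + star (A v) * D v) *
      star (star (C v) * B (Function.update v l w) + star (D v) * A (Function.update v l w) +
        (star (A v) * D (Function.update v l w) + star (B v) * C (Function.update v l w)))).re = 0)
    (o2 : ∀ l ≠ i, ∀ v w, ((star (C v) * B v + star (A v) * D v) *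
      star (star (D v) * B (Function.update v l w) +
        star (B v) * D (Function.update v l w))).re = 0)
    {v₀ : Fin 3 → Fin 2 → ℝ} (hC₀ : C v₀ ≠ 0)
    (hθ₀ : star (C v₀) * B v₀ + star (A v₀) * D v₀ ≠ 0) :
    ∃ κ : ℝ, ∀ v, (B v * star (D v)).imI = κ * (A v * star (D v) + B v * star (C v)).imI ∧
      Quaternion.normSq (star (C v) * B v + star (A v) * D v) =
        (A v * star (D v) + B v * star (C v)).imI ^ 2 := by
  set lam : (Fin 3 → Fin 2 → ℝ) → ℝ := fun v =>
    (C v * (star (C v) * B v + star (A v) * D v) * star (C v)).imI with hlam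
  set N : (Fin 3 → Fin 2 → ℝ) → ℝ := fun v => Quaternion.normSq (C v) with hN
  set p : (Fin 3 → Fin 2 → ℝ) → ℝ := fun v => (D v * star (C v)).re with hp
  have id := fun v => pencil_identities (s1 v) (p1 v) (gj v) (gk v) (s v)
  have aN : AnalyticOnNhd ℝ N Set.univ := analytic_normSq aC
  have ap : AnalyticOnNhd ℝ p Set.univ := analytic_re (aD.mul (analytic_star aC))
  have aθ : AnalyticOnNhd ℝ (fun v => star (C v) * B v + star (A v) * D v) Set.univ :=
    ((analytic_star aC).mul aB).add ((analytic_star aA).mul aD)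
  have alam : AnalyticOnNhd ℝ lam Set.univ :=
    analytic_imI ((aC.mul aθ).mul (analytic_star aC))
  have hN₀ : N v₀ ≠ 0 := by simpa [hN] using hC₀
  have hlam₀ : lam v₀ ≠ 0 := by
    intro h
    have := (id v₀).2.2.2
    have h0 : (C v₀ * (star (C v₀) * B v₀ + star (A v₀) * D v₀) * star (C v₀)).imI = 0 := h
    rw [h0] at this
    have h' : Quaternion.normSq (star (C v₀) * B v₀ + star (A v₀) * D v₀) ≠ 0 := by
      simpa using hθ₀
    exact mul_ne_zero (pow_ne_zero 2 hN₀) h' (this.trans (by norm_num))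
  -- the ratio of `p` and `N` is constant in each of the other two parameters
  have hder : ∀ l ≠ i, ∀ w v, (D (Function.update v l w) * star (C v) +
      D v * star (C (Function.update v l w))).re * N v =
      2 * p v * (C (Function.update v l w) * star (C v)).re := by
    intro l hl w v
    rw [← sub_eq_zero]
    refine eq_zero_of_mul_eq_zero_of_analytic (g := fun v => N v * lam v)
      (f := fun v => (D (Function.update v l w) * star (C v) +
      D v * star (C (Function.update v l w))).re * N v -
      2 * p v * (C (Function.update v l w) * star (C v)).re) ?_ (aN.mul alam) ?_
      (mul_ne_zero hN₀ hlam₀) v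
    · have aC' := analytic_update aC l w
      have aD' := analytic_update aD l w
      exact ((analytic_re ((aD'.mul (analytic_star aC)).add (aD.mul (analytic_star aC')))).mul
        aN).sub ((analyticOnNhd_const.mul ap).mul (analytic_re (aC'.mul (analytic_star aC))))
    · intro v
      by_cases h0 : N v * lam v = 0
      · rw [h0, mul_zero]
      · have hC : C v ≠ 0 := by
          intro h; apply h0; simp [hN, h]
        have hl0 : lam v ≠ 0 := right_ne_zero_of_mul h0
        have pol : ∀ {X Y : (Fin 3 → Fin 2 → ℝ) → Quaternion ℝ} {L : Quaternion ℝ →L[ℝ] ℝ},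
            (∀ v, L (X v * star (Y v)) = 0) → (∀ v w (τ : ℝ),
            X (Function.update v l (v l + τ • w)) = X v + τ • X (Function.update v l w)) →
            (∀ v w (τ : ℝ), Y (Function.update v l (v l + τ • w)) =
              Y v + τ • Y (Function.update v l w)) →
            L (X (Function.update v l w) * star (Y v) + X v * star (Y (Function.update v l w))) = 0
              := by
          intro X Y L h hX hY
          have h1 := h (Function.update v l (v l + (1 : ℝ) • w))
          have h2 := h v
          have h3 := h (Function.update v l w)
          rw [hX, hY] at h1
          simp only [one_smul, star_add, mul_add, add_mul, map_add] at h1 ⊢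
          linarith
        obtain ⟨g2, g3, g4, hg⟩ := pencil_conj_expand (A v) (B v) (C v) (D v)
          (A (Function.update v l w)) (B (Function.update v l w)) (C (Function.update v l w))
          (D (Function.update v l w))
        have hd := pencil_deriv hC (s1 v) (p1 v) (pol (L := reL) s1 (lA l hl) (lC l hl))
          (pol (L := imIL) p1 (lA l hl) (lC l hl)) (s2 v) (s3 v)
          (by
            have h1 := s2 (Function.update v l (v l + (1 : ℝ) • w))
            have h2 := s2 v
            have h3 := s2 (Function.update v l w)
            rw [lA l hl, lB l hl, lC l hl, lD l hl] at h1
            simp only [one_smul, star_add, mul_add, add_mul, Quaternion.re_add] at h1 h2 h3 ⊢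
            linarith)
          (pol (L := reL) s3 (lB l hl) (lD l hl)) (gj v) (gk v)
          (by
            apply coeff_one_eq_zero (x2 := g2.imJ) (x3 := g3.imJ) (x4 := g4.imJ)
            intro τ
            have h1 := gj (Function.update v l (v l + τ • w))
            rw [lA l hl, lB l hl, lC l hl, lD l hl, hg] at h1
            rw [Quaternion.imJ_add, Quaternion.imJ_add, Quaternion.imJ_add, Quaternion.imJ_add,
              gj v,
              zero_add, Quaternion.imJ_smul, Quaternion.imJ_smul, Quaternion.imJ_smul,
              Quaternion.imJ_smul] at h1
            exact h1)
          (by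
            apply coeff_one_eq_zero (x2 := g2.imK) (x3 := g3.imK) (x4 := g4.imK)
            intro τ
            have h1 := gk (Function.update v l (v l + τ • w))
            rw [lA l hl, lB l hl, lC l hl, lD l hl, hg] at h1
            rw [Quaternion.imK_add, Quaternion.imK_add, Quaternion.imK_add, Quaternion.imK_add,
              gk v,
              zero_add, Quaternion.imK_smul, Quaternion.imK_smul, Quaternion.imK_smul,
              Quaternion.imK_smul] at h1
            exact h1)
          hl0 (o1 l hl v w) (o2 l hl v w)
        rw [hd, hp, sub_self, zero_mul]
  have hprop : ∀ l ≠ i, ∀ w v, p (Function.update v l w) * N v = p v * N (Function.update v l w) :=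
    by
    intro l hl w v
    have hτ : ∀ τ : ℝ, ((D (Function.update v l w) * star (C v) +
        D v * star (C (Function.update v l w))).re + 2 * τ * p (Function.update v l w)) *
        (N v + τ * (2 * (C (Function.update v l w) * star (C v)).re) +
          τ ^ 2 * N (Function.update v l w)) =
        (p v + τ * (D (Function.update v l w) * star (C v) +
        D v * star (C (Function.update v l w))).re + τ ^ 2 * p (Function.update v l w)) *
        (2 * (C (Function.update v l w) * star (C v)).re + 2 * τ * N (Function.update v l w)) := by
      intro τ
      have h := hder l hl w (Function.update v l (v l + τ • w))
      simp only [hp, hN, Function.update_idem, lC l hl, lD l hl, normSq_def4] at h ⊢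
      generalize C (Function.update v l w) = C' at *
      generalize D (Function.update v l w) = D' at *
      simp at h ⊢
      linear_combination h
    -- With quadratics p and N in τ, the identity p′N = pN′ has the τ-coefficient 2(p₂N₀ − p₀N₂). It
    -- is isolated by subtracting the values at τ = 1 and τ = −1.
    have h1 := hτ 1
    have h2 := hτ (-1)
    linarith
  set κ : ℝ := p v₀ / N v₀ with hκ
  have hpκ : ∀ v, p v = κ * N v := by
    -- Pass from `v₀` to `v` by changing the coordinates `j` and `k` in turn; the coordinate `i` is
    -- irrelevant for C and D. The value of N at the intermediate point may vanish, so it is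
    -- cancelled by analyticity.
    obtain ⟨j, k, hj, hk, hjk, hall⟩ := exists_other_indices i
    intro v
    rw [← sub_eq_zero]
    refine eq_zero_of_mul_eq_zero_of_analytic (f := fun v => p v - κ * N v)
      (g := fun v => N (Function.update v₀ j (v j))) (ap.sub (analyticOnNhd_const.mul aN)) ?_ ?_
      (v₀ := v₀) (by simpa using hN₀) v
    · intro v _
      have h1 : AnalyticAt ℝ (fun v : Fin 3 → Fin 2 → ℝ => Function.update v₀ j (v j)) v := by
        rw [analyticAt_pi_iff]
        intro m
        by_cases hm : m = j
        · subst hm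
          simp only [Function.update_self]
          exact (ContinuousLinearMap.proj (R := ℝ) (φ := fun _ : Fin 3 => Fin 2 → ℝ) m).analyticAt v
        · simp only [Function.update_of_ne hm]
          exact analyticAt_const
      exact (aN _ trivial).fun_comp h1
    · intro v
      have h1 := hprop j hj (v j) v₀
      have h2 := hprop k hk (v k) (Function.update v₀ j (v j))
      have h3 : ∀ {X : (Fin 3 → Fin 2 → ℝ) → Quaternion ℝ}, (∀ v x,
        X (Function.update v i x) = X v) →
          X (Function.update (Function.update v₀ j (v j)) k (v k)) = X v := by
        intro X hX
        rw [← hX _ (v i)]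
        congr 1
        ext m : 1
        rcases hall m with rfl | rfl | rfl
        · simp
        · simp [hj, hjk]
        · simp [hk]
      simp only [hp, hN, h3 iC, h3 iD] at h1 h2 ⊢
      simp only [hκ, hp, hN] at *
      have h4 : (D (Function.update v₀ j (v j)) * star (C (Function.update v₀ j (v j)))).re =
          (D v₀ * star (C v₀)).re / Quaternion.normSq (C v₀) *
            Quaternion.normSq (C (Function.update v₀ j (v j))) := by
        field_simp
        exact h1
      rw [h4] at h2
      linear_combination h2
  refine ⟨κ, fun v => ⟨?_, ?_⟩⟩
  · rw [← sub_eq_zero]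
    refine eq_zero_of_mul_eq_zero_of_analytic (f := fun v => (B v * star (D v)).imI - κ *
      (A v * star (D v) + B v * star (C v)).imI) (g := fun v => N v ^ 2) ?_ (aN.pow 2) ?_
      (pow_ne_zero 2 hN₀) v
    · exact (analytic_imI (aB.mul (analytic_star aD))).sub (analyticOnNhd_const.mul
        (analytic_imI ((aA.mul (analytic_star aD)).add (aB.mul (analytic_star aC)))))
    · intro v
      obtain ⟨h1, h2, -, -⟩ := id v
      have h3 := hpκ v
      simp only [hp, hN] at h3 ⊢
      rw [h3] at h2
      linear_combination h2 - κ * Quaternion.normSq (C v) * h1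
  · rw [← sub_eq_zero]
    refine eq_zero_of_mul_eq_zero_of_analytic (f := fun v => Quaternion.normSq (star (C v) * B v +
      star (A v) * D v) - (A v * star (D v) + B v * star (C v)).imI ^ 2) (g := fun v => N v ^ 2) ?_
      (aN.pow 2) ?_ (pow_ne_zero 2 hN₀) v
    · exact (analytic_normSq aθ).sub ((analytic_imI ((aA.mul (analytic_star aD)).add
        (aB.mul (analytic_star aC)))).pow 2)
    · intro v
      obtain ⟨h1, -, -, h4⟩ := id v
      simp only [hN]
      rw [← h1] at h4
      linear_combination h4

/-! ### Surfaces of one family on a common plane -/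

namespace TrilinearPair

variable {F : TrilinearPair}

theorem mem_coordPlane_zero (hF : F.IsStudy) (v : Fin 3 → Fin 2 → ℝ) :
    F.eval v ∈ coordPlane 0 ↔ (F.U v * star (F.W v)).imI = 0 := by
  by_cases hW : F.W v = 0
  · rw [eval_eq_infty.2 hW, hW]; simp
  · obtain ⟨x, hx, hU⟩ := hF.U_eq_toQ hW
    have : Quaternion.normSq (F.W v) ≠ 0 := by simpa using hW
    rw [hx, coe_mem_coordPlane, hU, mul_assoc, mul_star_eq_smul_one]
    simp [hW]

/-- A surface of the system through a regular point of a plane, which itself is a coordinate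
surface of the same family, lies on that plane. -/
theorem plane_of_regular (hF : F.IsStudy) (ho : F.IsOrth) (i : Fin 3) {v₀ : Fin 3 → Fin 2 → ℝ}
    (hW₀ : F.W v₀ ≠ 0) (hr₀ : ∀ l, F.theta v₀ l (rot (v₀ l)) ≠ 0)
    (hp : ∀ v, v i = v₀ i → (F.U v * star (F.W v)).imI = 0) {v : Fin 3 → Fin 2 → ℝ}
    (hv : F.theta v i (rot (v i)) ≠ 0) (hpv : (F.U v * star (F.W v)).imI = 0)
    {v' : Fin 3 → Fin 2 → ℝ} (h' : v' i = v i) : (F.U v' * star (F.W v')).imI = 0 := by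
  obtain ⟨r, hr⟩ : ∃ r, v₀ i = r := ⟨_, rfl⟩
  have hr0 : r ≠ 0 := by
    rintro rfl
    exact hW₀ (F.W_eq_zero hr)
  -- In the basis `r`, `rot r` of the i-th factor, the point with coordinate a·r + b·rot r has U =
  -- aA + bB and W = aC + bD.
  set A : (Fin 3 → Fin 2 → ℝ) → Quaternion ℝ := fun v => F.U (Function.update v i r) with hA
  set B : (Fin 3 → Fin 2 → ℝ) → Quaternion ℝ := fun v => F.U (Function.update v i (rot r)) with hB
  set C : (Fin 3 → Fin 2 → ℝ) → Quaternion ℝ := fun v => F.W (Function.update v i r) with hC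
  set D : (Fin 3 → Fin 2 → ℝ) → Quaternion ℝ := fun v => F.W (Function.update v i (rot r)) with hD
  have aA : AnalyticOnNhd ℝ A Set.univ := by
    simp only [hA, U_eq]; exact analytic_update (analytic_triM _) i r
  have aB : AnalyticOnNhd ℝ B Set.univ := by
    simp only [hB, U_eq]; exact analytic_update (analytic_triM _) i _
  have aC : AnalyticOnNhd ℝ C Set.univ := by
    simp only [hC, W_eq]; exact analytic_update (analytic_triM _) i r
  have aD : AnalyticOnNhd ℝ D Set.univ := by
    simp only [hD, W_eq]; exact analytic_update (analytic_triM _) i _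
  have lin : ∀ (x : Fin 2 → ℝ), ∀ l ≠ i, ∀ v w (τ : ℝ),
      F.U (Function.update (Function.update v l (v l + τ • w)) i x) =
        F.U (Function.update v i x) + τ • F.U (Function.update (Function.update v l w) i x) ∧
      F.W (Function.update (Function.update v l (v l + τ • w)) i x) =
        F.W (Function.update v i x) + τ • F.W (Function.update (Function.update v l w) i x) := by
    intro x l hl v w τ
    have h1 := F.U_update (Function.update v i x) l (v l) w 1 τ
    have h2 := F.W_update (Function.update v i x) l (v l) w 1 τ
    have h3 : Function.update (Function.update v i x) l (v l) = Function.update v i x := by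
      conv_rhs => rw [← Function.update_eq_self l (Function.update v i x)]
      rw [Function.update_of_ne hl]
    rw [one_smul, one_smul, h3] at h1 h2
    rw [Function.update_comm hl, Function.update_comm hl]
    exact ⟨h1, h2⟩
  have s1 : ∀ v, (A v * star (C v)).re = 0 := fun v => hF _
  have s3 : ∀ v, (B v * star (D v)).re = 0 := fun v => hF _
  have s2 : ∀ v, (A v * star (D v) + B v * star (C v)).re = 0 := fun v => hF.polar v i r (rot r)
  have p1 : ∀ v, (A v * star (C v)).imI = 0 := fun v => hp _ (by simp [hr])
  have θeq : ∀ v, star (C v) * B v + star (A v) * D v =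
      F.theta (Function.update v i r) i (rot r) := by
    intro v; simp only [theta, Function.update_idem, hA, hB, hC, hD]
  have s : ∀ v, (star (C v) * B v + star (A v) * D v).re = 0 := fun v => by
    rw [θeq]; exact hF.theta_re _ _ _
  have hv₀ : Function.update v₀ i r = v₀ := by rw [← hr, Function.update_eq_self]
  have hC₀ : C v₀ ≠ 0 := by simpa only [hC, hv₀] using hW₀
  have hθ₀ : star (C v₀) * B v₀ + star (A v₀) * D v₀ ≠ 0 := by
    rw [θeq, hv₀, ← hr]; exact hr₀ i
  have DBs : ∀ v, star (D v) * B v + star (B v) * D v = 0 := by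
    intro v
    have := hF.theta_self (Function.update v i (rot r)) i
    simpa only [theta, Function.update_idem, Function.update_self] using this
  have o0 : ∀ l ≠ i, ∀ v w, ((star (C v) * B v + star (A v) * D v) *
      star (star (C v) * A (Function.update v l w) + star (A v) * C (Function.update v l w))).re
      = 0 := by
    intro l hl v w
    have := ho (Function.update v i r) i l (Ne.symm hl) (rot r) w
    rw [← θeq, theta, Function.update_comm (Ne.symm hl)] at this
    exact this
  have o2 : ∀ l ≠ i, ∀ v w, ((star (C v) * B v + star (A v) * D v) *
      star (star (D v) * B (Function.update v l w) +
        star (B v) * D (Function.update v l w))).re = 0 := by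
    intro l hl v w
    have := ho (Function.update v i (rot r)) i l (Ne.symm hl) r w
    have e : F.theta (Function.update v i (rot r)) i r =
        -(star (C v) * B v + star (A v) * D v) := by
      have h1 : F.theta (Function.update v i (rot r)) i r =
          star (star (C v) * B v + star (A v) * D v) := by
        simp only [theta, Function.update_idem, hA, hB, hC, hD, star_add, star_mul, star_star]
        exact add_comm _ _
      rw [h1]
      have := s v
      generalize star (C v) * B v + star (A v) * D v = q at this
      ext <;> simp [this]
    rw [e, theta, Function.update_comm (Ne.symm hl), neg_mul, Quaternion.re_neg,
      neg_eq_zero] at this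
    exact this
  have o1 : ∀ l ≠ i, ∀ v w, ((star (C v) * B v + star (A v) * D v) *
      star (star (C v) * B (Function.update v l w) + star (D v) * A (Function.update v l w) +
        (star (A v) * D (Function.update v l w) +
          star (B v) * C (Function.update v l w)))).re = 0 := by
    intro l hl v w
    -- The mixed condition is the cross term of orthogonality along the parameter line: evaluate at
    -- r + rot r and subtract the conditions `o0` and `o2` at the two ends.
    have h := ho (Function.update v i ((1 : ℝ) • r + (1 : ℝ) • rot r)) i l (Ne.symm hl) (rot r) w
    have e1 : F.theta (Function.update v i ((1 : ℝ) • r + (1 : ℝ) • rot r)) i (rot r) =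
        star (C v) * B v + star (A v) * D v := by
      have := DBs v
      rw [theta, U_update, W_update]
      simp only [Function.update_idem, one_smul, star_add, add_mul]
      calc _ = star (C v) * B v + star (A v) * D v + (star (D v) * B v + star (B v) * D v) := by
            simp only [hA, hB, hC, hD]; abel
        _ = _ := by rw [this, add_zero]
    rw [e1, theta, Function.update_comm (Ne.symm hl), U_update, W_update, U_update, W_update] at h
    have h0 := o0 l hl v w
    have h2 := o2 l hl v w
    simp only [one_smul, star_add, add_mul, mul_add, Quaternion.re_add, star_mul,
      star_star] at h h0 h2 ⊢
    simp only [hA, hB, hC, hD] at h h0 h2 ⊢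
    linarith
  -- The other two tangent vectors X j and X k lie in the plane. They are orthogonal and nonzero at
  -- `v₀`, hence span it there, so Y, being orthogonal to both, is normal to the plane. The
  -- determinant of X j and X k is then cancelled by analyticity.
  have gjk : ∀ v, (C v * (star (C v) * B v + star (A v) * D v) * star (C v)).imJ = 0 ∧
      (C v * (star (C v) * B v + star (A v) * D v) * star (C v)).imK = 0 := by
    obtain ⟨j, k, hj, hk, hjk, -⟩ := exists_other_indices i
    set X : Fin 3 → (Fin 3 → Fin 2 → ℝ) → Quaternion ℝ := fun l v =>
      C v * (star (C v) * A (Function.update v l (rot (v₀ l))) +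
        star (A v) * C (Function.update v l (rot (v₀ l)))) * star (C v) with hX
    set Y : (Fin 3 → Fin 2 → ℝ) → Quaternion ℝ := fun v =>
      C v * (star (C v) * B v + star (A v) * D v) * star (C v) with hY
    have Xθ : ∀ l ≠ i, ∀ v, star (C v) * A (Function.update v l (rot (v₀ l))) +
        star (A v) * C (Function.update v l (rot (v₀ l))) =
        F.theta (Function.update v i r) l (rot (v₀ l)) := by
      intro l hl v
      rw [theta, Function.update_comm (Ne.symm hl)]
    have XI : ∀ l ≠ i, ∀ v, (X l v).imI = 0 := by
      intro l hl v
      have h1 := p1 (Function.update v l (v l + (1 : ℝ) • rot (v₀ l)))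
      have h2 := p1 (Function.update v l (rot (v₀ l)))
      have h3 := p1 v
      simp only [hA, hC] at h1
      rw [(lin r l hl v _ 1).1, (lin r l hl v _ 1).2] at h1
      simp only [hX]
      rw [mul_theta_mul_star (s1 v)]
      simp only [one_smul, star_add, add_mul, mul_add, Quaternion.imI_add, Quaternion.imI_sub,
        Quaternion.imI_smul, smul_add, smul_eq_mul] at h1 ⊢
      rw [h3, mul_zero, sub_zero, ← mul_add]
      simp only [hA, hC] at h2 h3 ⊢
      rw [mul_eq_zero]; right
      linarith
    have Xre : ∀ l ≠ i, ∀ v, (X l v).re = 0 := by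
      intro l hl v
      simp only [hX]
      rw [Xθ l hl]
      exact conj_re _ _ (hF.theta_re _ _ _)
    have orth : ∀ (v : Fin 3 → Fin 2 → ℝ) (P Q : Quaternion ℝ), (P * star Q).re = 0 → P.re = 0 →
        Q.re = 0 → (C v * P * star (C v)).imI * (C v * Q * star (C v)).imI +
        (C v * P * star (C v)).imJ * (C v * Q * star (C v)).imJ +
        (C v * P * star (C v)).imK * (C v * Q * star (C v)).imK = 0 := by
      intro v P Q h hP hQ
      rw [← inner_imPart, inner_imPart_conj _ _ _ hP hQ, h, mul_zero]
    have hXY : ∀ l ≠ i, ∀ v, (Y v).imJ * (X l v).imJ + (Y v).imK * (X l v).imK = 0 := by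
      intro l hl v
      have h := orth v _ _ (o0 l hl v (rot (v₀ l))) (s v) (by
        simp only [Xθ l hl]; exact hF.theta_re _ _ _)
      have h1 := XI l hl v
      simp only [hX, hY] at h1 ⊢
      rw [h1] at h
      linarith
    have hXX : ∀ v, (X j v).imJ * (X k v).imJ + (X j v).imK * (X k v).imK = 0 := by
      intro v
      have h := orth v _ _ (ho (Function.update v i r) j k hjk (rot (v₀ j)) (rot (v₀ k)))
        (hF.theta_re _ _ _) (hF.theta_re _ _ _)
      rw [← Xθ j hj, ← Xθ k hk] at h
      have h1 := XI j hj v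
      simp only [hX] at h1 ⊢
      rw [h1] at h
      linarith
    have aX : ∀ l, AnalyticOnNhd ℝ (X l) Set.univ := fun l =>
      (aC.mul (((analytic_star aC).mul (analytic_update aA l _)).add
        ((analytic_star aA).mul (analytic_update aC l _)))).mul (analytic_star aC)
    have aY : AnalyticOnNhd ℝ Y Set.univ :=
      (aC.mul (((analytic_star aC).mul aB).add ((analytic_star aA).mul aD))).mul (analytic_star aC)
    have adet : AnalyticOnNhd ℝ (fun v => (X j v).imJ * (X k v).imK - (X j v).imK * (X k v).imJ)
        Set.univ := ((analytic_imJ (aX j)).mul (analytic_imK (aX k))).sub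
          ((analytic_imK (aX j)).mul (analytic_imJ (aX k)))
    have hX₀ : ∀ l ≠ i, (X l v₀).imJ ^ 2 + (X l v₀).imK ^ 2 ≠ 0 := by
      intro l hl h
      have h1 : X l v₀ = 0 := by
        ext
        · exact Xre l hl v₀
        · exact XI l hl v₀
        · change (X l v₀).imJ = 0
          nlinarith [sq_nonneg (X l v₀).imJ, sq_nonneg (X l v₀).imK]
        · change (X l v₀).imK = 0
          nlinarith [sq_nonneg (X l v₀).imJ, sq_nonneg (X l v₀).imK]
      simp only [hX] at h1
      rw [Xθ l hl, hv₀] at h1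
      have := mul_eq_zero.1 h1
      rcases this with h2 | h2
      · rcases mul_eq_zero.1 h2 with h3 | h3
        · exact hC₀ h3
        · exact hr₀ l h3
      · exact hC₀ (star_eq_zero.1 h2)
    have hdet₀ : (X j v₀).imJ * (X k v₀).imK - (X j v₀).imK * (X k v₀).imJ ≠ 0 := by
      intro h
      have h1 := hXX v₀
      have h2 := mul_ne_zero (hX₀ j hj) (hX₀ k hk)
      apply h2
      calc _ = ((X j v₀).imJ * (X k v₀).imK - (X j v₀).imK * (X k v₀).imJ) ^ 2 +
            ((X j v₀).imJ * (X k v₀).imJ + (X j v₀).imK * (X k v₀).imK) ^ 2 := by ring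
        _ = 0 := by rw [h, h1]; ring
    intro v
    constructor
    · refine eq_zero_of_mul_eq_zero_of_analytic (f := fun v => (Y v).imJ) (analytic_imJ aY) adet
        (fun v => ?_) hdet₀ v
      linear_combination (X k v).imK * hXY j hj v - (X j v).imK * hXY k hk v
    · refine eq_zero_of_mul_eq_zero_of_analytic (f := fun v => (Y v).imK) (analytic_imK aY) adet
        (fun v => ?_) hdet₀ v
      linear_combination -(X k v).imJ * hXY j hj v + (X j v).imJ * hXY k hk v
  obtain ⟨κ, hκ⟩ := exists_pencil_ratio (A := A) (B := B) (C := C) (D := D) (i := i) aA aB aC aD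
    (fun l hl v w τ => (lin r l hl v w τ).1) (fun l hl v w τ => (lin _ l hl v w τ).1)
    (fun l hl v w τ => (lin r l hl v w τ).2) (fun l hl v w τ => (lin _ l hl v w τ).2)
    (fun v x => by simp only [hC, Function.update_idem])
    (fun v x => by simp only [hD, Function.update_idem])
    s1 p1 s2 s3 s (fun v => (gjk v).1) (fun v => (gjk v).2) o1 o2 hC₀ hθ₀
  obtain ⟨a, b, hab⟩ := exists_eq_rot hr0 (v i)
  -- The defect from the plane factors. The factor b(a + κb) depends on the slice only: b = 0 is the
  -- given slice, and a + κb = 0 is the common second intersection of the circles with the plane.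
  have hf : ∀ v', v' i = v i → (F.U v' * star (F.W v')).imI =
      b * (a + κ * b) * (A v' * star (D v') + B v' * star (C v')).imI := by
    intro v' hv'
    have e : v' = Function.update v' i (a • r + b • rot r) := by
      rw [← hab, ← hv', Function.update_eq_self]
    conv_lhs => rw [e, U_update, W_update]
    have h1 := p1 v'
    have h2 := (hκ v').1
    change ((a • A v' + b • B v') * star (a • C v' + b • D v')).imI = _
    simp only [star_add, Quaternion.star_smul, add_mul, mul_add, smul_mul_assoc, mul_smul_comm,
      Quaternion.imI_add, Quaternion.imI_smul, smul_eq_mul] at h2 ⊢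
    rw [h1, h2]
    ring
  -- The square of the remaining factor is |θ|² at the slice `r`, which differs from `theta` at `v`
  -- by the scalar a² + b²; regularity in the i-th direction makes it nonzero.
  have hm : (A v * star (D v) + B v * star (C v)).imI ≠ 0 := by
    intro h
    have h2 := (hκ v).2
    rw [h, θeq] at h2
    have h3 : F.theta (Function.update v i r) i (rot r) = 0 := by simpa using h2
    apply hv
    have h4 : F.theta v i (rot (v i)) =
        (a ^ 2 + b ^ 2) • F.theta (Function.update v i r) i (rot r) := by
      have e1 : rot (v i) = (-b) • r + a • rot r := by
        rw [hab]; ext m; fin_cases m <;> simp [rot] <;> ring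
      have e2 : v = Function.update v i (a • r + b • rot r) := by
        rw [← hab, Function.update_eq_self]
      have e3 : F.U v = a • A v + b • B v := by rw [hA, hB, ← U_update, ← e2]
      have e4 : F.W v = a • C v + b • D v := by rw [hC, hD, ← W_update, ← e2]
      rw [← θeq, e1, theta_lin, theta, theta, e3, e4]
      change -b • (star (a • C v + b • D v) * A v + star (a • A v + b • B v) * C v) +
        a • (star (a • C v + b • D v) * B v + star (a • A v + b • B v) * D v) = _
      have f1 : star (C v) * A v + star (A v) * C v = 0 := by
        have := hF.theta_self (Function.update v i r) i
        simpa only [theta, Function.update_idem, Function.update_self] using this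
      have f2 := DBs v
      have f3 : star (D v) * A v + star (B v) * C v = -(star (C v) * B v + star (A v) * D v) := by
        have h1 := s v
        have h2 : star (D v) * A v + star (B v) * C v =
            star (star (C v) * B v + star (A v) * D v) := by
          simp only [star_add, star_mul, star_star]; abel
        rw [h2]
        generalize star (C v) * B v + star (A v) * D v = q at h1
        ext <;> simp [h1]
      calc _ = (-b * a) • (star (C v) * A v + star (A v) * C v) -
            (b ^ 2) • (star (D v) * A v + star (B v) * C v) +
            (a ^ 2) • (star (C v) * B v + star (A v) * D v) +
            (a * b) • (star (D v) * B v + star (B v) * D v) := by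
              simp only [star_add, Quaternion.star_smul, add_mul, smul_mul_assoc]
              module
        _ = _ := by rw [f1, f2, f3]; module
    rw [h4, h3, smul_zero]
  have h0 := hf v rfl
  rw [hpv] at h0
  rw [hf v' h', (mul_eq_zero.1 h0.symm).resolve_right hm, zero_mul]

end TrilinearPair

/-! ### Moving three M-spheres through a regular point to the coordinate planes -/

namespace TrilinearPair

variable {F : TrilinearPair}

theorem mem_coordPlane (hF : F.IsStudy) (i : Fin 3) (v : Fin 3 → Fin 2 → ℝ) :
    F.eval v ∈ coordPlane i ↔ imPart (F.U v * star (F.W v)) i = 0 := by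
  by_cases hW : F.W v = 0
  · rw [eval_eq_infty.2 hW, hW]
    simp only [infty_mem_coordPlane, star_zero, mul_zero, true_iff]
    rw [(imPart_eq_zero rfl).2 rfl]
    rfl
  · obtain ⟨x, hx, hU⟩ := hF.U_eq_toQ hW
    have : Quaternion.normSq (F.W v) ≠ 0 := by simpa using hW
    rw [hx, coe_mem_coordPlane, hU, mul_assoc, mul_star_eq_smul_one, mul_smul_comm, mul_one,
      imPart_smul, imPart_toQ]
    simp [hW]

theorem eq_zero_of_notMem_domain {v : Fin 3 → Fin 2 → ℝ} (hv : v ∉ F.domain) :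
    F.U v = 0 ∧ F.W v = 0 := by
  by_cases h : ∃ i, v i = 0
  · obtain ⟨i, hi⟩ := h
    exact ⟨F.U_eq_zero hi, F.W_eq_zero hi⟩
  · push Not at h
    by_contra h'
    exact hv ⟨h, by tauto⟩

/-- Möbius-invariant form of `plane_of_regular`. Sending the value at `v₀` to ∞ flattens `S` to a
plane; a second transformation brings that point to 0, so that the denominator at `v₀` is nonzero.
-/
theorem surface_subset_of_regular (hF : F.IsStudy) (ho : F.IsOrth) (S : MSphere) (i : Fin 3)
    {v₀ : Fin 3 → Fin 2 → ℝ} (hv₀ : v₀ ∈ F.domain) (hr₀ : ∀ l, F.theta v₀ l (rot (v₀ l)) ≠ 0)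
    (hp : ∀ v ∈ F.domain, v i = v₀ i → F.eval v ∈ S.carrier) {v : Fin 3 → Fin 2 → ℝ}
    (hvd : v ∈ F.domain) (hv : F.theta v i (rot (v i)) ≠ 0) (hpv : F.eval v ∈ S.carrier)
    {v' : Fin 3 → Fin 2 → ℝ} (hvd' : v' ∈ F.domain) (h' : v' i = v i) :
    F.eval v' ∈ S.carrier := by
  obtain ⟨μ, hμ, hμ0, hμS⟩ := exists_moebius_plane (F.eval v₀)
  obtain ⟨n, k, hn, hS⟩ := hμS S (hp v₀ hv₀ rfl)
  obtain ⟨ν, hν, hν0, hνS⟩ := exists_moebius_coordPlane k hn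
  have hS' : ∀ q, (ν * μ) q ∈ coordPlane 0 ↔ q ∈ S.carrier := fun q => by
    rw [Equiv.Perm.mul_apply, hνS, hS]
  obtain ⟨F', hF'⟩ := exists_isLift hF (mul_mem hν hμ)
  have h1 : F'.eval v₀ = ((0 : E3) : OnePoint E3) := by
    rw [hF'.eval v₀ hv₀, Equiv.Perm.mul_apply, hμ0, hν0]
  have hW₀ : F'.W v₀ ≠ 0 := (hF'.study.eval_eq_coe.1 h1).1
  have key : ∀ w ∈ F.domain, F.eval w ∈ S.carrier ↔ (F'.U w * star (F'.W w)).imI = 0 := by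
    intro w hw
    rw [← mem_coordPlane_zero hF'.study, hF'.eval w hw, hS']
  rw [key v' hvd']
  refine plane_of_regular hF'.study (hF'.isOrth ho) i hW₀ (fun l => ?_) ?_ ?_ ((key v hvd).1 hpv) h'
  · rw [ne_eq, hF'.theta_eq_zero]; exact hr₀ l
  · intro w hw
    by_cases hwd : w ∈ F.domain
    · exact (key w hwd).1 (hp w hwd hw)
    · rw [← hF'.domain] at hwd
      rw [(eq_zero_of_notMem_domain hwd).1]; simp
  · rw [ne_eq, hF'.theta_eq_zero]; exact hv

/-- The vectors Y l are, up to scaling, the partial derivatives in the chart at ∞, and are mutually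
orthogonal. For l ≠ i, varying the l-th parameter keeps the point on the i-th plane ⟨n i, Im UW̄⟩ =
k i·|W|². As W vanishes at `v₁`, the right side is quadratic in the variation, so the linear term
gives n i ⟂ Y l. Thus each normal is proportional to its own Y i. -/
theorem normals_orthogonal (hF : F.IsStudy) (ho : F.IsOrth) {v₁ : Fin 3 → Fin 2 → ℝ}
    (hv₁ : v₁ ∈ F.domain) (hr : ∀ l, F.theta v₁ l (rot (v₁ l)) ≠ 0) (hinf : F.eval v₁ = ∞)
    (n : Fin 3 → E3) (k : Fin 3 → ℝ)
    (h : ∀ i, ∀ v ∈ F.domain, v i = v₁ i → F.eval v ∈ genSphere 0 (n i) (-(k i))) :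
    ∀ i j, i ≠ j → inner ℝ (n i) (n j) = 0 := by
  have hW : F.W v₁ = 0 := eval_eq_infty.1 hinf
  have hU : F.U v₁ ≠ 0 := hv₁.2.resolve_right (not_not.2 hW)
  have hUn : Quaternion.normSq (F.U v₁) ≠ 0 := by simpa using hU
  have h1 : ∀ i v, v i = v₁ i →
      inner ℝ (n i) (imPart (F.U v * star (F.W v))) = k i * Quaternion.normSq (F.W v) := by
    intro i v hv
    by_cases hWv : F.W v = 0
    · rw [hWv, star_zero, mul_zero, (imPart_eq_zero rfl).2 rfl, inner_zero_right, map_zero,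
        mul_zero]
    · have hd : v ∈ F.domain := by
        by_contra hd
        exact hWv (eq_zero_of_notMem_domain hd).2
      obtain ⟨x, hx, hUx⟩ := hF.U_eq_toQ hWv
      have h2 := h i v hd hv
      rw [hx, coe_mem_genSphere, zero_mul, zero_add] at h2
      rw [hUx, mul_assoc, mul_star_eq_smul_one, mul_smul_comm, mul_one, imPart_smul, imPart_toQ,
        inner_smul_right]
      linear_combination Quaternion.normSq (F.W v) * h2
  set Y : Fin 3 → E3 := fun l => imPart (F.U v₁ * F.theta v₁ l (rot (v₁ l)) * star (F.U v₁)) with hY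
  have hY0 : ∀ l, Y l ≠ 0 := by
    intro l h0
    rw [imPart_eq_zero (conj_re _ _ (hF.theta_re _ _ _))] at h0
    rcases mul_eq_zero.1 h0 with h2 | h2
    · rcases mul_eq_zero.1 h2 with h3 | h3
      · exact hU h3
      · exact hr l h3
    · exact hU (star_eq_zero.1 h2)
  have hYo : ∀ i j, i ≠ j → inner ℝ (Y i) (Y j) = 0 := by
    intro i j hij
    rw [hY, inner_imPart_conj _ _ _ (hF.theta_re _ _ _) (hF.theta_re _ _ _), ho v₁ i j hij,
      mul_zero]
  have hnY : ∀ i l, l ≠ i → inner ℝ (n i) (Y l) = 0 := by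
    intro i l hl
    have h2 : ∀ τ : ℝ, inner ℝ (n i) (imPart ((F.U v₁ +
        τ • F.U (Function.update v₁ l (rot (v₁ l)))) *
        star (τ • F.W (Function.update v₁ l (rot (v₁ l)))))) =
        k i * Quaternion.normSq (τ • F.W (Function.update v₁ l (rot (v₁ l)))) := by
      intro τ
      have h3 := h1 i (Function.update v₁ l ((1 : ℝ) • v₁ l + τ • rot (v₁ l)))
        (Function.update_of_ne (Ne.symm hl) _ _)
      rw [U_update, W_update] at h3
      simpa [hW] using h3
    have e : Y l = (-Quaternion.normSq (F.U v₁)) •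
        imPart (F.U v₁ * star (F.W (Function.update v₁ l (rot (v₁ l))))) := by
      rw [hY, ← imPart_smul]
      simp only [theta, hW, star_zero, zero_mul, zero_add]
      rw [← mul_assoc, mul_star_eq_smul_one, smul_mul_assoc, one_mul, smul_mul_assoc]
      simp only [imPart_smul, neg_smul]
      rw [← smul_neg]
      ext m; fin_cases m <;> simp [imPart] <;> ring
    have h3 := h2 1
    have h4 := h2 (-1)
    have eq1 : ∀ τ : ℝ, imPart ((F.U v₁ + τ • F.U (Function.update v₁ l (rot (v₁ l)))) *
        star (τ • F.W (Function.update v₁ l (rot (v₁ l))))) =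
        τ • imPart (F.U v₁ * star (F.W (Function.update v₁ l (rot (v₁ l))))) +
        τ ^ 2 • imPart (F.U (Function.update v₁ l (rot (v₁ l))) *
          star (F.W (Function.update v₁ l (rot (v₁ l))))) := by
      intro τ
      rw [← imPart_smul, ← imPart_smul, ← imPartL_apply, ← imPartL_apply, ← imPartL_apply,
        ← map_add]
      congr 1
      simp only [Quaternion.star_smul, add_mul, mul_smul_comm, smul_mul_assoc, smul_add,
        smul_smul, pow_two]
    rw [eq1, inner_add_right, inner_smul_right, inner_smul_right] at h3 h4
    have h5 : Quaternion.normSq ((-1 : ℝ) • F.W (Function.update v₁ l (rot (v₁ l)))) =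
        Quaternion.normSq ((1 : ℝ) • F.W (Function.update v₁ l (rot (v₁ l)))) := by simp
    rw [h5] at h4
    rw [e, inner_smul_right]
    have : inner ℝ (n i) (imPart (F.U v₁ * star (F.W (Function.update v₁ l (rot (v₁ l)))))) =
      (0 : ℝ) := by
      linarith
    rw [this, mul_zero]
  intro i j hij
  obtain ⟨b, hb⟩ := exists_orthonormalBasis_normalize Y hY0 hYo
  rw [← b.sum_inner_mul_inner]
  refine Finset.sum_eq_zero fun l _ => ?_
  rw [hb]
  by_cases hl : l = i
  · subst hl
    rw [real_inner_comm, real_inner_comm (n j), inner_smul_right, hnY j l hij, mul_zero, mul_zero]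
  · rw [inner_smul_right, hnY i l hl, mul_zero, zero_mul]

/-- The normal position of a system with three spherical coordinate surfaces that meet in a
regular point. -/
theorem exists_lift_coordPlanes (hF : F.IsStudy) (ho : F.IsOrth) (S : Fin 3 → MSphere)
    (hfamily : ∀ i, F.HasMSphere i (S i)) {p : OnePoint E3} (hpS : ∀ i, p ∈ (S i).carrier)
    (hp : p ∉ F.singularLocus) : ∃ μ ∈ moebiusGroup, μ p = ((0 : E3) : OnePoint E3) ∧
      ∃ F', F.IsLift F' μ ∧ ∃ v₁ ∈ F.domain, F.eval v₁ = p ∧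
        (∀ l, F.theta v₁ l (rot (v₁ l)) ≠ 0) ∧
        ∀ i, ∀ v, v i = v₁ i → imPart (F'.U v * star (F'.W v)) i = 0 := by
  -- Each M-sphere comes with its own parameter point over `p`, and these need not agree; all of
  -- them are regular because `p` is not a singular value.
  have hpre : ∀ i, ∃ v ∈ F.domain, F.eval v = p ∧ (∀ l, F.theta v l (rot (v l)) ≠ 0) ∧
      ∀ w ∈ F.domain, w i = v i → F.eval w ∈ (S i).carrier := by
    intro i
    obtain ⟨r, hr, e⟩ := hfamily i
    have h1 := hpS i
    rw [← e] at h1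
    obtain ⟨v, hv, hvi, hvp⟩ := h1
    refine ⟨v, hv, hvp, fun l hl => hp ⟨v, hv, ?_, hvp⟩, fun w hw hwi => ?_⟩
    · rw [jacobian_eq_zero_iff hF ho hv]; exact ⟨l, hl⟩
    · rw [← e]; exact ⟨w, hw, hwi.trans hvi, rfl⟩
  obtain ⟨v₁, hv₁, hv₁p, hr₁, -⟩ := hpre 0
  -- The pencil argument transfers all three conditions to the single parameter point `v₁`.
  have hsurf : ∀ i, ∀ w ∈ F.domain, w i = v₁ i → F.eval w ∈ (S i).carrier := by
    intro i w hw hwi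
    obtain ⟨v, hv, hvp, hr, hs⟩ := hpre i
    exact surface_subset_of_regular hF ho (S i) i hv hr hs hv₁ (hr₁ i)
      (by rw [hv₁p]; exact hpS i) hw hwi
  obtain ⟨μ, hμ, hμp, hμS⟩ := exists_moebius_plane p
  choose n k hn hnk using fun i => hμS (S i) (hpS i)
  obtain ⟨F₁, hF₁⟩ := exists_isLift hF hμ
  have hortho := normals_orthogonal hF₁.study (hF₁.isOrth ho) (v₁ := v₁) (by rwa [hF₁.domain])
    (fun l => by rw [ne_eq, hF₁.theta_eq_zero]; exact hr₁ l)
    (by rw [hF₁.eval v₁ hv₁, hv₁p, hμp]) n k (by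
      intro i v hv hvi
      rw [hF₁.domain] at hv
      rw [hF₁.eval v hv, hnk]
      exact hsurf i v hv hvi)
  obtain ⟨ν, hν, hν0, hνS⟩ := exists_moebius_coordPlanes n k hn hortho
  obtain ⟨F', hF'⟩ := exists_isLift hF (mul_mem hν hμ)
  refine ⟨ν * μ, mul_mem hν hμ, by rw [Equiv.Perm.mul_apply, hμp, hν0], F', hF', v₁, hv₁, hv₁p,
    hr₁, fun i v hvi => ?_⟩
  by_cases hd : v ∈ F.domain
  · rw [← mem_coordPlane hF'.study, hF'.eval v hd, Equiv.Perm.mul_apply, hνS, hnk]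
    exact hsurf i v hd hvi
  · rw [← hF'.domain] at hd
    rw [(eq_zero_of_notMem_domain hd).1, zero_mul, (imPart_eq_zero rfl).2 rfl]; rfl

end TrilinearPair

/-! ### Systems in normal position -/

namespace TrilinearPair

variable {F : TrilinearPair}

theorem U_expand (x y z : Fin 2 → ℝ) : F.U ![x, y, z] =
    (x 0 * y 0 * z 0) • F.coeffU ![0, 0, 0] + (x 1 * y 0 * z 0) • F.coeffU ![1, 0, 0] +
    (x 0 * y 1 * z 0) • F.coeffU ![0, 1, 0] + (x 0 * y 0 * z 1) • F.coeffU ![0, 0, 1] +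
    (x 1 * y 1 * z 0) • F.coeffU ![1, 1, 0] + (x 1 * y 0 * z 1) • F.coeffU ![1, 0, 1] +
    (x 0 * y 1 * z 1) • F.coeffU ![0, 1, 1] + (x 1 * y 1 * z 1) • F.coeffU ![1, 1, 1] := by
  simp [U, univ_eq_exponents, Fin.prod_univ_three, add_assoc]

theorem W_expand (x y z : Fin 2 → ℝ) : F.W ![x, y, z] =
    (x 0 * y 0 * z 0) • F.coeffW ![0, 0, 0] + (x 1 * y 0 * z 0) • F.coeffW ![1, 0, 0] +
    (x 0 * y 1 * z 0) • F.coeffW ![0, 1, 0] + (x 0 * y 0 * z 1) • F.coeffW ![0, 0, 1] +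
    (x 1 * y 1 * z 0) • F.coeffW ![1, 1, 0] + (x 1 * y 0 * z 1) • F.coeffW ![1, 0, 1] +
    (x 0 * y 1 * z 1) • F.coeffW ![0, 1, 1] + (x 1 * y 1 * z 1) • F.coeffW ![1, 1, 1] := by
  simp [W, univ_eq_exponents, Fin.prod_univ_three, add_assoc]

theorem update_zero {α : Type*} (x y z w : α) : Function.update ![x, y, z] 0 w = ![w, y, z] := by
  ext i; fin_cases i <;> rfl

theorem update_one {α : Type*} (x y z w : α) : Function.update ![x, y, z] 1 w = ![x, w, z] := by
  ext i; fin_cases i <;> rfl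

theorem update_two {α : Type*} (x y z w : α) : Function.update ![x, y, z] 2 w = ![x, y, w] := by
  ext i; fin_cases i <;> rfl

theorem ext_coeff {F G : TrilinearPair} (hU : ∀ e, F.coeffU e = G.coeffU e)
    (hW : ∀ e, F.coeffW e = G.coeffW e) : F = G := by
  cases F; cases G
  simp only [mk.injEq]
  exact ⟨funext hU, funext hW⟩

theorem mem_exponents (e : Fin 3 → Fin 2) : e = ![0, 0, 0] ∨ e = ![1, 0, 0] ∨ e = ![0, 1, 0] ∨
    e = ![0, 0, 1] ∨ e = ![1, 1, 0] ∨ e = ![1, 0, 1] ∨ e = ![0, 1, 1] ∨ e = ![1, 1, 1] := by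
  have he : e ∈ (Finset.univ : Finset (Fin 3 → Fin 2)) := Finset.mem_univ e
  rw [univ_eq_exponents] at he
  simpa only [Finset.mem_insert, Finset.mem_singleton] using he

/-- The quaternion unit `i`. -/
def qI : Quaternion ℝ := ⟨0, 1, 0, 0⟩

/-- The quaternion unit `j`. -/
def qJ : Quaternion ℝ := ⟨0, 0, 1, 0⟩

/-- The quaternion unit `k`. -/
def qK : Quaternion ℝ := ⟨0, 0, 0, 1⟩

@[simp] theorem qI_re : qI.re = 0 := rfl
@[simp] theorem qI_imI : qI.imI = 1 := rfl
@[simp] theorem qI_imJ : qI.imJ = 0 := rfl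
@[simp] theorem qI_imK : qI.imK = 0 := rfl
@[simp] theorem qJ_re : qJ.re = 0 := rfl
@[simp] theorem qJ_imI : qJ.imI = 0 := rfl
@[simp] theorem qJ_imJ : qJ.imJ = 1 := rfl
@[simp] theorem qJ_imK : qJ.imK = 0 := rfl
@[simp] theorem qK_re : qK.re = 0 := rfl
@[simp] theorem qK_imI : qK.imI = 0 := rfl
@[simp] theorem qK_imJ : qK.imJ = 0 := rfl
@[simp] theorem qK_imK : qK.imK = 1 := rfl

/-- On the face where the first parameter is 0 the pair is tj + uk + tuA over 1 + tuB. Sampling the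
plane and Study conditions, and orthogonality along the two axes of the face, gives linear
equations. They leave only the i-component of `B` free. -/
theorem face_coeffs_i {A B : Quaternion ℝ}
    (hp : ∀ t u : ℝ, ((t • qJ + u • qK + (t * u) • A) * star (1 + (t * u) • B)).imI = 0)
    (hs : ∀ t u : ℝ, ((t • qJ + u • qK + (t * u) • A) * star (1 + (t * u) • B)).re = 0)
    (ht : ∀ t : ℝ, (qJ * star (qK + t • A + star (t • qJ) * (t • B))).re = 0)
    (hu : ∀ u : ℝ, ((qJ + u • A + star (u • qK) * (u • B)) * star qK).re = 0) :
    A = 0 ∧ B.re = 0 ∧ B = B.imI • qI := by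
  simp at hp hs ht hu
  have p1 := hp 1 1
  have p2 := hp 1 (-1)
  have p3 := hp (-1) 1
  have p4 := hp (-1) (-1)
  have p5 := hp 1 2
  have s1 := hs 1 1
  have s2 := hs 1 (-1)
  have s3 := hs (-1) 1
  have s4 := hs (-1) (-1)
  have s5 := hs 1 2
  have t1 := ht 1
  have t2 := ht (-1)
  have u1 := hu 1
  have u2 := hu (-1)
  clear hp hs ht hu
  ring_nf at *
  refine ⟨?_, by linarith, ?_⟩ <;> ext <;> simp <;> linarith

theorem face_coeffs_j {A B : Quaternion ℝ}
    (hp : ∀ t u : ℝ, ((t • qK + u • qI + (t * u) • A) * star (1 + (t * u) • B)).imJ = 0)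
    (hs : ∀ t u : ℝ, ((t • qK + u • qI + (t * u) • A) * star (1 + (t * u) • B)).re = 0)
    (ht : ∀ t : ℝ, (qK * star (qI + t • A + star (t • qK) * (t • B))).re = 0)
    (hu : ∀ u : ℝ, ((qK + u • A + star (u • qI) * (u • B)) * star qI).re = 0) :
    A = 0 ∧ B.re = 0 ∧ B = B.imJ • qJ := by
  simp at hp hs ht hu
  have p1 := hp 1 1
  have p2 := hp 1 (-1)
  have p3 := hp (-1) 1
  have p4 := hp (-1) (-1)
  have p5 := hp 1 2
  have s1 := hs 1 1
  have s2 := hs 1 (-1)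
  have s3 := hs (-1) 1
  have s4 := hs (-1) (-1)
  have s5 := hs 1 2
  have t1 := ht 1
  have t2 := ht (-1)
  have u1 := hu 1
  have u2 := hu (-1)
  clear hp hs ht hu
  ring_nf at *
  refine ⟨?_, by linarith, ?_⟩ <;> ext <;> simp <;> linarith

theorem face_coeffs_k {A B : Quaternion ℝ}
    (hp : ∀ t u : ℝ, ((t • qI + u • qJ + (t * u) • A) * star (1 + (t * u) • B)).imK = 0)
    (hs : ∀ t u : ℝ, ((t • qI + u • qJ + (t * u) • A) * star (1 + (t * u) • B)).re = 0)
    (ht : ∀ t : ℝ, (qI * star (qJ + t • A + star (t • qI) * (t • B))).re = 0)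
    (hu : ∀ u : ℝ, ((qI + u • A + star (u • qJ) * (u • B)) * star qJ).re = 0) :
    A = 0 ∧ B.re = 0 ∧ B = B.imK • qK := by
  simp at hp hs ht hu
  have p1 := hp 1 1
  have p2 := hp 1 (-1)
  have p3 := hp (-1) 1
  have p4 := hp (-1) (-1)
  have p5 := hp 1 2
  have s1 := hs 1 1
  have s2 := hs 1 (-1)
  have s3 := hs (-1) 1
  have s4 := hs (-1) (-1)
  have s5 := hs 1 2
  have t1 := ht 1
  have t2 := ht (-1)
  have u1 := hu 1
  have u2 := hu (-1)
  clear hp hs ht hu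
  ring_nf at *
  refine ⟨?_, by linarith, ?_⟩ <;> ext <;> simp <;> linarith

/-- A system in normal position at the origin of the parameters is in canonical form. -/
theorem eq_canonicalPair (hF : F.IsStudy) (ho : F.IsOrth)
    (hp : ∀ i, ∀ v : Fin 3 → Fin 2 → ℝ, v i = ![1, 0] → imPart (F.U v * star (F.W v)) i = 0)
    (hU0 : F.coeffU ![0, 0, 0] = 0) (hW0 : F.coeffW ![0, 0, 0] = 1)
    (hU1 : F.coeffU ![1, 0, 0] = qI) (hW1 : F.coeffW ![1, 0, 0] = 0)
    (hU2 : F.coeffU ![0, 1, 0] = qJ) (hW2 : F.coeffW ![0, 1, 0] = 0)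
    (hU3 : F.coeffU ![0, 0, 1] = qK) (hW3 : F.coeffW ![0, 0, 1] = 0) :
    ∃ a b c, F = canonicalPair a b c := by
  have eU : ∀ x y z : Fin 2 → ℝ, F.U ![x, y, z] = (x 1 * y 0 * z 0) • qI +
      (x 0 * y 1 * z 0) • qJ + (x 0 * y 0 * z 1) • qK + (x 1 * y 1 * z 0) • F.coeffU ![1, 1, 0] +
      (x 1 * y 0 * z 1) • F.coeffU ![1, 0, 1] + (x 0 * y 1 * z 1) • F.coeffU ![0, 1, 1] +
      (x 1 * y 1 * z 1) • F.coeffU ![1, 1, 1] := fun x y z => by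
    rw [U_expand, hU0, hU1, hU2, hU3, smul_zero, zero_add]
  have eW : ∀ x y z : Fin 2 → ℝ, F.W ![x, y, z] = (x 0 * y 0 * z 0) • 1 +
      (x 1 * y 1 * z 0) • F.coeffW ![1, 1, 0] +
      (x 1 * y 0 * z 1) • F.coeffW ![1, 0, 1] + (x 0 * y 1 * z 1) • F.coeffW ![0, 1, 1] +
      (x 1 * y 1 * z 1) • F.coeffW ![1, 1, 1] := fun x y z => by
    rw [W_expand, hW0, hW1, hW2, hW3]; simp only [smul_zero, add_zero]
  have o := fun (x y z : Fin 2 → ℝ) i j hij => ho ![x, y, z] i j hij ![0, 1] ![0, 1]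
  obtain ⟨hA, hB, hB'⟩ : F.coeffU ![0, 1, 1] = 0 ∧ _ ∧ _ := face_coeffs_i (B := F.coeffW ![0, 1, 1])
    (fun t u => by
      have := hp 0 ![![1, 0], ![1, t], ![1, u]] rfl
      rw [eU, eW] at this
      simpa only [Matrix.cons_val_zero, Matrix.cons_val_one, imPart, mul_one, mul_zero, zero_mul,
        zero_smul, one_mul, zero_add, add_zero, one_smul, star_zero, star_one] using this)
    (fun t u => by
      have := hF ![![1, 0], ![1, t], ![1, u]]
      rw [eU, eW] at this
      simpa only [Matrix.cons_val_zero, Matrix.cons_val_one, imPart, mul_one, mul_zero, zero_mul,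
        zero_smul, one_mul, zero_add, add_zero, one_smul, star_zero, star_one] using this)
    (fun t => by
      have := o ![1, 0] ![1, t] ![1, 0] 1 2 (by decide)
      simpa only [theta, update_one, update_two, eU, eW, Matrix.cons_val_zero,
        Matrix.cons_val_one, imPart, mul_one, mul_zero, zero_mul, zero_smul, one_mul, zero_add,
        add_zero, one_smul, star_zero, star_one] using this)
    (fun t => by
      have := o ![1, 0] ![1, 0] ![1, t] 1 2 (by decide)
      simpa only [theta, update_one, update_two, eU, eW, Matrix.cons_val_zero,
        Matrix.cons_val_one, imPart, mul_one, mul_zero, zero_mul, zero_smul, one_mul, zero_add,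
        add_zero, one_smul, star_zero, star_one] using this)
  obtain ⟨hA1, hB1, hB1'⟩ : F.coeffU ![1, 0, 1] = 0 ∧ _ ∧ _ :=
    face_coeffs_j (B := F.coeffW ![1, 0, 1])
    (fun t u => by
      have := hp 1 ![![1, u], ![1, 0], ![1, t]] rfl
      rw [eU, eW] at this
      rw [add_comm (t • qK), mul_comm t u]
      simpa only [Matrix.cons_val_zero, Matrix.cons_val_one, Matrix.cons_val, imPart, mul_one,
        mul_zero, zero_mul, zero_smul, one_mul, zero_add, add_zero, one_smul, star_zero,
        star_one] using this)
    (fun t u => by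
      have := hF ![![1, u], ![1, 0], ![1, t]]
      rw [eU, eW] at this
      rw [add_comm (t • qK), mul_comm t u]
      simpa only [Matrix.cons_val_zero, Matrix.cons_val_one, Matrix.cons_val, imPart, mul_one,
        mul_zero, zero_mul, zero_smul, one_mul, zero_add, add_zero, one_smul, star_zero,
        star_one] using this)
    (fun t => by
      have := o ![1, 0] ![1, 0] ![1, t] 2 0 (by decide)
      simpa only [theta, update_zero, update_two, eU, eW, Matrix.cons_val_zero,
        Matrix.cons_val_one, Matrix.cons_val, imPart, mul_one, mul_zero, zero_mul, zero_smul,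
        one_mul, zero_add, add_zero, one_smul, star_zero, star_one] using this)
    (fun t => by
      have := o ![1, t] ![1, 0] ![1, 0] 2 0 (by decide)
      simpa only [theta, update_zero, update_two, eU, eW, Matrix.cons_val_zero,
        Matrix.cons_val_one, Matrix.cons_val, imPart, mul_one, mul_zero, zero_mul, zero_smul,
        one_mul, zero_add, add_zero, one_smul, star_zero, star_one] using this)
  obtain ⟨hA2, hB2, hB2'⟩ : F.coeffU ![1, 1, 0] = 0 ∧ _ ∧ _ :=
    face_coeffs_k (B := F.coeffW ![1, 1, 0])
    (fun t u => by
      have := hp 2 ![![1, t], ![1, u], ![1, 0]] rfl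
      rw [eU, eW] at this
      simpa only [Matrix.cons_val_zero, Matrix.cons_val_one, Matrix.cons_val, imPart, mul_one,
        mul_zero, zero_mul, zero_smul, one_mul, zero_add, add_zero, one_smul, star_zero,
        star_one] using this)
    (fun t u => by
      have := hF ![![1, t], ![1, u], ![1, 0]]
      rw [eU, eW] at this
      simpa only [Matrix.cons_val_zero, Matrix.cons_val_one, Matrix.cons_val, imPart, mul_one,
        mul_zero, zero_mul, zero_smul, one_mul, zero_add, add_zero, one_smul, star_zero,
        star_one] using this)
    (fun t => by
      have := o ![1, t] ![1, 0] ![1, 0] 0 1 (by decide)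
      simpa only [theta, update_one, update_zero, eU, eW, Matrix.cons_val_zero,
        Matrix.cons_val_one, Matrix.cons_val, imPart, mul_one, mul_zero, zero_mul, zero_smul,
        one_mul, zero_add, add_zero, one_smul, star_zero, star_one] using this)
    (fun t => by
      have := o ![1, 0] ![1, t] ![1, 0] 0 1 (by decide)
      simpa only [theta, update_one, update_zero, eU, eW, Matrix.cons_val_zero,
        Matrix.cons_val_one, Matrix.cons_val, imPart, mul_one, mul_zero, zero_mul, zero_smul,
        one_mul, zero_add, add_zero, one_smul, star_zero, star_one] using this)
  rw [hA, hA1, hA2] at eU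
  rw [hB', hB1', hB2'] at eW
  set a := (F.coeffW ![1, 1, 0]).imK
  set b := (F.coeffW ![0, 1, 1]).imI
  set c := (F.coeffW ![1, 0, 1]).imJ
  -- Only the coefficients of stu remain unknown. On each face the derivative transverse to it
  -- contains them; its orthogonality to a derivative along the face kills the imaginary part in U
  -- and the real part in W.
  have o20 := fun s t : ℝ => o ![1, s] ![1, t] ![1, 0] 2 0 (by decide)
  have o01 := fun t u : ℝ => o ![1, 0] ![1, t] ![1, u] 0 1 (by decide)
  have o12 := fun u s : ℝ => o ![1, s] ![1, 0] ![1, u] 1 2 (by decide)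
  have st := fun s t u : ℝ => hF ![![1, s], ![1, t], ![1, u]]
  simp only [theta, update_zero, update_one, update_two, eU, eW, Matrix.cons_val_zero,
    Matrix.cons_val_one, mul_one, mul_zero, zero_mul, zero_smul, one_mul, zero_add, add_zero,
    one_smul, smul_zero] at o20 o01 o12 st
  clear hp hF ho o eU eW
  have k1 : (F.coeffU ![1, 1, 1]).imI = 0 ∧ (F.coeffW ![1, 1, 1]).re = 0 := by
    have e1 := o20 1 1
    have e2 := o20 1 (-1)
    have e3 := o20 (-1) 1
    have e4 := o20 (-1) (-1)
    have e5 := o20 1 2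
    have e6 := o20 1 (-2)
    have e7 := o20 (-1) 2
    have e8 := o20 (-1) (-2)
    clear o20 o01 o12 st
    simp only [Quaternion.re_mul, Quaternion.imI_mul, Quaternion.imJ_mul, Quaternion.imK_mul,
      Quaternion.re_add, Quaternion.imI_add, Quaternion.imJ_add, Quaternion.imK_add,
      Quaternion.re_smul, Quaternion.imI_smul, Quaternion.imJ_smul, Quaternion.imK_smul,
      Quaternion.re_star, Quaternion.imI_star, Quaternion.imJ_star, Quaternion.imK_star,
      Quaternion.re_one, Quaternion.imI_one, Quaternion.imJ_one, Quaternion.imK_one, qI_re,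
      qI_imI, qI_imJ, qI_imK, qJ_re, qJ_imI, qJ_imJ, qJ_imK, qK_re, qK_imI, qK_imJ, qK_imK,
      smul_eq_mul] at e1 e2 e3 e4 e5 e6 e7 e8
    ring_nf at e1 e2 e3 e4 e5 e6 e7 e8
    constructor <;> linarith
  have k2 : (F.coeffU ![1, 1, 1]).imJ = 0 ∧ (F.coeffW ![1, 1, 1]).re = 0 := by
    have e1 := o01 1 1
    have e2 := o01 1 (-1)
    have e3 := o01 (-1) 1
    have e4 := o01 (-1) (-1)
    have e5 := o01 1 2
    have e6 := o01 1 (-2)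
    have e7 := o01 (-1) 2
    have e8 := o01 (-1) (-2)
    clear o20 o01 o12 st
    simp only [Quaternion.re_mul, Quaternion.imI_mul, Quaternion.imJ_mul, Quaternion.imK_mul,
      Quaternion.re_add, Quaternion.imI_add, Quaternion.imJ_add, Quaternion.imK_add,
      Quaternion.re_smul, Quaternion.imI_smul, Quaternion.imJ_smul, Quaternion.imK_smul,
      Quaternion.re_star, Quaternion.imI_star, Quaternion.imJ_star, Quaternion.imK_star,
      Quaternion.re_one, Quaternion.imI_one, Quaternion.imJ_one, Quaternion.imK_one, qI_re,
      qI_imI, qI_imJ, qI_imK, qJ_re, qJ_imI, qJ_imJ, qJ_imK, qK_re, qK_imI, qK_imJ, qK_imK,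
      smul_eq_mul] at e1 e2 e3 e4 e5 e6 e7 e8
    ring_nf at e1 e2 e3 e4 e5 e6 e7 e8
    constructor <;> linarith
  have k3 : (F.coeffU ![1, 1, 1]).imK = 0 ∧ (F.coeffW ![1, 1, 1]).re = 0 := by
    have e1 := o12 1 1
    have e2 := o12 1 (-1)
    have e3 := o12 (-1) 1
    have e4 := o12 (-1) (-1)
    have e5 := o12 1 2
    have e6 := o12 1 (-2)
    have e7 := o12 (-1) 2
    have e8 := o12 (-1) (-2)
    clear o20 o01 o12 st
    simp only [Quaternion.re_mul, Quaternion.imI_mul, Quaternion.imJ_mul, Quaternion.imK_mul,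
      Quaternion.re_add, Quaternion.imI_add, Quaternion.imJ_add, Quaternion.imK_add,
      Quaternion.re_smul, Quaternion.imI_smul, Quaternion.imJ_smul, Quaternion.imK_smul,
      Quaternion.re_star, Quaternion.imI_star, Quaternion.imJ_star, Quaternion.imK_star,
      Quaternion.re_one, Quaternion.imI_one, Quaternion.imJ_one, Quaternion.imK_one, qI_re,
      qI_imI, qI_imJ, qI_imK, qJ_re, qJ_imI, qJ_imJ, qJ_imK, qK_re, qK_imI, qK_imJ, qK_imK,
      smul_eq_mul] at e1 e2 e3 e4 e5 e6 e7 e8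
    ring_nf at e1 e2 e3 e4 e5 e6 e7 e8
    constructor <;> linarith
  clear o20 o01 o12
  -- The Study condition off the faces fixes the real part in U and kills the imaginary part in W.
  have k4 : (F.coeffU ![1, 1, 1]).re = - a - b - c ∧ (F.coeffW ![1, 1, 1]).imI = 0 ∧
      (F.coeffW ![1, 1, 1]).imJ = 0 ∧ (F.coeffW ![1, 1, 1]).imK = 0 := by
    obtain ⟨k1, k0⟩ := k1
    have k2 := k2.1
    have k3 := k3.1
    have e1 := st 1 1 1
    have e2 := st 1 1 (-1)
    have e3 := st 1 (-1) 1
    have e4 := st (-1) 1 1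
    clear st
    simp only [k0, k1, k2, k3, Quaternion.re_mul, Quaternion.re_add, Quaternion.imI_add,
      Quaternion.imJ_add, Quaternion.imK_add, Quaternion.re_smul, Quaternion.imI_smul,
      Quaternion.imJ_smul, Quaternion.imK_smul, Quaternion.re_star, Quaternion.imI_star,
      Quaternion.imJ_star, Quaternion.imK_star, Quaternion.re_one, Quaternion.imI_one,
      Quaternion.imJ_one, Quaternion.imK_one, qI_re, qI_imI, qI_imJ, qI_imK, qJ_re, qJ_imI,
      qJ_imJ, qJ_imK, qK_re, qK_imI, qK_imJ, qK_imK, smul_eq_mul] at e1 e2 e3 e4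
    ring_nf at e1 e2 e3 e4
    refine ⟨?_, ?_, ?_, ?_⟩ <;> linarith
  clear st
  refine ⟨-a, -b, -c, ?_⟩
  clear_value a b c
  refine ext_coeff (fun e => ?_) (fun e => ?_) <;> simp only [canonicalPair] <;>
    rcases mem_exponents e with rfl | rfl | rfl | rfl | rfl | rfl | rfl | rfl
  all_goals ext <;> simp [*] <;> linarith

end TrilinearPair

theorem exists_linearEquiv {p : Fin 2 → ℝ} (hp : p ≠ 0) (α : ℝ) {β : ℝ} (hβ : β ≠ 0) :
    ∃ L : (Fin 2 → ℝ) ≃ₗ[ℝ] (Fin 2 → ℝ), L (stdVec 0) = p ∧ L (stdVec 1) = α • p + β • rot p := by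
  have h : p 0 ^ 2 + p 1 ^ 2 ≠ 0 := by
    intro h
    apply hp
    ext k
    fin_cases k <;> simp <;> nlinarith [sq_nonneg (p 0), sq_nonneg (p 1)]
  let L : (Fin 2 → ℝ) →ₗ[ℝ] (Fin 2 → ℝ) :=
    (LinearMap.proj 0).smulRight p + (LinearMap.proj 1).smulRight (α • p + β • rot p)
  have hL : Function.Injective L := by
    rw [← LinearMap.ker_eq_bot, LinearMap.ker_eq_bot']
    intro x hx
    have h0 := congrFun hx 0
    have h1 := congrFun hx 1
    simp [L, rot, Matrix.vecHead, Matrix.vecTail] at h0 h1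
    have e1 : x 1 = 0 := by
      have : β * (p 0 ^ 2 + p 1 ^ 2) * x 1 = 0 := by linear_combination p 0 * h1 - p 1 * h0
      simpa [hβ, h] using this
    have e0 : x 0 = 0 := by
      rw [e1] at h0 h1
      have : (p 0 ^ 2 + p 1 ^ 2) * x 0 = 0 := by linear_combination p 0 * h0 + p 1 * h1
      simpa [h] using this
    ext k; fin_cases k <;> simp [e0, e1]
  exact ⟨LinearEquiv.ofInjectiveEndo L hL, by simp [L, stdVec], by simp [L, stdVec]⟩

/-! ### Projective changes of the parameters and right factors -/

namespace TrilinearPair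

variable {F : TrilinearPair}

/-- The pair in new parameters, with both entries multiplied by `w` from the right. -/
noncomputable def reparam (F : TrilinearPair) (ρ : Fin 3 → (Fin 2 → ℝ) ≃ₗ[ℝ] (Fin 2 → ℝ))
    (w : Quaternion ℝ) : TrilinearPair where
  coeffU e := triM F.coeffU (fun i => ρ i (stdVec (e i))) * w
  coeffW e := triM F.coeffW (fun i => ρ i (stdVec (e i))) * w

variable {ρ : Fin 3 → (Fin 2 → ℝ) ≃ₗ[ℝ] (Fin 2 → ℝ)} {w : Quaternion ℝ}

theorem reparam_U (v : Fin 3 → Fin 2 → ℝ) :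
    (F.reparam ρ w).U v = F.U (fun i => ρ i (v i)) * w := by
  rw [U_eq, U_eq]
  simp only [reparam]
  rw [triM_mul_right]
  exact congrArg (· * w) (triM_comp F.coeffU (fun i => (ρ i : (Fin 2 → ℝ) →ₗ[ℝ] (Fin 2 → ℝ))) v)

theorem reparam_W (v : Fin 3 → Fin 2 → ℝ) :
    (F.reparam ρ w).W v = F.W (fun i => ρ i (v i)) * w := by
  rw [W_eq, W_eq]
  simp only [reparam]
  rw [triM_mul_right]
  exact congrArg (· * w) (triM_comp F.coeffW (fun i => (ρ i : (Fin 2 → ℝ) →ₗ[ℝ] (Fin 2 → ℝ))) v)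

theorem apply_update_reparam (v : Fin 3 → Fin 2 → ℝ) (i : Fin 3) (x : Fin 2 → ℝ) :
    (fun j => ρ j (Function.update v i x j)) =
      Function.update (fun j => ρ j (v j)) i (ρ i x) := by
  funext j
  exact Function.apply_update (fun j => ρ j) v i x j

theorem reparam_theta (v : Fin 3 → Fin 2 → ℝ) (i : Fin 3) (x : Fin 2 → ℝ) :
    (F.reparam ρ w).theta v i x = star w * F.theta (fun j => ρ j (v j)) i (ρ i x) * w := by
  simp only [theta, reparam_U, reparam_W, apply_update_reparam, star_mul]
  noncomm_ring

theorem reparam_mul_star (v : Fin 3 → Fin 2 → ℝ) :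
    (F.reparam ρ w).U v * star ((F.reparam ρ w).W v) =
      Quaternion.normSq w • (F.U (fun i => ρ i (v i)) * star (F.W (fun i => ρ i (v i)))) := by
  rw [reparam_U, reparam_W, star_mul, mul_assoc, ← mul_assoc w, mul_star_eq_smul_one,
    smul_mul_assoc, one_mul, mul_smul_comm]

theorem IsStudy.reparam (hF : F.IsStudy) : (F.reparam ρ w).IsStudy := fun v => by
  rw [reparam_mul_star, Quaternion.re_smul, hF, smul_zero]

theorem IsOrth.reparam (ho : F.IsOrth) : (F.reparam ρ w).IsOrth := fun v i j hij x y => by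
  have h : ∀ a b : Quaternion ℝ, (star w * a * w * star (star w * b * w)).re =
      Quaternion.normSq w ^ 2 * (a * star b).re := fun a b => by
    simp [normSq_def4]; ring
  rw [reparam_theta, reparam_theta, h, ho _ i j hij, mul_zero]

theorem reparam_mem_domain (hw : w ≠ 0) (v : Fin 3 → Fin 2 → ℝ) :
    v ∈ (F.reparam ρ w).domain ↔ (fun i => ρ i (v i)) ∈ F.domain := by
  simp [domain, reparam_U, reparam_W, hw]

theorem reparam_eval (hw : w ≠ 0) (v : Fin 3 → Fin 2 → ℝ) :
    (F.reparam ρ w).eval v = F.eval (fun i => ρ i (v i)) := by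
  by_cases h : F.W (fun i => ρ i (v i)) = 0
  · rw [eval_eq_infty.2 h, eval_eq_infty.2 (by rw [reparam_W, h, zero_mul])]
  · rw [eval, eval, if_neg h, if_neg (by rw [reparam_W]; exact mul_ne_zero h hw), reparam_U,
      reparam_W, mul_inv_rev, mul_assoc, mul_inv_cancel_left₀ hw]

/-- `ρ i` may tilt `rot (v i)` towards the radial direction, but `theta` ignores the radial part,
and injectivity keeps the `rot` part nonzero. -/
theorem reparam_theta_rot_eq_zero (hw : w ≠ 0) {v : Fin 3 → Fin 2 → ℝ} (hv : ∀ i, v i ≠ 0)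
    (i : Fin 3) (hF : F.IsStudy) : (F.reparam ρ w).theta v i (rot (v i)) = 0 ↔
      F.theta (fun j => ρ j (v j)) i (rot (ρ i (v i))) = 0 := by
  have hw' : star w ≠ 0 := star_ne_zero.2 hw
  rw [reparam_theta, mul_eq_zero, mul_eq_zero]
  simp only [hw, hw', or_false, false_or]
  obtain ⟨a, b, h⟩ := exists_eq_rot (show ρ i (v i) ≠ 0 by simpa using hv i) (ρ i (rot (v i)))
  have hb : b ≠ 0 := by
    rintro rfl
    rw [zero_smul, add_zero, ← map_smul] at h
    have h' := (ρ i).injective h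
    have h0 := congrFun h' 0
    have h1 := congrFun h' 1
    simp [rot] at h0 h1
    have ha : 1 + a ^ 2 ≠ 0 := by positivity
    have e0 : v i 0 * (1 + a ^ 2) = 0 := by linear_combination h1 - a * h0
    have e1 : v i 1 * (1 + a ^ 2) = 0 := by linear_combination -h0 - a * h1
    apply hv i
    ext k
    fin_cases k
    · simpa [ha] using e0
    · simpa [ha] using e1
  rw [h, theta_lin, hF.theta_self (fun j => ρ j (v j)) i, smul_zero, zero_add, smul_eq_zero]
  simp [hb]

/-- The quaternion units `i`, `j`, `k`. -/
def unitQ : Fin 3 → Quaternion ℝ := ![qI, qJ, qK]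

/-- Applied to parameter lines through the origin lying in two coordinate planes, that is, on an
axis: A and AB̄ are both multiples of one unit, which forces B to be real. -/
theorem exists_eq_unitQ {A B : Quaternion ℝ} (i : Fin 3) (hA0 : A ≠ 0) (hA : A.re = 0)
    (hAB : (A * star B).re = 0) (h1 : ∀ j, j ≠ i → imPart A j = 0)
    (h2 : ∀ j, j ≠ i → imPart (A * star B) j = 0) :
    ∃ l η : ℝ, l ≠ 0 ∧ A = l • unitQ i ∧ B = η • 1 := by
  have key : A = imPart A i • unitQ i := by
    fin_cases i
    · ext <;> simp [unitQ, imPart, hA]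
      · simpa [imPart] using h1 1 (by decide)
      · simpa [imPart] using h1 2 (by decide)
    · ext <;> simp [unitQ, imPart, hA]
      · simpa [imPart] using h1 0 (by decide)
      · simpa [imPart] using h1 2 (by decide)
    · ext <;> simp [unitQ, imPart, hA]
      · simpa [imPart] using h1 0 (by decide)
      · simpa [imPart] using h1 1 (by decide)
  have hl : imPart A i ≠ 0 := fun h => hA0 (by rw [key, h, zero_smul])
  refine ⟨imPart A i, B.re, hl, key, ?_⟩
  generalize imPart A i = l at *
  subst key
  fin_cases i
  · have e1 := h2 1 (by decide)
    have e2 := h2 2 (by decide)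
    simp [unitQ, imPart, hl] at e1 e2 hAB
    ext <;> simp [*]
  · have e1 := h2 0 (by decide)
    have e2 := h2 2 (by decide)
    simp [unitQ, imPart, hl] at e1 e2 hAB
    ext <;> simp [*]
  · have e1 := h2 0 (by decide)
    have e2 := h2 1 (by decide)
    simp [unitQ, imPart, hl] at e1 e2 hAB
    ext <;> simp [*]

theorem exists_reparam_canonicalPair_of_W_eq_one (hF : F.IsStudy) (ho : F.IsOrth)
    {v₁ : Fin 3 → Fin 2 → ℝ} (hv : ∀ i, v₁ i ≠ 0) (hU : F.U v₁ = 0) (hW : F.W v₁ = 1)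
    (hr : ∀ i, F.theta v₁ i (rot (v₁ i)) ≠ 0)
    (hp : ∀ i, ∀ v, v i = v₁ i → imPart (F.U v * star (F.W v)) i = 0) :
    ∃ a b c ρ, F.reparam ρ 1 = canonicalPair a b c ∧ ∀ i, ρ i (stdVec 0) = v₁ i := by
  have h1 : ∀ i, ∃ l η : ℝ, l ≠ 0 ∧ F.U (Function.update v₁ i (rot (v₁ i))) = l • unitQ i ∧
      F.W (Function.update v₁ i (rot (v₁ i))) = η • 1 := by
    intro i
    have e : ∀ j, j ≠ i → ∀ τ : ℝ, imPart ((τ • F.U (Function.update v₁ i (rot (v₁ i)))) *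
        star (1 + τ • F.W (Function.update v₁ i (rot (v₁ i))))) j = 0 := by
      intro j hj τ
      have h3 := hp j (Function.update v₁ i ((1 : ℝ) • v₁ i + τ • rot (v₁ i)))
        (Function.update_of_ne hj _ _)
      rw [U_update, W_update] at h3
      simpa [hU, hW] using h3
    have e1 : ∀ j, j ≠ i → imPart (F.U (Function.update v₁ i (rot (v₁ i)))) j = 0 ∧
        imPart (F.U (Function.update v₁ i (rot (v₁ i))) *
          star (F.W (Function.update v₁ i (rot (v₁ i))))) j = 0 := by
      intro j hj
      have e2 := e j hj 1
      have e3 := e j hj (-1)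
      have e4 : ∀ A B : Quaternion ℝ, imPart (((1 : ℝ) • A) * star (1 + (1 : ℝ) • B)) =
          imPart A + imPart (A * star B) := fun A B => by
        rw [← imPartL_apply, ← imPartL_apply, ← imPartL_apply, ← map_add]
        simp [mul_add]
      have e5 : ∀ A B : Quaternion ℝ, imPart (((-1 : ℝ) • A) * star (1 + (-1 : ℝ) • B)) =
          - imPart A + imPart (A * star B) := fun A B => by
        rw [← imPartL_apply, ← imPartL_apply, ← imPartL_apply, ← map_neg, ← map_add]
        simp [mul_add]
      rw [e4, PiLp.add_apply] at e2
      rw [e5, PiLp.add_apply, PiLp.neg_apply] at e3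
      constructor <;> linarith
    refine exists_eq_unitQ i ?_ ?_ (hF _) (fun j hj => (e1 j hj).1) (fun j hj => (e1 j hj).2)
    · intro h
      apply hr i
      rw [theta, h, hU]
      simp
    · have := hF.polar' v₁ i (rot (v₁ i))
      simpa [hU, hW] using this
  choose l η hl hlU hηW using h1
  -- The new second basis vector is l⁻¹(rot v₁ − η v₁). On it U takes the unit as its value, and W
  -- vanishes because W(v₁) = 1.
  choose ρ hρ0 hρ1 using fun i =>
    exists_linearEquiv (hv i) (-(l i)⁻¹ * η i) (inv_ne_zero (hl i))
  have hu0 : ∀ i, F.U (Function.update v₁ i (ρ i (stdVec 1))) = unitQ i := fun i => by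
    rw [hρ1, U_update, hlU, Function.update_eq_self, hU, smul_zero, zero_add, smul_smul,
      inv_mul_cancel₀ (hl i), one_smul]
  have hw0 : ∀ i, F.W (Function.update v₁ i (ρ i (stdVec 1))) = 0 := fun i => by
    rw [hρ1, W_update, hηW, Function.update_eq_self, hW, smul_smul, ← add_smul]
    simp
  have f0 : (fun i => ρ i (stdVec ((![0, 0, 0] : Fin 3 → Fin 2) i))) = v₁ := by
    funext i; rw [← hρ0]; fin_cases i <;> rfl
  have f1 : (fun i => ρ i (stdVec ((![1, 0, 0] : Fin 3 → Fin 2) i))) =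
      Function.update v₁ 0 (ρ 0 (stdVec 1)) := by
    funext i; fin_cases i <;> simp [hρ0]
  have f2 : (fun i => ρ i (stdVec ((![0, 1, 0] : Fin 3 → Fin 2) i))) =
      Function.update v₁ 1 (ρ 1 (stdVec 1)) := by
    funext i; fin_cases i <;> simp [hρ0]
  have f3 : (fun i => ρ i (stdVec ((![0, 0, 1] : Fin 3 → Fin 2) i))) =
      Function.update v₁ 2 (ρ 2 (stdVec 1)) := by
    funext i; fin_cases i <;> simp [hρ0]
  have std0 : stdVec 0 = ![1, 0] := by ext k; fin_cases k <;> simp [stdVec]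
  obtain ⟨a, b, c, h⟩ := eq_canonicalPair (F := F.reparam ρ 1) hF.reparam ho.reparam
    (fun i v hvi => by
      rw [reparam_mul_star, map_one, one_smul]
      exact hp i _ (by rw [hvi, ← std0, hρ0]))
    (by simp only [reparam, ← U_eq, f0, hU, zero_mul])
    (by simp only [reparam, ← W_eq, f0, hW, mul_one])
    (by simp only [reparam, ← U_eq, f1, hu0, mul_one]; rfl)
    (by simp only [reparam, ← W_eq, f1, hw0, zero_mul])
    (by simp only [reparam, ← U_eq, f2, hu0, mul_one]; rfl)
    (by simp only [reparam, ← W_eq, f2, hw0, zero_mul])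
    (by simp only [reparam, ← U_eq, f3, hu0, mul_one]; rfl)
    (by simp only [reparam, ← W_eq, f3, hw0, zero_mul])
  exact ⟨a, b, c, ρ, h, hρ0⟩

theorem reparam_refl_reparam :
    (F.reparam (fun _ => LinearEquiv.refl ℝ _) w).reparam ρ 1 = F.reparam ρ w := by
  refine ext_coeff (fun e => ?_) (fun e => ?_) <;> simp only [reparam] <;>
    rw [mul_one, triM_mul_right] <;> congr 1
  · exact triM_comp F.coeffU (fun _ => LinearMap.id) _
  · exact triM_comp F.coeffW (fun _ => LinearMap.id) _

/-- The right factor W(v₁)⁻¹ leaves the quotient unchanged and makes the constant term of the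
denominator 1. -/
theorem exists_reparam_canonicalPair (hF : F.IsStudy) (ho : F.IsOrth)
    {v₁ : Fin 3 → Fin 2 → ℝ} (hv : ∀ i, v₁ i ≠ 0) (hU : F.U v₁ = 0) (hW : F.W v₁ ≠ 0)
    (hr : ∀ i, F.theta v₁ i (rot (v₁ i)) ≠ 0)
    (hp : ∀ i, ∀ v, v i = v₁ i → imPart (F.U v * star (F.W v)) i = 0) :
    ∃ a b c ρ w, w ≠ 0 ∧ F.reparam ρ w = canonicalPair a b c ∧ ∀ i, ρ i (stdVec 0) = v₁ i := by
  have hw : (F.W v₁)⁻¹ ≠ 0 := inv_ne_zero hW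
  have hr' := fun i => (not_congr (reparam_theta_rot_eq_zero (F := F)
    (ρ := fun _ => LinearEquiv.refl ℝ _) hw hv i hF)).2 (hr i)
  obtain ⟨a, b, c, ρ, h, hρ⟩ := exists_reparam_canonicalPair_of_W_eq_one
    (F := F.reparam (fun _ => LinearEquiv.refl ℝ _) (F.W v₁)⁻¹) hF.reparam ho.reparam hv
    (by rw [reparam_U]; simp [hU]) (by rw [reparam_W]; exact mul_inv_cancel₀ hW) hr'
    (fun i v hvi => by
      rw [reparam_mul_star, imPart_smul, PiLp.smul_apply]
      simp only [LinearEquiv.refl_apply]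
      rw [hp i v hvi, smul_zero])
  refine ⟨a, b, c, ρ, (F.W v₁)⁻¹, hw, ?_, hρ⟩
  rw [← h, reparam_refl_reparam]

end TrilinearPair

/-! ### Reduction to a canonical pair -/

namespace TrilinearPair

variable {F : TrilinearPair}

/-- A non-spherical system with three M-spheres as coordinate surfaces that meet in a regular point
is Möbius equivalent to a canonical one, the origin being a regular value. -/
theorem exists_canonicalPair (hF : F.IsDCSystem) (hns : ¬ F.IsSpherical) (S : Fin 3 → MSphere)
    (hfamily : ∀ i, F.HasMSphere i (S i)) {p : OnePoint E3} (hpS : ∀ i, p ∈ (S i).carrier)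
    (hp : p ∉ F.singularLocus) : ∃ a b c, F.MoebiusEquivalent (canonicalPair a b c) ∧
      ¬ (canonicalPair a b c).IsSpherical ∧
      ((0 : E3) : OnePoint E3) ∉ (canonicalPair a b c).singularLocus := by
  have ho : F.IsOrth := isOrth_of_orthogonal hF.study hF.orthogonal
  obtain ⟨μ, hμ, hμp, F', hF', v₁, hv₁, hv₁p, hr, hpl⟩ :=
    exists_lift_coordPlanes hF.study ho S hfamily hpS hp
  have h0 : F'.eval v₁ = ((0 : E3) : OnePoint E3) := by rw [hF'.eval v₁ hv₁, hv₁p, hμp]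
  obtain ⟨hW, hU⟩ := hF'.study.eval_eq_coe.1 h0
  have hU0 : F'.U v₁ = 0 := by
    rw [hU]
    have : toQ 0 = 0 := by ext <;> simp
    rw [this, zero_mul]
  obtain ⟨a, b, c, ρ, w, hw, h, hρ⟩ := exists_reparam_canonicalPair hF'.study (hF'.isOrth ho)
    hv₁.1 hU0 hW (fun i => by rw [ne_eq, hF'.theta_eq_zero]; exact hr i) hpl
  have hdom : ∀ v, v ∈ (canonicalPair a b c).domain ↔ (fun i => ρ i (v i)) ∈ F.domain := by
    intro v
    rw [← h, reparam_mem_domain hw, hF'.domain]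
  have heval : ∀ v ∈ (canonicalPair a b c).domain,
      (canonicalPair a b c).eval v = μ (F.eval (fun i => ρ i (v i))) := by
    intro v hv
    rw [← hF'.eval _ ((hdom v).1 hv), ← h, reparam_eval hw]
  have hst : (canonicalPair a b c).IsStudy := by rw [← h]; exact hF'.study.reparam
  have hor : (canonicalPair a b c).IsOrth := by rw [← h]; exact (hF'.isOrth ho).reparam
  refine ⟨a, b, c, ⟨μ, hμ, ⟨ρ, 1⟩, fun v => ⟨hdom v, heval v⟩⟩, ?_, ?_⟩
  · rintro ⟨i, hi⟩
    refine hns ⟨i, fun r hr0 => ?_⟩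
    obtain ⟨S, hS⟩ := hi ((ρ i).symm r) (by simpa using hr0)
    obtain ⟨S', hS'⟩ := exists_MSphere_image (inv_mem hμ) S
    refine ⟨S', ?_⟩
    rintro _ ⟨v, hv, hvi, rfl⟩
    have hv' : (fun i => ρ i ((ρ i).symm (v i))) = v := by funext j; simp
    have hd : (fun i => (ρ i).symm (v i)) ∈ (canonicalPair a b c).domain := by
      rw [hdom, hv']; exact hv
    have h1 := hS' _ (hS ⟨_, hd, by simp [hvi], rfl⟩)
    rw [heval _ hd, hv'] at h1
    simpa using h1
  · rintro ⟨v, hv, hj, hv0⟩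
    rw [jacobian_eq_zero_iff hst hor hv] at hj
    obtain ⟨i, hi⟩ := hj
    apply hp
    refine ⟨_, (hdom v).1 hv, ?_, ?_⟩
    · rw [jacobian_eq_zero_iff hF.study ho ((hdom v).1 hv)]
      refine ⟨i, ?_⟩
      rw [← h, reparam_theta_rot_eq_zero hw hv.1 i hF'.study, hF'.theta_eq_zero] at hi
      exact hi
    · apply μ.injective
      rw [← heval v hv, hv0, hμp]

end TrilinearPair

/-! ### Canonical systems -/

/-- The polynomial of the singular curve of the first family in its plane. -/
def curveForm (a b c y z : ℝ) : ℝ :=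
  a * b * c * (y ^ 2 + z ^ 2) ^ 2 + (b * c - a * (a + b + c)) * y ^ 2 +
    (c * (a + b + c) - a * b) * z ^ 2 - (a + b + c)

/-- The factor of the first partial derivative, as a function of the other two parameters. -/
def speedForm (a b c : ℝ) (t u : Fin 2 → ℝ) : ℝ :=
  t 0 ^ 2 * u 0 ^ 2 + a * t 1 ^ 2 * u 0 ^ 2 - c * t 0 ^ 2 * u 1 ^ 2 +
    b * (a + b + c) * t 1 ^ 2 * u 1 ^ 2

/-- `h1` and `h2` say that the slice where the first parameter is 0 takes the value (0, y, z) at (t,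
u). With n = |W|², solving for y and z makes curveForm·n² the product of `speedForm` and a second
factor. -/
theorem curveForm_eq_zero {a b c y z : ℝ} {t u : Fin 2 → ℝ}
    (h1 : y * (t 0 * u 0) - z * (b * t 1 * u 1) = t 1 * u 0)
    (h2 : z * (t 0 * u 0) + y * (b * t 1 * u 1) = t 0 * u 1)
    (hn : t 0 * u 0 ≠ 0 ∨ b * t 1 * u 1 ≠ 0) (hP : speedForm a b c t u = 0) :
    curveForm a b c y z = 0 := by
  obtain ⟨n, hn', hn0⟩ : ∃ n, n = (t 0 * u 0) ^ 2 + (b * t 1 * u 1) ^ 2 ∧ n ≠ 0 := by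
    refine ⟨_, rfl, ?_⟩
    rcases hn with h | h <;> positivity
  have hy : y * n = t 0 * t 1 * (u 0 ^ 2 + b * u 1 ^ 2) := by
    rw [hn']; linear_combination (t 0 * u 0) * h1 + (b * t 1 * u 1) * h2
  have hz : z * n = u 0 * u 1 * (t 0 ^ 2 - b * t 1 ^ 2) := by
    rw [hn']; linear_combination (t 0 * u 0) * h2 - (b * t 1 * u 1) * h1
  have hr : (y ^ 2 + z ^ 2) * n = t 1 ^ 2 * u 0 ^ 2 + t 0 ^ 2 * u 1 ^ 2 := by
    rw [hn', ← mul_pow, ← mul_pow, ← h1, ← h2]; ring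
  have key : curveForm a b c y z * n ^ 2 = 0 := by
    have : curveForm a b c y z * n ^ 2 = a * b * c * ((y ^ 2 + z ^ 2) * n) ^ 2 +
        (b * c - a * (a + b + c)) * (y * n) ^ 2 + (c * (a + b + c) - a * b) * (z * n) ^ 2 -
        (a + b + c) * n ^ 2 := by unfold curveForm; ring
    rw [this, hy, hz, hr, hn']
    unfold speedForm at hP
    linear_combination (-(a + b + c) * t 0 ^ 2 * u 0 ^ 2 + b * c * t 1 ^ 2 * u 0 ^ 2 -
      a * b * t 0 ^ 2 * u 1 ^ 2 - b ^ 3 * t 1 ^ 2 * u 1 ^ 2) * hP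
  exact (mul_eq_zero.1 key).resolve_right (pow_ne_zero 2 hn0)

/-- Every point of the coordinate plane has a preimage in the slice. Eliminating u gives b y t² − A
t + y = 0. Its discriminant A² − 4by² = B² + 4bz² is nonnegative by one of its two forms, according
to the sign of b. Writing the root as 2y/(A + R) avoids a special case b = 0. -/
theorem exists_affine_param (b y z : ℝ) : ∃ t u : ℝ, y - z * (b * t * u) = t ∧
    z + y * (b * t * u) = u := by
  by_cases hy : y = 0
  · exact ⟨0, z, by simp [hy], by simp⟩
  by_cases hz : z = 0
  · exact ⟨y, 0, by simp, by simp [hz]⟩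
  obtain ⟨A, hA⟩ : ∃ A, A = 1 + b * (y ^ 2 + z ^ 2) := ⟨_, rfl⟩
  obtain ⟨B, hB⟩ : ∃ B, B = 1 - b * (y ^ 2 + z ^ 2) := ⟨_, rfl⟩
  have hy2 : 0 < y ^ 2 := by positivity
  have hz2 : 0 < z ^ 2 := by positivity
  have hD : A ^ 2 - 4 * b * y ^ 2 = B ^ 2 + 4 * b * z ^ 2 := by rw [hA, hB]; ring
  have hD0 : 0 ≤ A ^ 2 - 4 * b * y ^ 2 := by
    rcases le_total 0 b with h | h
    · rw [hD]; positivity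
    · nlinarith [sq_nonneg A]
  obtain ⟨R, hR0, hR⟩ : ∃ R, 0 ≤ R ∧ R ^ 2 = A ^ 2 - 4 * b * y ^ 2 :=
    ⟨_, Real.sqrt_nonneg _, Real.sq_sqrt hD0⟩
  have hp : A + R ≠ 0 := by
    intro h
    have h1 : b * y ^ 2 = 0 := by
      have : R = -A := by linarith
      rw [this] at hR; linarith
    have hb : b = 0 := by simpa [hy] using h1
    rw [hb] at hA; linarith
  have hq : B + R ≠ 0 := by
    intro h
    have h1 : b * z ^ 2 = 0 := by
      have : R = -B := by linarith
      rw [hD, this] at hR; linarith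
    have hb : b = 0 := by simpa [hz] using h1
    rw [hb] at hB; linarith
  have e1 : 4 * b * y ^ 2 = A ^ 2 - R ^ 2 := by linarith
  have e2 : 4 * b * z ^ 2 = R ^ 2 - B ^ 2 := by linarith
  have hAB : A + B = 2 := by rw [hA, hB]; ring
  refine ⟨2 * y / (A + R), 2 * z / (B + R), ?_, ?_⟩
  · field_simp
    linear_combination (-1 : ℝ) * e2 + (B + R) * hAB
  · field_simp
    linear_combination e1 + (A + R) * hAB

theorem exists_param {a b c y z : ℝ} (hσ : a + b + c ≠ 0) (h : curveForm a b c y z = 0) :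
    ∃ t u : Fin 2 → ℝ, t ≠ 0 ∧ u ≠ 0 ∧ (t 0 * u 0 ≠ 0 ∨ b * t 1 * u 1 ≠ 0) ∧
      y * (t 0 * u 0) - z * (b * t 1 * u 1) = t 1 * u 0 ∧
      z * (t 0 * u 0) + y * (b * t 1 * u 1) = t 0 * u 1 ∧ speedForm a b c t u = 0 := by
  obtain ⟨t, u, h1, h2⟩ := exists_affine_param b y z
  obtain ⟨n, hn', hn0⟩ : ∃ n, n = 1 + (b * t * u) ^ 2 ∧ n ≠ 0 := ⟨_, rfl, by positivity⟩
  have hy : y * n = t * (1 + b * u ^ 2) := by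
    rw [hn']; linear_combination h1 + (b * t * u) * h2
  have hz : z * n = u * (1 - b * t ^ 2) := by
    rw [hn']; linear_combination h2 - (b * t * u) * h1
  have hr : (y ^ 2 + z ^ 2) * n = t ^ 2 + u ^ 2 := by
    rw [hn']
    linear_combination (y - z * (b * t * u) + t) * h1 + (z + y * (b * t * u) + u) * h2
  have key : speedForm a b c ![1, t] ![1, u] * (-(a + b + c) + b * c * t ^ 2 - a * b * u ^ 2 -
      b ^ 3 * t ^ 2 * u ^ 2) = 0 := by
    have : curveForm a b c y z * n ^ 2 = a * b * c * ((y ^ 2 + z ^ 2) * n) ^ 2 +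
        (b * c - a * (a + b + c)) * (y * n) ^ 2 + (c * (a + b + c) - a * b) * (z * n) ^ 2 -
        (a + b + c) * n ^ 2 := by unfold curveForm; ring
    rw [h, zero_mul, hr, hy, hz, hn'] at this
    simp only [speedForm, Matrix.cons_val_zero, Matrix.cons_val_one]
    linear_combination -this
  have ne1 : ∀ x : ℝ, (![1, x] : Fin 2 → ℝ) ≠ 0 := fun x h => by simpa using congrFun h 0
  have ne2 : ∀ x : ℝ, (![x, 1] : Fin 2 → ℝ) ≠ 0 := fun x h => by simpa using congrFun h 1
  rcases mul_eq_zero.1 key with h3 | h3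
  · exact ⟨![1, t], ![1, u], ne1 _, ne1 _, by simp, by simpa using h1, by simpa using h2, h3⟩
  -- If the second factor vanishes instead, use the other preimage (1/(bt), −1/(bu)), in homogeneous
  -- coordinates; its `speedForm` is −b times that factor.
  · have hb : b ≠ 0 := by
      rintro rfl
      apply hσ
      linarith
    refine ⟨![b * t, 1], ![-(b * u), 1], ne2 _, ne2 _, by simp [hb], ?_, ?_, ?_⟩
    · simp; linear_combination (-b) * h2
    · simp; linear_combination b * h1
    · simp [speedForm]; linear_combination (-b) * h3

/-- The quaternion with the given components. -/
def mkQ (p q r s : ℝ) : Quaternion ℝ := ⟨p, q, r, s⟩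

@[simp] theorem mkQ_re (p q r s : ℝ) : (mkQ p q r s).re = p := rfl
@[simp] theorem mkQ_imI (p q r s : ℝ) : (mkQ p q r s).imI = q := rfl
@[simp] theorem mkQ_imJ (p q r s : ℝ) : (mkQ p q r s).imJ = r := rfl
@[simp] theorem mkQ_imK (p q r s : ℝ) : (mkQ p q r s).imK = s := rfl

theorem mkQ_eq_zero {p q r s : ℝ} : mkQ p q r s = 0 ↔ p = 0 ∧ q = 0 ∧ r = 0 ∧ s = 0 :=
  Quaternion.ext_iff

namespace TrilinearPair

variable {F : TrilinearPair}

theorem U_mk (a b c : ℝ) (v : Fin 3 → Fin 2 → ℝ) : (canonicalPair a b c).U v =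
    mkQ ((a + b + c) * v 0 1 * v 1 1 * v 2 1) (v 0 1 * v 1 0 * v 2 0) (v 0 0 * v 1 1 * v 2 0)
      (v 0 0 * v 1 0 * v 2 1) := by
  ext <;> simp [U, univ_eq_exponents, Fin.prod_univ_three] <;> simp [canonicalPair] <;> ring

theorem W_mk (a b c : ℝ) (v : Fin 3 → Fin 2 → ℝ) : (canonicalPair a b c).W v =
    mkQ (v 0 0 * v 1 0 * v 2 0) (-(b * v 0 0 * v 1 1 * v 2 1)) (-(c * v 0 1 * v 1 0 * v 2 1))
      (-(a * v 0 1 * v 1 1 * v 2 0)) := by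
  ext <;> simp [W, univ_eq_exponents, Fin.prod_univ_three] <;> simp [canonicalPair] <;> ring

theorem isStudy_canonicalPair (a b c : ℝ) : (canonicalPair a b c).IsStudy := fun v => by
  rw [U_mk, W_mk]
  simp
  ring

/-- The factors of the three partial derivatives of a canonical system. -/
def speed (a b c : ℝ) (v : Fin 3 → Fin 2 → ℝ) : Fin 3 → ℝ :=
  ![speedForm a b c (v 1) (v 2), speedForm b c a (v 2) (v 0), speedForm c a b (v 0) (v 1)]

/-- The real factor does not depend on the i-th parameter, so each component of the singular set is
a union of parameter lines on which the map is constant. -/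
theorem theta_canonicalPair (a b c : ℝ) (v : Fin 3 → Fin 2 → ℝ) (i : Fin 3) (w : Fin 2 → ℝ) :
    (canonicalPair a b c).theta v i w =
      ((v i 0 * w 1 - v i 1 * w 0) * speed a b c v i) • unitQ i := by
  simp only [theta, U_mk, W_mk]
  fin_cases i
  · ext <;> simp [unitQ, speed, speedForm] <;> ring
  · ext <;> simp [unitQ, speed, speedForm] <;> ring
  · ext <;> simp [unitQ, speed, speedForm] <;> ring

theorem isOrth_canonicalPair (a b c : ℝ) : (canonicalPair a b c).IsOrth := by
  intro v i j hij x y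
  rw [theta_canonicalPair, theta_canonicalPair, Quaternion.star_smul, smul_mul_smul_comm,
    Quaternion.re_smul]
  have : (unitQ i * star (unitQ j)).re = 0 := by
    fin_cases i <;> fin_cases j <;> simp [unitQ] at hij ⊢
  rw [this, smul_zero]

theorem mem_singularLocus_canonicalPair {a b c : ℝ} {p : OnePoint E3} :
    p ∈ (canonicalPair a b c).singularLocus ↔ ∃ v ∈ (canonicalPair a b c).domain,
      (∃ i, speed a b c v i = 0) ∧ (canonicalPair a b c).eval v = p := by
  refine exists_congr fun v => and_congr_right fun hv => and_congr_left fun _ => ?_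
  rw [jacobian_eq_zero_iff (isStudy_canonicalPair a b c) (isOrth_canonicalPair a b c) hv]
  refine exists_congr fun i => ?_
  have h1 : unitQ i ≠ 0 := by
    intro h
    fin_cases i
    · simpa [unitQ] using congrArg (fun q : Quaternion ℝ => q.imI) h
    · simpa [unitQ] using congrArg (fun q : Quaternion ℝ => q.imJ) h
    · simpa [unitQ] using congrArg (fun q : Quaternion ℝ => q.imK) h
  have h2 : v i 0 * v i 0 + v i 1 * v i 1 ≠ 0 := by
    intro h
    apply hv.1 i
    ext k
    fin_cases k <;> simp <;> nlinarith [mul_self_nonneg (v i 0), mul_self_nonneg (v i 1)]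
  rw [theta_canonicalPair, smul_eq_zero, or_iff_left h1, mul_eq_zero, or_iff_right]
  simpa [rot] using h2

/-- Along a parameter line on which the map has zero derivative it is constant. -/
theorem IsStudy.eval_update (hF : F.IsStudy) {v : Fin 3 → Fin 2 → ℝ} (hv : v ∈ F.domain)
    {i : Fin 3} {x : Fin 2 → ℝ} (hθ : F.theta v i x = 0) (hW : F.W (Function.update v i x) ≠ 0) :
    F.eval v = F.eval (Function.update v i x) := by
  have hWv : F.W v ≠ 0 := by
    intro h
    have hU : F.U v ≠ 0 := by simpa [h] using hv.2
    rw [theta, h, star_zero, zero_mul, zero_add, mul_eq_zero, star_eq_zero] at hθ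
    tauto
  obtain ⟨y, hy, hU⟩ := hF.U_eq_toQ hWv
  rw [hy, eq_comm, hF.eval_eq_coe]
  refine ⟨hW, ?_⟩
  rw [theta, hU, star_mul, mul_assoc, ← mul_add, mul_eq_zero, star_eq_zero, or_iff_right hWv] at hθ
  have : star (toQ y) = - toQ y := by ext <;> simp
  rw [this, neg_mul, add_neg_eq_zero] at hθ
  exact hθ

theorem eval_canonicalPair_eq_coe {a b c : ℝ} {v : Fin 3 → Fin 2 → ℝ} {x : E3} :
    (canonicalPair a b c).eval v = x ↔ (canonicalPair a b c).W v ≠ 0 ∧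
      (canonicalPair a b c).U v = toQ x * (canonicalPair a b c).W v :=
  (isStudy_canonicalPair a b c).eval_eq_coe

/-- `h1` and `h2` say that W vanishes at the point of the line with first parameter 0. The other
coefficients of W along the line then vanish as well, so a line collapses to ∞ only if abc = 0. -/
theorem fiber_infty {a b c : ℝ} {t u : Fin 2 → ℝ} (ht : t ≠ 0) (hu : u ≠ 0)
    (h1 : t 0 * u 0 = 0) (h2 : b * t 1 * u 1 = 0) (hP : speedForm a b c t u = 0) :
    c * t 0 * u 1 = 0 ∧ a * t 1 * u 0 = 0 ∧ a * b * c = 0 := by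
  have ht' : t 0 ≠ 0 ∨ t 1 ≠ 0 := by
    by_contra h; push Not at h; exact ht (by ext k; fin_cases k <;> simp [h])
  have hu' : u 0 ≠ 0 ∨ u 1 ≠ 0 := by
    by_contra h; push Not at h; exact hu (by ext k; fin_cases k <;> simp [h])
  unfold speedForm at hP
  have e : b * (a + b + c) * t 1 ^ 2 * u 1 ^ 2 = 0 := by
    linear_combination ((a + b + c) * t 1 * u 1) * h2
  rcases mul_eq_zero.1 h1 with h | h
  · have h3 : t 1 ≠ 0 := by tauto
    have e1 : a * t 1 * u 0 = 0 := by
      have : (t 1 * u 0) * (a * t 1 * u 0) = 0 := by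
        rw [h] at hP; linear_combination hP - e
      rcases mul_eq_zero.1 this with h4 | h4
      · linear_combination a * h4
      · exact h4
    refine ⟨by rw [h]; ring, e1, ?_⟩
    simp [h3] at e1 h2
    rcases h2 with h4 | h4
    · rw [h4]; ring
    · have : a = 0 := by tauto
      rw [this]; ring
  · have h3 : u 1 ≠ 0 := by tauto
    have e1 : c * t 0 * u 1 = 0 := by
      have : (t 0 * u 1) * (c * t 0 * u 1) = 0 := by
        rw [h] at hP; linear_combination e - hP
      rcases mul_eq_zero.1 this with h4 | h4
      · linear_combination c * h4
      · exact h4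
    refine ⟨e1, by rw [h]; ring, ?_⟩
    simp [h3] at e1 h2
    rcases h2 with h4 | h4
    · rw [h4]; ring
    · have : c = 0 := by tauto
      rw [this]; ring

/-- The parameter line collapses, so its value can be computed at first parameter 0, where the map
takes values in the plane x = 0; the exception is a line with W = 0 throughout. -/
theorem eval_of_speed_first {a b c : ℝ} {v : Fin 3 → Fin 2 → ℝ}
    (hv : v ∈ (canonicalPair a b c).domain) (h : speed a b c v 0 = 0) :
    ((canonicalPair a b c).eval v = ∞ ∧ a * b * c = 0) ∨ ∃ x : E3,
      (canonicalPair a b c).eval v = x ∧ x 0 = 0 ∧ curveForm a b c (x 1) (x 2) = 0 := by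
  have h' : speedForm a b c (v 1) (v 2) = 0 := h
  by_cases hW : (canonicalPair a b c).W (Function.update v 0 ![1, 0]) = 0
  · left
    rw [eval_eq_infty]
    rw [W_mk, mkQ_eq_zero] at hW ⊢
    simp only [Function.update_self, Function.update_of_ne, ne_eq, Fin.reduceEq, not_false_eq_true,
      Matrix.cons_val_zero, Matrix.cons_val_one] at hW
    obtain ⟨g1, g2, g3⟩ := fiber_infty (hv.1 1) (hv.1 2) (by linear_combination hW.1)
      (by linear_combination -hW.2.1) h'
    refine ⟨⟨?_, ?_, ?_, ?_⟩, by linear_combination g3⟩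
    · linear_combination v 0 0 * hW.1
    · linear_combination (v 0 0) * hW.2.1
    · linear_combination (-v 0 1) * g1
    · linear_combination (-v 0 1) * g2
  · right
    have h1 := (isStudy_canonicalPair a b c).eval_update hv (i := 0) (x := ![1, 0])
      (by rw [theta_canonicalPair, h, mul_zero, zero_smul]) hW
    obtain ⟨x, hx, hU⟩ := (isStudy_canonicalPair a b c).U_eq_toQ hW
    refine ⟨x, h1.trans hx, ?_⟩
    rw [U_mk, W_mk] at hU
    rw [W_mk, mkQ_eq_zero] at hW
    have e0 := congrArg (fun q : Quaternion ℝ => q.re) hU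
    have e1 := congrArg (fun q : Quaternion ℝ => q.imI) hU
    have e2 := congrArg (fun q : Quaternion ℝ => q.imJ) hU
    have e3 := congrArg (fun q : Quaternion ℝ => q.imK) hU
    simp only [Function.update_self, Function.update_of_ne, ne_eq, Fin.reduceEq, not_false_eq_true,
      Matrix.cons_val_zero, Matrix.cons_val_one, Quaternion.re_mul, Quaternion.imI_mul,
      Quaternion.imJ_mul, Quaternion.imK_mul, toQ_re, toQ_imI, toQ_imJ, toQ_imK, mkQ_re, mkQ_imI,
      mkQ_imJ, mkQ_imK, mul_zero, zero_mul, mul_one, one_mul, neg_zero, sub_zero, add_zero,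
      zero_add, zero_sub, mul_neg, neg_neg, and_true, neg_eq_zero] at e0 e1 e2 e3 hW
    have hn : v 1 0 * v 2 0 ≠ 0 ∨ b * v 1 1 * v 2 1 ≠ 0 := by
      by_contra h3
      push Not at h3
      apply hW
      constructor <;> [linear_combination h3.1; linear_combination h3.2]
    constructor
    · rcases hn with h3 | h3
      · exact (mul_eq_zero.1 (show x 0 * (v 1 0 * v 2 0) = 0 by
          linear_combination -e1)).resolve_right h3
      · exact (mul_eq_zero.1 (show x 0 * (b * v 1 1 * v 2 1) = 0 by
          linear_combination -e0)).resolve_right h3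
    · exact curveForm_eq_zero (t := v 1) (u := v 2) (by linear_combination -e2) (by
        linear_combination -e3) hn h'

theorem eval_of_speed_second {a b c : ℝ} {v : Fin 3 → Fin 2 → ℝ}
    (hv : v ∈ (canonicalPair a b c).domain) (h : speed a b c v 1 = 0) :
    ((canonicalPair a b c).eval v = ∞ ∧ a * b * c = 0) ∨ ∃ x : E3,
      (canonicalPair a b c).eval v = x ∧ x 1 = 0 ∧ curveForm b c a (x 2) (x 0) = 0 := by
  have h' : speedForm b c a (v 2) (v 0) = 0 := h
  by_cases hW : (canonicalPair a b c).W (Function.update v 1 ![1, 0]) = 0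
  · left
    rw [eval_eq_infty]
    rw [W_mk, mkQ_eq_zero] at hW ⊢
    simp only [Function.update_self, Function.update_of_ne, ne_eq, Fin.reduceEq, not_false_eq_true,
      Matrix.cons_val_zero, Matrix.cons_val_one] at hW
    obtain ⟨g1, g2, g3⟩ := fiber_infty (hv.1 2) (hv.1 0) (by linear_combination hW.1)
      (by linear_combination -hW.2.2.1) h'
    refine ⟨⟨?_, ?_, ?_, ?_⟩, by linear_combination g3⟩
    · linear_combination v 1 0 * hW.1
    · linear_combination (-v 1 1) * g2
    · linear_combination (v 1 0) * hW.2.2.1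
    · linear_combination (-v 1 1) * g1
  · right
    have h1 := (isStudy_canonicalPair a b c).eval_update hv (i := 1) (x := ![1, 0])
      (by rw [theta_canonicalPair, h, mul_zero, zero_smul]) hW
    obtain ⟨x, hx, hU⟩ := (isStudy_canonicalPair a b c).U_eq_toQ hW
    refine ⟨x, h1.trans hx, ?_⟩
    rw [U_mk, W_mk] at hU
    rw [W_mk, mkQ_eq_zero] at hW
    have e0 := congrArg (fun q : Quaternion ℝ => q.re) hU
    have e1 := congrArg (fun q : Quaternion ℝ => q.imI) hU
    have e2 := congrArg (fun q : Quaternion ℝ => q.imJ) hU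
    have e3 := congrArg (fun q : Quaternion ℝ => q.imK) hU
    simp only [Function.update_self, Function.update_of_ne, ne_eq, Fin.reduceEq, not_false_eq_true,
      Matrix.cons_val_zero, Matrix.cons_val_one, Quaternion.re_mul, Quaternion.imI_mul,
      Quaternion.imJ_mul, Quaternion.imK_mul, toQ_re, toQ_imI, toQ_imJ, toQ_imK, mkQ_re, mkQ_imI,
      mkQ_imJ, mkQ_imK, mul_zero, zero_mul, mul_one, neg_zero, sub_zero, add_zero,
      zero_add, zero_sub, mul_neg, neg_neg, and_true, true_and, neg_eq_zero] at e0 e1 e2 e3 hW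
    have hn : v 2 0 * v 0 0 ≠ 0 ∨ c * v 2 1 * v 0 1 ≠ 0 := by
      by_contra h3
      push Not at h3
      apply hW
      constructor <;> [linear_combination h3.1; linear_combination h3.2]
    constructor
    · rcases hn with h3 | h3
      · exact (mul_eq_zero.1 (show x 1 * (v 2 0 * v 0 0) = 0 by
          linear_combination -e2)).resolve_right h3
      · exact (mul_eq_zero.1 (show x 1 * (c * v 2 1 * v 0 1) = 0 by
          linear_combination -e0)).resolve_right h3
    · exact curveForm_eq_zero (t := v 2) (u := v 0) (by linear_combination -e3) (by
        linear_combination -e1) hn h'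

theorem eval_of_speed_third {a b c : ℝ} {v : Fin 3 → Fin 2 → ℝ}
    (hv : v ∈ (canonicalPair a b c).domain) (h : speed a b c v 2 = 0) :
    ((canonicalPair a b c).eval v = ∞ ∧ a * b * c = 0) ∨ ∃ x : E3,
      (canonicalPair a b c).eval v = x ∧ x 2 = 0 ∧ curveForm c a b (x 0) (x 1) = 0 := by
  have h' : speedForm c a b (v 0) (v 1) = 0 := h
  by_cases hW : (canonicalPair a b c).W (Function.update v 2 ![1, 0]) = 0
  · left
    rw [eval_eq_infty]
    rw [W_mk, mkQ_eq_zero] at hW ⊢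
    simp only [Function.update_self, Function.update_of_ne, ne_eq, Fin.reduceEq, not_false_eq_true,
      Matrix.cons_val_zero, Matrix.cons_val_one] at hW
    obtain ⟨g1, g2, g3⟩ := fiber_infty (hv.1 0) (hv.1 1) (by linear_combination hW.1)
      (by linear_combination -hW.2.2.2) h'
    refine ⟨⟨?_, ?_, ?_, ?_⟩, by linear_combination g3⟩
    · linear_combination v 2 0 * hW.1
    · linear_combination (-v 2 1) * g1
    · linear_combination (-v 2 1) * g2
    · linear_combination (v 2 0) * hW.2.2.2
  · right
    have h1 := (isStudy_canonicalPair a b c).eval_update hv (i := 2) (x := ![1, 0])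
      (by rw [theta_canonicalPair, h, mul_zero, zero_smul]) hW
    obtain ⟨x, hx, hU⟩ := (isStudy_canonicalPair a b c).U_eq_toQ hW
    refine ⟨x, h1.trans hx, ?_⟩
    rw [U_mk, W_mk] at hU
    rw [W_mk, mkQ_eq_zero] at hW
    have e0 := congrArg (fun q : Quaternion ℝ => q.re) hU
    have e1 := congrArg (fun q : Quaternion ℝ => q.imI) hU
    have e2 := congrArg (fun q : Quaternion ℝ => q.imJ) hU
    have e3 := congrArg (fun q : Quaternion ℝ => q.imK) hU
    simp only [Function.update_self, Function.update_of_ne, ne_eq, Fin.reduceEq, not_false_eq_true,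
      Matrix.cons_val_zero, Matrix.cons_val_one, Quaternion.re_mul, Quaternion.imI_mul,
      Quaternion.imJ_mul, Quaternion.imK_mul, toQ_re, toQ_imI, toQ_imJ, toQ_imK, mkQ_re, mkQ_imI,
      mkQ_imJ, mkQ_imK, mul_zero, zero_mul, mul_one, neg_zero, sub_zero, add_zero,
      zero_add, zero_sub, mul_neg, neg_neg, true_and, neg_eq_zero] at e0 e1 e2 e3 hW
    have hn : v 0 0 * v 1 0 ≠ 0 ∨ a * v 0 1 * v 1 1 ≠ 0 := by
      by_contra h3
      push Not at h3
      apply hW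
      constructor <;> [linear_combination h3.1; linear_combination h3.2]
    constructor
    · rcases hn with h3 | h3
      · exact (mul_eq_zero.1 (show x 2 * (v 0 0 * v 1 0) = 0 by
          linear_combination -e3)).resolve_right h3
      · exact (mul_eq_zero.1 (show x 2 * (a * v 0 1 * v 1 1) = 0 by
          linear_combination -e0)).resolve_right h3
    · exact curveForm_eq_zero (t := v 0) (u := v 1) (by linear_combination -e1) (by
        linear_combination -e2) hn h'

end TrilinearPair

/-! ### Lifting the singular curves, and the degenerate parameters -/

namespace TrilinearPair

theorem exists_speed_eq_zero_first {a b c : ℝ} (hσ : a + b + c ≠ 0) {x : E3} (hx : x 0 = 0)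
    (h : curveForm a b c (x 1) (x 2) = 0) : ∃ v ∈ (canonicalPair a b c).domain,
      (∃ i, speed a b c v i = 0) ∧ (canonicalPair a b c).eval v = x := by
  obtain ⟨t, u, ht, hu, hn, h1, h2, hP⟩ := exists_param (fun h' => hσ (by linear_combination h')) h
  have hW : (canonicalPair a b c).W ![![1, 0], t, u] ≠ 0 := by
    rw [W_mk, ne_eq, mkQ_eq_zero]
    simp
    simp at hn
    tauto
  refine ⟨![![1, 0], t, u], ⟨fun l => ?_, Or.inr hW⟩, ⟨0, hP⟩, ?_⟩
  · fin_cases l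
    · exact fun h => by simpa using congrFun h 0
    · exact ht
    · exact hu
  · rw [eval_canonicalPair_eq_coe]
    refine ⟨hW, ?_⟩
    rw [U_mk, W_mk]
    ext
    · simp [hx]
    · simp [hx]
    · simp; linear_combination -h1
    · simp; linear_combination -h2

theorem exists_speed_eq_zero_second {a b c : ℝ} (hσ : a + b + c ≠ 0) {x : E3} (hx : x 1 = 0)
    (h : curveForm b c a (x 2) (x 0) = 0) : ∃ v ∈ (canonicalPair a b c).domain,
      (∃ i, speed a b c v i = 0) ∧ (canonicalPair a b c).eval v = x := by
  obtain ⟨t, u, ht, hu, hn, h1, h2, hP⟩ := exists_param (fun h' => hσ (by linear_combination h')) h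
  have hW : (canonicalPair a b c).W ![u, ![1, 0], t] ≠ 0 := by
    rw [W_mk, ne_eq, mkQ_eq_zero]
    simp
    simp at hn
    tauto
  refine ⟨![u, ![1, 0], t], ⟨fun l => ?_, Or.inr hW⟩, ⟨1, hP⟩, ?_⟩
  · fin_cases l
    · exact hu
    · exact fun h => by simpa using congrFun h 0
    · exact ht
  · rw [eval_canonicalPair_eq_coe]
    refine ⟨hW, ?_⟩
    rw [U_mk, W_mk]
    ext
    · simp [hx]
    · simp; linear_combination -h2
    · simp [hx]
    · simp; linear_combination -h1

theorem exists_speed_eq_zero_third {a b c : ℝ} (hσ : a + b + c ≠ 0) {x : E3} (hx : x 2 = 0)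
    (h : curveForm c a b (x 0) (x 1) = 0) : ∃ v ∈ (canonicalPair a b c).domain,
      (∃ i, speed a b c v i = 0) ∧ (canonicalPair a b c).eval v = x := by
  obtain ⟨t, u, ht, hu, hn, h1, h2, hP⟩ := exists_param (fun h' => hσ (by linear_combination h')) h
  have hW : (canonicalPair a b c).W ![t, u, ![1, 0]] ≠ 0 := by
    rw [W_mk, ne_eq, mkQ_eq_zero]
    simp
    simp at hn
    tauto
  refine ⟨![t, u, ![1, 0]], ⟨fun l => ?_, Or.inr hW⟩, ⟨2, hP⟩, ?_⟩
  · fin_cases l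
    · exact ht
    · exact hu
    · exact fun h => by simpa using congrFun h 0
  · rw [eval_canonicalPair_eq_coe]
    refine ⟨hW, ?_⟩
    rw [U_mk, W_mk]
    ext
    · simp [hx]
    · simp; linear_combination -h1
    · simp; linear_combination -h2
    · simp [hx]

/-- The singular locus of a canonical system. -/
theorem mem_singularLocus_iff {a b c : ℝ} (hσ : a + b + c ≠ 0) {p : OnePoint E3} :
    p ∈ (canonicalPair a b c).singularLocus ↔ (p = ∞ ∧ a * b * c = 0) ∨ ∃ x : E3, p = x ∧
      ((x 0 = 0 ∧ curveForm a b c (x 1) (x 2) = 0) ∨ (x 1 = 0 ∧ curveForm b c a (x 2) (x 0) = 0) ∨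
        (x 2 = 0 ∧ curveForm c a b (x 0) (x 1) = 0)) := by
  rw [mem_singularLocus_canonicalPair]
  constructor
  · rintro ⟨v, hv, ⟨i, hi⟩, rfl⟩
    fin_cases i
    · rcases eval_of_speed_first hv hi with h | ⟨x, hx, h⟩
      · exact Or.inl h
      · exact Or.inr ⟨x, hx, Or.inl h⟩
    · rcases eval_of_speed_second hv hi with h | ⟨x, hx, h⟩
      · exact Or.inl h
      · exact Or.inr ⟨x, hx, Or.inr (Or.inl h)⟩
    · rcases eval_of_speed_third hv hi with h | ⟨x, hx, h⟩
      · exact Or.inl h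
      · exact Or.inr ⟨x, hx, Or.inr (Or.inr h)⟩
  · rintro (⟨rfl, h⟩ | ⟨x, rfl, h | h | h⟩)
    -- At the point (∞, ∞, ∞) the denominator vanishes and U = a + b + c. The three factors there
    -- are a + b + c times b, c and a, respectively.
    · refine ⟨fun _ => ![0, 1], ⟨fun i h => by simpa using congrFun h 1, Or.inl ?_⟩, ?_, ?_⟩
      · rw [U_mk, ne_eq, mkQ_eq_zero]
        simp [hσ]
      · have hσ1 : b + c + a ≠ 0 := fun h' => hσ (by linear_combination h')
        have hσ2 : c + a + b ≠ 0 := fun h' => hσ (by linear_combination h')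
        rw [mul_eq_zero, mul_eq_zero] at h
        rcases h with (h | h) | h
        · exact ⟨2, by simp [speed, speedForm, h]⟩
        · exact ⟨0, by simp [speed, speedForm, h]⟩
        · exact ⟨1, by simp [speed, speedForm, h]⟩
      · rw [eval_eq_infty, W_mk, mkQ_eq_zero]
        simp
    · exact exists_speed_eq_zero_first hσ h.1 h.2
    · exact exists_speed_eq_zero_second hσ h.1 h.2
    · exact exists_speed_eq_zero_third hσ h.1 h.2

/-- At s = 0, t = u = ∞ the value is 0, provided b ≠ 0, and the first factor is b(a + b + c). -/
theorem zero_mem_singularLocus {a b c : ℝ} (hσ : a + b + c = 0) (hb : b ≠ 0) :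
    ((0 : E3) : OnePoint E3) ∈ (canonicalPair a b c).singularLocus := by
  rw [mem_singularLocus_canonicalPair]
  have hW : (canonicalPair a b c).W ![![1, 0], ![0, 1], ![0, 1]] ≠ 0 := by
    rw [W_mk, ne_eq, mkQ_eq_zero]
    simp [hb]
  refine ⟨![![1, 0], ![0, 1], ![0, 1]], ⟨fun l => ?_, Or.inr hW⟩, ⟨0, ?_⟩, ?_⟩
  · fin_cases l
    · exact fun h => by simpa using congrFun h 0
    · exact fun h => by simpa using congrFun h 1
    · exact fun h => by simpa using congrFun h 1
  · simp [speed, speedForm, hσ]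
  · rw [eval_canonicalPair_eq_coe]
    refine ⟨hW, ?_⟩
    rw [U_mk]
    ext <;> simp

theorem exists_ne_zero {x : Fin 2 → ℝ} (hx : x ≠ 0) : x 0 ≠ 0 ∨ x 1 ≠ 0 := by
  by_contra h
  push Not at h
  exact hx (by ext k; fin_cases k <;> simp [h])

/-- For a = −c the surfaces of the first family satisfy c·s|x|² + (1 − c·s²)x₀ − s = 0. The equation
is trivial only for c = 0 and s = ∞, where the whole slice is mapped to ∞. The next two lemmas are
its cyclic images. -/
theorem isSpherical_first {a b c : ℝ} (h : c + a = 0) : (canonicalPair a b c).IsSpherical := by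
  refine ⟨0, fun r hr => ?_⟩
  by_cases h0 : c = 0 ∧ r 0 = 0
  · refine ⟨MSphere.plane !₂[1, 1, 1] 0 (fun h' => by simpa using congrArg (fun x : E3 => x 0) h'),
      ?_⟩
    rintro _ ⟨v, hv, rfl, rfl⟩
    have hq : a = 0 := by linarith [h0.1]
    rw [eval_eq_infty.2]
    · exact Set.mem_insert _ _
    · rw [W_mk, mkQ_eq_zero]
      simp [h0.1, h0.2, hq]
  · obtain ⟨S, hS⟩ := genSphere_subset (α := c * r 0 * r 1)
      (β := !₂[r 0 ^ 2 - c * r 1 ^ 2, 0, 0]) (γ := -(r 0 * r 1)) (by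
        rintro ⟨-, h2, h3⟩
        have h2 := congrArg (fun x : E3 => x 0) h2
        simp at h2 h3
        apply hr
        rcases h3 with h3 | h3
        · have hp : c ≠ 0 := fun h' => h0 ⟨h', h3⟩
          simp [h3, hp] at h2
          ext k; fin_cases k <;> simp [h2, h3]
        · simp [h3] at h2
          ext k; fin_cases k <;> simp [h2, h3])
    refine ⟨S, fun p hp => hS ?_⟩
    obtain ⟨v, hv, rfl, rfl⟩ := hp
    by_cases hW : (canonicalPair a b c).W v = 0
    · rw [eval_eq_infty.2 hW, infty_mem_genSphere]
      by_contra h1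
      simp only [mul_eq_zero, not_or] at h1
      obtain ⟨⟨hp, hr0⟩, hr1⟩ := h1
      have hU : (canonicalPair a b c).U v ≠ 0 := hv.2.resolve_right (not_not.2 hW)
      rw [W_mk, mkQ_eq_zero] at hW
      rw [U_mk, ne_eq, mkQ_eq_zero] at hU
      have hq : a = -c := by linarith
      rw [hq] at hW hU
      have hj := exists_ne_zero (hv.1 1)
      have hk := exists_ne_zero (hv.1 2)
      simp [hp, hr0, hr1] at hW hU
      grind
    · obtain ⟨x, hx, hU⟩ := (isStudy_canonicalPair a b c).U_eq_toQ hW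
      rw [hx, coe_mem_genSphere]
      have hN : Quaternion.normSq ((canonicalPair a b c).W v) ≠ 0 := by simpa using hW
      have e1 : Quaternion.normSq ((canonicalPair a b c).U v) =
          ‖x‖ ^ 2 * Quaternion.normSq ((canonicalPair a b c).W v) := by
        rw [hU, map_mul, norm_sq_eq, normSq_def4 (toQ x)]
        simp
      have e2 : (canonicalPair a b c).U v * star ((canonicalPair a b c).W v) =
          Quaternion.normSq ((canonicalPair a b c).W v) • toQ x := by
        rw [hU, mul_assoc, mul_star_eq_smul_one, mul_smul_comm, mul_one]
      have e3 := congrArg (fun q : Quaternion ℝ => q.imI) e2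
      apply (mul_eq_zero.1 ?_).resolve_left hN
      rw [U_mk, W_mk] at e1 e3
      rw [W_mk]
      rw [normSq_def4, normSq_def4] at e1
      rw [normSq_def4] at e3 ⊢
      have hq : a = -c := by linarith
      subst hq
      simp only [mkQ_re, mkQ_imI, mkQ_imJ, mkQ_imK, Quaternion.imI_mul, Quaternion.re_star,
        Quaternion.imI_star, Quaternion.imJ_star, Quaternion.imK_star, Quaternion.imI_smul,
        smul_eq_mul, toQ_imI] at e1 e3 ⊢
      rw [inner_eq]
      simp [-mul_eq_zero]
      linear_combination -(c * v 0 0 * v 0 1) * e1 - (v 0 0 ^ 2 - c * v 0 1 ^ 2) * e3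

theorem isSpherical_second {a b c : ℝ} (h : a + b = 0) : (canonicalPair a b c).IsSpherical := by
  refine ⟨1, fun r hr => ?_⟩
  by_cases h0 : a = 0 ∧ r 0 = 0
  · refine ⟨MSphere.plane !₂[1, 1, 1] 0 (fun h' => by simpa using congrArg (fun x : E3 => x 0) h'),
      ?_⟩
    rintro _ ⟨v, hv, rfl, rfl⟩
    have hq : b = 0 := by linarith [h0.1]
    rw [eval_eq_infty.2]
    · exact Set.mem_insert _ _
    · rw [W_mk, mkQ_eq_zero]
      simp [h0.1, h0.2, hq]
  · obtain ⟨S, hS⟩ := genSphere_subset (α := a * r 0 * r 1)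
      (β := !₂[0, r 0 ^ 2 - a * r 1 ^ 2, 0]) (γ := -(r 0 * r 1)) (by
        rintro ⟨-, h2, h3⟩
        have h2 := congrArg (fun x : E3 => x 1) h2
        simp at h2 h3
        apply hr
        rcases h3 with h3 | h3
        · have hp : a ≠ 0 := fun h' => h0 ⟨h', h3⟩
          simp [h3, hp] at h2
          ext k; fin_cases k <;> simp [h2, h3]
        · simp [h3] at h2
          ext k; fin_cases k <;> simp [h2, h3])
    refine ⟨S, fun p hp => hS ?_⟩
    obtain ⟨v, hv, rfl, rfl⟩ := hp
    by_cases hW : (canonicalPair a b c).W v = 0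
    · rw [eval_eq_infty.2 hW, infty_mem_genSphere]
      by_contra h1
      simp only [mul_eq_zero, not_or] at h1
      obtain ⟨⟨hp, hr0⟩, hr1⟩ := h1
      have hU : (canonicalPair a b c).U v ≠ 0 := hv.2.resolve_right (not_not.2 hW)
      rw [W_mk, mkQ_eq_zero] at hW
      rw [U_mk, ne_eq, mkQ_eq_zero] at hU
      have hq : b = -a := by linarith
      rw [hq] at hW hU
      have hj := exists_ne_zero (hv.1 2)
      have hk := exists_ne_zero (hv.1 0)
      simp [hp, hr0, hr1] at hW hU
      grind
    · obtain ⟨x, hx, hU⟩ := (isStudy_canonicalPair a b c).U_eq_toQ hW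
      rw [hx, coe_mem_genSphere]
      have hN : Quaternion.normSq ((canonicalPair a b c).W v) ≠ 0 := by simpa using hW
      have e1 : Quaternion.normSq ((canonicalPair a b c).U v) =
          ‖x‖ ^ 2 * Quaternion.normSq ((canonicalPair a b c).W v) := by
        rw [hU, map_mul, norm_sq_eq, normSq_def4 (toQ x)]
        simp
      have e2 : (canonicalPair a b c).U v * star ((canonicalPair a b c).W v) =
          Quaternion.normSq ((canonicalPair a b c).W v) • toQ x := by
        rw [hU, mul_assoc, mul_star_eq_smul_one, mul_smul_comm, mul_one]
      have e3 := congrArg (fun q : Quaternion ℝ => q.imJ) e2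
      apply (mul_eq_zero.1 ?_).resolve_left hN
      rw [U_mk, W_mk] at e1 e3
      rw [W_mk]
      rw [normSq_def4, normSq_def4] at e1
      rw [normSq_def4] at e3 ⊢
      have hq : b = -a := by linarith
      subst hq
      simp only [mkQ_re, mkQ_imI, mkQ_imJ, mkQ_imK, Quaternion.imJ_mul, Quaternion.re_star,
        Quaternion.imI_star, Quaternion.imJ_star, Quaternion.imK_star, Quaternion.imJ_smul,
        smul_eq_mul, toQ_imJ] at e1 e3 ⊢
      rw [inner_eq]
      simp [-mul_eq_zero]
      linear_combination -(a * v 1 0 * v 1 1) * e1 - (v 1 0 ^ 2 - a * v 1 1 ^ 2) * e3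

theorem isSpherical_third {a b c : ℝ} (h : b + c = 0) : (canonicalPair a b c).IsSpherical := by
  refine ⟨2, fun r hr => ?_⟩
  by_cases h0 : b = 0 ∧ r 0 = 0
  · refine ⟨MSphere.plane !₂[1, 1, 1] 0 (fun h' => by simpa using congrArg (fun x : E3 => x 0) h'),
      ?_⟩
    rintro _ ⟨v, hv, rfl, rfl⟩
    have hq : c = 0 := by linarith [h0.1]
    rw [eval_eq_infty.2]
    · exact Set.mem_insert _ _
    · rw [W_mk, mkQ_eq_zero]
      simp [h0.1, h0.2, hq]
  · obtain ⟨S, hS⟩ := genSphere_subset (α := b * r 0 * r 1)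
      (β := !₂[0, 0, r 0 ^ 2 - b * r 1 ^ 2]) (γ := -(r 0 * r 1)) (by
        rintro ⟨-, h2, h3⟩
        have h2 := congrArg (fun x : E3 => x 2) h2
        simp at h2 h3
        apply hr
        rcases h3 with h3 | h3
        · have hp : b ≠ 0 := fun h' => h0 ⟨h', h3⟩
          simp [h3, hp] at h2
          ext k; fin_cases k <;> simp [h2, h3]
        · simp [h3] at h2
          ext k; fin_cases k <;> simp [h2, h3])
    refine ⟨S, fun p hp => hS ?_⟩
    obtain ⟨v, hv, rfl, rfl⟩ := hp
    by_cases hW : (canonicalPair a b c).W v = 0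
    · rw [eval_eq_infty.2 hW, infty_mem_genSphere]
      by_contra h1
      simp only [mul_eq_zero, not_or] at h1
      obtain ⟨⟨hp, hr0⟩, hr1⟩ := h1
      have hU : (canonicalPair a b c).U v ≠ 0 := hv.2.resolve_right (not_not.2 hW)
      rw [W_mk, mkQ_eq_zero] at hW
      rw [U_mk, ne_eq, mkQ_eq_zero] at hU
      have hq : c = -b := by linarith
      rw [hq] at hW hU
      have hj := exists_ne_zero (hv.1 0)
      have hk := exists_ne_zero (hv.1 1)
      simp [hp, hr0, hr1] at hW hU
      grind
    · obtain ⟨x, hx, hU⟩ := (isStudy_canonicalPair a b c).U_eq_toQ hW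
      rw [hx, coe_mem_genSphere]
      have hN : Quaternion.normSq ((canonicalPair a b c).W v) ≠ 0 := by simpa using hW
      have e1 : Quaternion.normSq ((canonicalPair a b c).U v) =
          ‖x‖ ^ 2 * Quaternion.normSq ((canonicalPair a b c).W v) := by
        rw [hU, map_mul, norm_sq_eq, normSq_def4 (toQ x)]
        simp
      have e2 : (canonicalPair a b c).U v * star ((canonicalPair a b c).W v) =
          Quaternion.normSq ((canonicalPair a b c).W v) • toQ x := by
        rw [hU, mul_assoc, mul_star_eq_smul_one, mul_smul_comm, mul_one]
      have e3 := congrArg (fun q : Quaternion ℝ => q.imK) e2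
      apply (mul_eq_zero.1 ?_).resolve_left hN
      rw [U_mk, W_mk] at e1 e3
      rw [W_mk]
      rw [normSq_def4, normSq_def4] at e1
      rw [normSq_def4] at e3 ⊢
      have hq : c = -b := by linarith
      subst hq
      simp only [mkQ_re, mkQ_imI, mkQ_imJ, mkQ_imK, Quaternion.imK_mul, Quaternion.re_star,
        Quaternion.imI_star, Quaternion.imJ_star, Quaternion.imK_star, Quaternion.imK_smul,
        smul_eq_mul, toQ_imK] at e1 e3 ⊢
      rw [inner_eq]
      simp [-mul_eq_zero]
      linear_combination -(b * v 2 0 * v 2 1) * e1 - (v 2 0 ^ 2 - b * v 2 1 ^ 2) * e3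

end TrilinearPair

/-! ### Rescaling the parameters a, b, c -/

namespace TrilinearPair

variable {F : TrilinearPair}

/-- Rescaling of a canonical system. -/
theorem MoebiusEquivalent.scale {a b c l : ℝ} (h : F.MoebiusEquivalent (canonicalPair a b c))
    (hl : 0 < l) : F.MoebiusEquivalent (canonicalPair (l ^ 2 * a) (l ^ 2 * b) (l ^ 2 * c)) := by
  obtain ⟨μ, hμ, ρ, h⟩ := h
  have hs : √l ≠ 0 := (Real.sqrt_pos.2 hl).ne'
  -- The identity behind this is F_{l²a, l²b, l²c}(s, t, u) = l⁻¹F_{a, b, c}(ls, lt, lu). Scalings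
  -- were built with a squared ratio, hence the square root.
  obtain ⟨ν, hν, hν1, hν2⟩ := exists_moebius_scaling (inv_ne_zero hs)
  have hs2 : (√l)⁻¹ ^ 2 = l⁻¹ := by rw [inv_pow, Real.sq_sqrt hl.le]
  rw [hs2] at hν2
  have hne : ∀ k : Fin 2, (![1, l] : Fin 2 → ℝ) k ≠ 0 := by
    intro k; fin_cases k <;> simp [hl.ne']
  let D : (Fin 2 → ℝ) ≃ₗ[ℝ] (Fin 2 → ℝ) :=
    LinearEquiv.piCongrRight fun k => LinearEquiv.smulOfNeZero ℝ ℝ (![1, l] k) (hne k)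
  have hD0 : ∀ x, D x 0 = x 0 := fun x => by simp [D]
  have hD1 : ∀ x, D x 1 = l * x 1 := fun x => by simp [D]
  have hU : ∀ v : Fin 3 → Fin 2 → ℝ, (canonicalPair (l ^ 2 * a) (l ^ 2 * b) (l ^ 2 * c)).U v =
      l⁻¹ • (canonicalPair a b c).U (fun i => D (v i)) := fun v => by
    rw [U_mk, U_mk]
    ext <;> simp [hD0, hD1] <;> field_simp
  have hW : ∀ v : Fin 3 → Fin 2 → ℝ, (canonicalPair (l ^ 2 * a) (l ^ 2 * b) (l ^ 2 * c)).W v =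
      (canonicalPair a b c).W (fun i => D (v i)) := fun v => by
    rw [W_mk, W_mk]
    ext <;> simp [hD0, hD1, -mul_eq_mul_left_iff, -mul_eq_mul_right_iff] <;> ring
  have hdom : ∀ v, v ∈ (canonicalPair (l ^ 2 * a) (l ^ 2 * b) (l ^ 2 * c)).domain ↔
      (fun i => D (v i)) ∈ (canonicalPair a b c).domain := fun v => by
    simp [domain, hU, hW, hl.ne']
  refine ⟨ν * μ, mul_mem hν hμ, ⟨fun i => D.trans (ρ.proj i), ρ.perm⟩, fun v => ?_⟩
  obtain ⟨h1, h2⟩ := h (fun i => D (v i))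
  refine ⟨(hdom v).trans h1, fun hv => ?_⟩
  have h3 := h2 ((hdom v).1 hv)
  rw [Equiv.Perm.mul_apply]
  refine Eq.trans ?_ (congrArg ν h3)
  by_cases hw : (canonicalPair a b c).W (fun i => D (v i)) = 0
  · rw [eval_eq_infty.2 hw, hν1, eval_eq_infty, hW, hw]
  · rw [eval, eval, if_neg hw, if_neg (by rwa [hW]), hν2, hU, hW, smul_mul_assoc, imPart_smul]

end TrilinearPair

/-! ### Focal conics -/

theorem exists_fin_three {P : Fin 3 → Prop} : (∃ i, P i) ↔ P 0 ∨ P 1 ∨ P 2 := by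
  constructor
  · rintro ⟨i, h⟩
    fin_cases i
    · exact Or.inl h
    · exact Or.inr (Or.inl h)
    · exact Or.inr (Or.inr h)
  · rintro (h | h | h) <;> exact ⟨_, h⟩

/-- A family of three focal conics together with infinity. -/
theorem isFocalEllipseHyperbola_of_injective {A : Fin 3 → ℝ} (hA : Function.Injective A)
    {Z : Set (OnePoint E3)} (hZ : ∀ p, p ∈ Z ↔ p = ∞ ∨ ∃ x : E3, p = x ∧
      ∃ i, x i = 0 ∧ ∑ j, x j ^ 2 / (A j - A i) = 1) : IsFocalEllipseHyperbola Z := by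
  -- Order the numbers decreasingly. The plane of the smallest carries the ellipse, that of the
  -- middle one the hyperbola, and for the largest all terms are nonpositive, so there are no
  -- points. The summand j = i is a division by 0, hence 0.
  let σ : Equiv.Perm (Fin 3) := Tuple.sort (-A)
  have hσ : StrictMono ((-A) ∘ σ) := (Tuple.monotone_sort (-A)).strictMono_of_injective
    ((neg_injective.comp hA).comp σ.injective)
  have h01 : A (σ 1) < A (σ 0) := by simpa using hσ (show (0 : Fin 3) < 1 by decide)
  have h12 : A (σ 2) < A (σ 1) := by simpa using hσ (show (1 : Fin 3) < 2 by decide)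
  have h02 := h12.trans h01
  refine ⟨σ, √(A (σ 0) - A (σ 2)), √(A (σ 1) - A (σ 2)), √(A (σ 0) - A (σ 1)),
    Real.sqrt_pos.2 (by linarith), Real.sqrt_pos.2 (by linarith), Real.sqrt_pos.2 (by linarith),
    ?_, ?_⟩
  · rw [Real.sq_sqrt, Real.sq_sqrt, Real.sq_sqrt] <;> linarith
  · rw [Real.sq_sqrt (by linarith), Real.sq_sqrt (by linarith), Real.sq_sqrt (by linarith)]
    ext p
    rw [hZ, Set.mem_insert_iff]
    refine or_congr_right ?_
    simp only [Set.mem_image, Set.mem_union, Set.mem_ofPred_eq]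
    refine exists_congr fun x => ?_
    rw [and_comm, eq_comm]
    refine and_congr_left fun _ => ?_
    have e : ∀ i, ∑ j, x j ^ 2 / (A j - A i) = ∑ j, x (σ j) ^ 2 / (A (σ j) - A i) := fun i =>
      (Equiv.sum_comp σ fun j => x j ^ 2 / (A j - A i)).symm
    have n1 : A (σ 1) - A (σ 0) = -(A (σ 0) - A (σ 1)) := by ring
    have n2 : A (σ 2) - A (σ 0) = -(A (σ 0) - A (σ 2)) := by ring
    have n3 : A (σ 2) - A (σ 1) = -(A (σ 1) - A (σ 2)) := by ring
    rw [← σ.exists_congr_right]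
    simp only [e, exists_fin_three, Fin.sum_univ_three, sub_self, div_zero, zero_add, add_zero]
    rw [n1, n2, n3, div_neg, div_neg, div_neg, or_iff_right, or_comm]
    · simp only [sub_eq_add_neg]
    · rintro ⟨-, h⟩
      have p1 : 0 ≤ x (σ 1) ^ 2 / (A (σ 0) - A (σ 1)) := div_nonneg (sq_nonneg _) (by linarith)
      have p2 : 0 ≤ x (σ 2) ^ 2 / (A (σ 0) - A (σ 2)) := div_nonneg (sq_nonneg _) (by linarith)
      linarith

/-! ### Ovals -/

/-- The set is a simple closed curve of the complex plane. -/
def IsPlaneOval (D : Set ℂ) : Prop :=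
  ∃ f : Circle → ℂ, Continuous f ∧ Function.Injective f ∧ Set.range f = D

theorem IsPlaneOval.image {D : Set ℂ} (hD : IsPlaneOval D) {J : ℂ → E3} (hJ : Continuous J)
    (hJ' : Function.Injective J) : IsOneOval (J '' D) := by
  obtain ⟨f, hf, hi, rfl⟩ := hD
  rw [← Set.range_comp]
  exact ⟨((hJ.comp hf).isClosedEmbedding (hJ'.comp hi)).isEmbedding.toHomeomorph.symm⟩

theorem isPlaneOval_radial {ρ : Circle → ℝ} (hρ : Continuous ρ) (h0 : ∀ z, 0 < ρ z) :
    IsPlaneOval {p : ℂ | ∃ z : Circle, p = ρ z * z} := by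
  refine ⟨fun z => ρ z * z, by fun_prop, fun z w h => ?_, ?_⟩
  · have h1 := congrArg norm h
    simp only [norm_mul, Complex.norm_real, Circle.norm_coe, mul_one, Real.norm_eq_abs,
      abs_of_pos (h0 _)] at h1
    simp only [h1] at h
    exact Circle.coe_injective (mul_left_cancel₀ (by simpa using (h0 w).ne') h)
  · ext p
    simp [eq_comm]

/-- A symmetric bicircular quartic of the complex plane. -/
def planeQuartic (A B δ : ℝ) : Set ℂ :=
  {p | (p.re ^ 2 + p.im ^ 2) ^ 2 - 2 * A * p.re ^ 2 - 2 * B * p.im ^ 2 + δ = 0}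

theorem circle_re_sq_add_im_sq (z : Circle) : (z : ℂ).re ^ 2 + (z : ℂ).im ^ 2 = 1 := by
  have := Circle.normSq_coe z
  rw [Complex.normSq_apply] at this
  linarith

theorem exists_polar {p : ℂ} (hp : p ≠ 0) : ∃ (r : ℝ) (z : Circle), 0 < r ∧ p = r * z := by
  exact ⟨‖p‖, Circle.exp p.arg, norm_pos_iff.2 hp, (Complex.norm_mul_exp_arg_mul_I p).symm⟩

/-- The value of the quadratic form with eigenvalues `A`, `B` in a direction. -/
def dirForm (A B : ℝ) (z : Circle) : ℝ := A * (z : ℂ).re ^ 2 + B * (z : ℂ).im ^ 2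

theorem continuous_dirForm (A B : ℝ) : Continuous (dirForm A B) := by
  unfold dirForm
  fun_prop

theorem polar_mem_planeQuartic {A B δ r : ℝ} {z : Circle} :
    (r * z : ℂ) ∈ planeQuartic A B δ ↔ (r ^ 2 - dirForm A B z) ^ 2 = dirForm A B z ^ 2 - δ := by
  have h := circle_re_sq_add_im_sq z
  simp only [planeQuartic, Set.mem_ofPred_eq, Complex.re_ofReal_mul, Complex.im_ofReal_mul,
    mul_pow, ← mul_add, h]
  unfold dirForm
  constructor <;> intro h' <;> linarith

/-- In each direction the quadratic in r² has root product −1, hence exactly one positive root, and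
the curve is star-shaped about 0. -/
theorem isPlaneOval_planeQuartic (A B : ℝ) : IsPlaneOval (planeQuartic A B (-1)) := by
  have hs : ∀ z, |dirForm A B z| < √(dirForm A B z ^ 2 + 1) := fun z =>
    Real.lt_sqrt_of_sq_lt (by rw [sq_abs]; linarith)
  have hpos : ∀ z, 0 < dirForm A B z + √(dirForm A B z ^ 2 + 1) := fun z => by
    linarith [hs z, neg_abs_le (dirForm A B z)]
  have hc := continuous_dirForm A B
  convert isPlaneOval_radial (ρ := fun z => √(dirForm A B z + √(dirForm A B z ^ 2 + 1)))
    (by fun_prop) (fun z => Real.sqrt_pos.2 (hpos z)) using 1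
  ext p
  have hsq : ∀ z, √(dirForm A B z ^ 2 + 1) ^ 2 = dirForm A B z ^ 2 + 1 := fun z =>
    Real.sq_sqrt (by positivity)
  constructor
  · intro hp
    have h0 : p ≠ 0 := by
      rintro rfl
      simp [planeQuartic] at hp
    obtain ⟨r, z, hr, rfl⟩ := exists_polar h0
    rw [polar_mem_planeQuartic, sub_neg_eq_add, ← hsq, sq_eq_sq_iff_eq_or_eq_neg] at hp
    refine ⟨z, ?_⟩
    have : r ^ 2 = dirForm A B z + √(dirForm A B z ^ 2 + 1) := by
      rcases hp with h | h
      · linarith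
      · nlinarith [hs z, le_abs_self (dirForm A B z)]
    rw [← this, Real.sqrt_sq hr.le]
  · rintro ⟨z, rfl⟩
    rw [polar_mem_planeQuartic, Real.sq_sqrt (hpos z).le]
    linear_combination hsq z

/-- The directional form exceeds 1 everywhere, so both roots in r² are positive and distinct: two
nested star-shaped ovals. -/
theorem isPlaneOval_pair {A B : ℝ} (hA : 1 < A) (hB : 1 < B) : ∃ D₁ D₂, IsPlaneOval D₁ ∧
    IsPlaneOval D₂ ∧ Disjoint D₁ D₂ ∧ planeQuartic A B 1 = D₁ ∪ D₂ := by
  have hE : ∀ z, 1 < dirForm A B z := fun z => by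
    have := circle_re_sq_add_im_sq z
    have hm : 1 < min A B := lt_min hA hB
    unfold dirForm
    nlinarith [mul_le_mul_of_nonneg_right (min_le_left A B) (sq_nonneg (z : ℂ).re),
      mul_le_mul_of_nonneg_right (min_le_right A B) (sq_nonneg (z : ℂ).im)]
  have hc := continuous_dirForm A B
  have h1 : ∀ z, 0 < dirForm A B z ^ 2 - 1 := fun z => by nlinarith [hE z]
  have hs0 : ∀ z, 0 < √(dirForm A B z ^ 2 - 1) := fun z => Real.sqrt_pos.2 (h1 z)
  have hsq : ∀ z, √(dirForm A B z ^ 2 - 1) ^ 2 = dirForm A B z ^ 2 - 1 := fun z =>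
    Real.sq_sqrt (h1 z).le
  have hpos : ∀ z, 0 < dirForm A B z + √(dirForm A B z ^ 2 - 1) := fun z => by
    linarith [hs0 z, hE z]
  have hpos' : ∀ z, 0 < dirForm A B z - √(dirForm A B z ^ 2 - 1) := fun z => by
    nlinarith [hs0 z, hE z, hsq z]
  refine ⟨_, _, isPlaneOval_radial (ρ := fun z => √(dirForm A B z + √(dirForm A B z ^ 2 - 1)))
    (by fun_prop) (fun z => Real.sqrt_pos.2 (hpos z)),
    isPlaneOval_radial (ρ := fun z => √(dirForm A B z - √(dirForm A B z ^ 2 - 1)))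
    (by fun_prop) (fun z => Real.sqrt_pos.2 (hpos' z)), ?_, ?_⟩
  · rw [Set.disjoint_left]
    rintro p ⟨z, rfl⟩ ⟨w, hw⟩
    have hn := congrArg norm hw
    simp only [norm_mul, Complex.norm_real, Circle.norm_coe, mul_one, Real.norm_eq_abs,
      abs_of_nonneg (Real.sqrt_nonneg _)] at hn
    rw [hn] at hw
    have hzw : z = w := Circle.coe_injective (mul_left_cancel₀ (by
      simpa using (Real.sqrt_pos.2 (hpos' w)).ne') hw)
    subst hzw
    rw [Real.sqrt_inj (hpos z).le (hpos' z).le] at hn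
    linarith [hs0 z]
  · ext p
    constructor
    · intro hp
      have h0 : p ≠ 0 := by
        rintro rfl
        simp [planeQuartic] at hp
      obtain ⟨r, z, hr, rfl⟩ := exists_polar h0
      rw [polar_mem_planeQuartic, ← hsq, sq_eq_sq_iff_eq_or_eq_neg] at hp
      rcases hp with h | h
      · refine Or.inl ⟨z, ?_⟩
        rw [← h, add_sub_cancel, Real.sqrt_sq hr.le]
      · refine Or.inr ⟨z, ?_⟩
        rw [sub_eq_add_neg, ← h, add_sub_cancel, Real.sqrt_sq hr.le]
    · rintro (⟨z, rfl⟩ | ⟨z, rfl⟩)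
      · rw [polar_mem_planeQuartic, Real.sq_sqrt (hpos z).le]
        linear_combination hsq z
      · rw [polar_mem_planeQuartic, Real.sq_sqrt (hpos' z).le]
        linear_combination hsq z

theorem planeQuartic_eq_empty {A B : ℝ} (hA : A < 0) (hB : B < 0) : planeQuartic A B 1 = ∅ := by
  ext p
  simp only [planeQuartic, Set.mem_ofPred_eq, Set.mem_empty_iff_false, iff_false]
  nlinarith [sq_nonneg (p.re ^ 2 + p.im ^ 2), mul_nonneg (neg_nonneg.2 hA.le) (sq_nonneg p.re),
    mul_nonneg (neg_nonneg.2 hB.le) (sq_nonneg p.im)]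

/-- With ρ = x² + y² the equation becomes (ρ − A)² + 2(A − B)y² = A² − 1, an ellipse in the (ρ,
y)-plane. It is parametrized by the circle. The value x² = ρ − y² recovered from it equals `g`,
which is positive because B < 0, so each sign of x gives one oval. -/
theorem isPlaneOval_side {A B ε : ℝ} (hA : 1 < A) (hB : B < 0) (hε : ε ^ 2 = 1) :
    IsPlaneOval {p ∈ planeQuartic A B 1 | 0 < ε * p.re} := by
  have hA1 : 0 < A ^ 2 - 1 := by nlinarith
  obtain ⟨m, hm0, hm⟩ : ∃ m, 0 < m ∧ m ^ 2 = A ^ 2 - 1 :=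
    ⟨_, Real.sqrt_pos.2 hA1, Real.sq_sqrt hA1.le⟩
  have hmA : m < A := by nlinarith
  have hAB : 0 < 2 * (A - B) := by linarith
  have hAB' : A - B ≠ 0 := fun h => by linarith
  obtain ⟨κ, hκ0, hκ⟩ : ∃ κ, 0 < κ ∧ κ ^ 2 = m ^ 2 / (2 * (A - B)) :=
    ⟨_, Real.sqrt_pos.2 (by positivity), Real.sq_sqrt (by positivity)⟩
  have hκ' : 2 * (A - B) * κ ^ 2 = m ^ 2 := by rw [hκ]; field_simp
  let ρ : Circle → ℝ := fun z => A + m * (z : ℂ).re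
  let g : Circle → ℝ := fun z => (ρ z ^ 2 - 2 * B * ρ z + 1) / (2 * (A - B))
  have hρ : ∀ z, 0 < ρ z := fun z => by
    have h1 := circle_re_sq_add_im_sq z
    have h2 : -1 ≤ (z : ℂ).re := by nlinarith [sq_nonneg (z : ℂ).im]
    have : 0 < A + m * (z : ℂ).re := by nlinarith
    exact this
  have hg : ∀ z, 0 < g z := fun z => by
    have := mul_pos (neg_pos.2 hB) (hρ z)
    exact div_pos (by nlinarith [sq_nonneg (ρ z)]) hAB
  have hsq : ∀ z, √(g z) ^ 2 = g z := fun z => Real.sq_sqrt (hg z).le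
  have hsum : ∀ z, g z + (κ * (z : ℂ).im) ^ 2 = ρ z := fun z => by
    have h1 := circle_re_sq_add_im_sq z
    have h2 : 2 * (A - B) * g z = ρ z ^ 2 - 2 * B * ρ z + 1 := by
      simp only [g]; field_simp
    have h3 : 2 * (A - B) * (g z + (κ * (z : ℂ).im) ^ 2) = 2 * (A - B) * ρ z := by
      rw [mul_add, h2, mul_pow, ← mul_assoc, hκ']
      simp only [ρ]
      linear_combination m ^ 2 * h1 + hm
    exact mul_left_cancel₀ hAB.ne' h3
  have hεn : ε ≠ 0 := by rintro rfl; norm_num at hε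
  refine ⟨fun z => ⟨ε * √(g z), κ * (z : ℂ).im⟩, ?_, fun z w h => ?_, ?_⟩
  · have h1 : Continuous g := by fun_prop
    have h2 : Continuous fun z : Circle => (((ε * √(g z) : ℝ) : ℂ) +
        ((κ * (z : ℂ).im : ℝ) : ℂ) * Complex.I) := by fun_prop
    convert h2 using 2 with z
    apply Complex.ext <;> simp
  · have h1 : ε * √(g z) = ε * √(g w) := congrArg Complex.re h
    have h2 : κ * (z : ℂ).im = κ * (w : ℂ).im := congrArg Complex.im h
    have h3 : ρ z = ρ w := by
      rw [← hsum z, ← hsum w, h2, ← hsq z, mul_left_cancel₀ hεn h1, hsq]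
    refine Circle.coe_injective (Complex.ext ?_ (mul_left_cancel₀ hκ0.ne' h2))
    have h4 : m * (z : ℂ).re = m * (w : ℂ).re := by
      simp only [ρ] at h3; linarith
    exact mul_left_cancel₀ hm0.ne' h4
  · ext p
    simp only [Set.mem_range, Set.mem_ofPred_eq, planeQuartic]
    constructor
    · rintro ⟨z, rfl⟩
      have h2 : 2 * (A - B) * g z = ρ z ^ 2 - 2 * B * ρ z + 1 := by
        simp only [g]; field_simp
      have hs := Real.sqrt_pos.2 (hg z)
      constructor
      · simp only [mul_pow ε, hε, one_mul, hsq]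
        rw [hsum]
        linear_combination -h2 - 2 * B * hsum z
      · have : ε * (ε * √(g z)) = √(g z) := by rw [← mul_assoc, ← pow_two, hε, one_mul]
        simpa only [this] using hs
    · rintro ⟨h1, h2⟩
      obtain ⟨r, hr⟩ : ∃ r, r = p.re ^ 2 + p.im ^ 2 := ⟨_, rfl⟩
      have h3 : (r - A) ^ 2 + m ^ 2 * (p.im / κ) ^ 2 = m ^ 2 := by
        have e : m ^ 2 * (p.im / κ) ^ 2 = 2 * (A - B) * p.im ^ 2 := by
          rw [← hκ']; field_simp
        rw [e, hr, hm]; linear_combination h1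
      have h4 : ((r - A) / m) ^ 2 + (p.im / κ) ^ 2 = 1 := by
        field_simp at h3 ⊢
        linear_combination h3
      have hz : (⟨(r - A) / m, p.im / κ⟩ : ℂ) ∈ Submonoid.unitSphere ℂ := by
        have h5 : Complex.normSq ⟨(r - A) / m, p.im / κ⟩ = 1 := by
          rw [Complex.normSq_apply]
          linear_combination h4
        refine mem_sphere_zero_iff_norm.2 ?_
        rw [Complex.norm_def, h5, Real.sqrt_one]
      refine ⟨⟨_, hz⟩, ?_⟩
      have e1 : ρ ⟨_, hz⟩ = r := by
        simp only [ρ]; field_simp; ring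
      have e2 : g ⟨_, hz⟩ = p.re ^ 2 := by
        have h5 : κ * (p.im / κ) = p.im := by field_simp
        have := hsum ⟨_, hz⟩
        rw [e1] at this
        simp only [h5] at this
        linarith
      apply Complex.ext
      · simp only [e2]
        rw [← one_mul (p.re ^ 2), ← hε, ← mul_pow, Real.sqrt_sq h2.le, ← mul_assoc, ← pow_two, hε,
          one_mul]
      · simp only
        field_simp

theorem isPlaneOval_sides {A B : ℝ} (hA : 1 < A) (hB : B < 0) : ∃ D₁ D₂, IsPlaneOval D₁ ∧
    IsPlaneOval D₂ ∧ Disjoint D₁ D₂ ∧ planeQuartic A B 1 = D₁ ∪ D₂ := by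
  refine ⟨_, _, isPlaneOval_side (ε := 1) hA hB (by norm_num),
    isPlaneOval_side (ε := -1) hA hB (by norm_num), ?_, ?_⟩
  · rw [Set.disjoint_left]
    rintro p ⟨-, h1⟩ ⟨-, h2⟩
    linarith
  · ext p
    simp only [Set.mem_union, Set.mem_ofPred_eq, ← and_or_left]
    refine ⟨fun h => ⟨h, ?_⟩, fun h => h.1⟩
    rcases lt_trichotomy p.re 0 with h1 | h1 | h1
    · right; linarith
    · exfalso
      simp only [planeQuartic, Set.mem_ofPred_eq, h1] at h
      nlinarith [sq_nonneg (p.im ^ 2), mul_nonneg (neg_nonneg.2 hB.le) (sq_nonneg p.im)]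
    · left; linarith

/-- The parametrization of the coordinate planes that carry the three quartics. -/
noncomputable def planeChart (p : ℂ) : Fin 3 → E3 :=
  ![!₂[p.re, p.im, 0], !₂[p.im, 0, p.re], !₂[0, p.re, p.im]]

theorem continuous_planeChart (i : Fin 3) : Continuous fun p => planeChart p i := by
  fin_cases i
  · show Continuous fun p : ℂ => (!₂[p.re, p.im, 0] : E3)
    fun_prop
  · show Continuous fun p : ℂ => (!₂[p.im, 0, p.re] : E3)
    fun_prop
  · show Continuous fun p : ℂ => (!₂[0, p.re, p.im] : E3)
    fun_prop

theorem planeChart_injective (i : Fin 3) : Function.Injective fun p => planeChart p i := by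
  intro p q h
  have h0 := congrArg (fun x : E3 => x 0) h
  have h1 := congrArg (fun x : E3 => x 1) h
  have h2 := congrArg (fun x : E3 => x 2) h
  fin_cases i <;> simp [planeChart] at h0 h1 h2 <;> apply Complex.ext <;> assumption

/-- Listing the coordinates of the planes cyclically, (x, y), (z, x), (y, z), makes the coefficient
pairs cyclic too: (K, −M), (M, −N), (N, −K). -/
theorem quartic_eq_image (δ K M N : ℝ) (i : Fin 3) : quartic δ K M N i =
    (fun p => planeChart p i) '' planeQuartic (![K, M, N] i) (-(![M, N, K] i)) δ := by
  ext x
  constructor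
  · intro h
    fin_cases i
    · refine ⟨⟨x 0, x 1⟩, ?_, ?_⟩
      · simp [planeQuartic]; linear_combination h.2
      · ext k; fin_cases k <;> simp [planeChart, h.1.symm]
    · refine ⟨⟨x 2, x 0⟩, ?_, ?_⟩
      · simp [planeQuartic]; linear_combination h.2
      · ext k; fin_cases k <;> simp [planeChart, h.1.symm]
    · refine ⟨⟨x 1, x 2⟩, ?_, ?_⟩
      · simp [planeQuartic]; linear_combination h.2
      · ext k; fin_cases k <;> simp [planeChart, h.1.symm]
  · rintro ⟨p, hp, rfl⟩
    fin_cases i <;> simp [planeQuartic, planeChart, quartic] at hp ⊢ <;> linear_combination hp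

theorem isOneOval_quartic (K M N : ℝ) (i : Fin 3) : IsOneOval (quartic (-1) K M N i) := by
  rw [quartic_eq_image]
  exact (isPlaneOval_planeQuartic _ _).image (continuous_planeChart i) (planeChart_injective i)

theorem IsPlaneOval.swap {D : Set ℂ} (hD : IsPlaneOval D) :
    IsPlaneOval {p : ℂ | (⟨p.im, p.re⟩ : ℂ) ∈ D} := by
  obtain ⟨f, hf, hi, rfl⟩ := hD
  refine ⟨fun z => ⟨(f z).im, (f z).re⟩, ?_, fun z w h => hi ?_, ?_⟩
  · have h2 : Continuous fun z : Circle => (((f z).im : ℂ) + ((f z).re : ℂ) * Complex.I) := by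
      fun_prop
    convert h2 using 2 with z
    apply Complex.ext <;> simp
  · exact Complex.ext (congrArg Complex.im h) (congrArg Complex.re h)
  · ext p
    simp only [Set.mem_range, Set.mem_ofPred_eq]
    refine exists_congr fun z => ⟨?_, fun h => ?_⟩
    · rintro rfl; rfl
    · rw [h]

theorem exists_plane_ovals {A B : ℝ} (hA : 1 < A ^ 2) (hB : 1 < B ^ 2) (h : 0 < A ∨ 0 < B) :
    ∃ D₁ D₂, IsPlaneOval D₁ ∧ IsPlaneOval D₂ ∧ Disjoint D₁ D₂ ∧ planeQuartic A B 1 = D₁ ∪ D₂ := by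
  rcases lt_or_ge 0 A with hA0 | hA0
  · have hA1 : 1 < A := by nlinarith
    rcases lt_or_ge 0 B with hB0 | hB0
    · exact isPlaneOval_pair hA1 (by nlinarith)
    · exact isPlaneOval_sides hA1 (lt_of_le_of_ne hB0 (by rintro rfl; norm_num at hB))
  · have hB0 : 0 < B := h.resolve_left (not_lt.2 hA0)
    obtain ⟨D₁, D₂, h1, h2, h3, h4⟩ := isPlaneOval_sides (A := B) (B := A) (by nlinarith)
      (lt_of_le_of_ne hA0 (by rintro rfl; norm_num at hA))
    refine ⟨_, _, h1.swap, h2.swap, ?_, ?_⟩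
    · rw [Set.disjoint_left] at h3 ⊢
      exact fun p hp => h3 hp
    · ext p
      have h5 : (⟨p.im, p.re⟩ : ℂ) ∈ planeQuartic B A 1 ↔
          (⟨p.im, p.re⟩ : ℂ) ∈ D₁ ∪ D₂ := by rw [h4]
      refine Iff.trans ?_ h5
      simp only [planeQuartic, Set.mem_ofPred_eq]
      constructor <;> intro h <;> linear_combination h

theorem isTwoOval_quartic {K M N : ℝ} {i : Fin 3} (hA : 1 < (![K, M, N] i) ^ 2)
    (hB : 1 < (![M, N, K] i) ^ 2) (h : 0 < ![K, M, N] i ∨ ![M, N, K] i < 0) :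
    IsTwoOval (quartic 1 K M N i) := by
  obtain ⟨D₁, D₂, h1, h2, h3, h4⟩ := exists_plane_ovals (B := -(![M, N, K] i)) hA
    (by rwa [neg_sq]) (by simpa using h)
  rw [quartic_eq_image, h4, Set.image_union]
  exact ⟨_, _, h1.image (continuous_planeChart i) (planeChart_injective i),
    h2.image (continuous_planeChart i) (planeChart_injective i),
    (Set.disjoint_image_iff (planeChart_injective i)).2 h3, rfl⟩

/-- Exactly one member of a focal triple with `δ = 1` has no real points. -/
theorem exists_quartic_eq_empty {K M N : ℝ} (hK : 1 < K ^ 2) (hM : 1 < M ^ 2) (hN : 1 < N ^ 2)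
    (h : K * M + M * N + N * K + 1 = 0) :
    ∃ i, quartic 1 K M N i = ∅ ∧ ∀ j, j ≠ i → IsTwoOval (quartic 1 K M N j) := by
  have hne : ∀ {x : ℝ}, 1 < x ^ 2 → x < 0 ∨ 0 < x := fun {x} hx =>
    lt_or_gt_of_ne (by rintro rfl; norm_num at hx)
  have hempty : ∀ i, ![K, M, N] i < 0 → 0 < ![M, N, K] i → quartic 1 K M N i = ∅ :=
    fun i h1 h2 => by
      rw [quartic_eq_image, planeQuartic_eq_empty h1 (by linarith), Set.image_empty]
  have hA : ∀ i, 1 < (![K, M, N] i) ^ 2 := fun i => by fin_cases i <;> assumption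
  have hB : ∀ i, 1 < (![M, N, K] i) ^ 2 := fun i => by fin_cases i <;> assumption
  have htwo : ∀ i, (0 < ![K, M, N] i ∨ ![M, N, K] i < 0) → IsTwoOval (quartic 1 K M N i) :=
    fun i hi => isTwoOval_quartic (hA i) (hB i) hi
  have pp : ∀ {x y : ℝ}, 0 < x → 0 < y → 0 < x * y := fun h1 h2 => mul_pos h1 h2
  have nn : ∀ {x y : ℝ}, x < 0 → y < 0 → 0 < x * y := fun h1 h2 => mul_pos_of_neg_of_neg h1 h2
  -- Equal signs would make KM + MN + NK positive instead of −1. So somewhere in the cycle K, M, N a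
  -- negative number is followed by a positive one, and that position is the empty curve.
  have main : (K < 0 ∧ 0 < M) ∨ (M < 0 ∧ 0 < N) ∨ (N < 0 ∧ 0 < K) := by
    rcases hne hK with hK | hK <;> rcases hne hM with hM | hM <;> rcases hne hN with hN | hN
    · linarith [nn hK hM, nn hM hN, nn hN hK]
    · tauto
    · tauto
    · tauto
    · tauto
    · tauto
    · tauto
    · linarith [pp hK hM, pp hM hN, pp hN hK]
  rcases main with ⟨h1, h2⟩ | ⟨h1, h2⟩ | ⟨h1, h2⟩
  · refine ⟨0, hempty 0 h1 h2, fun j hj => htwo j ?_⟩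
    fin_cases j
    · exact absurd rfl hj
    · exact Or.inl h2
    · exact Or.inr h1
  · refine ⟨1, hempty 1 h1 h2, fun j hj => htwo j ?_⟩
    fin_cases j
    · exact Or.inr h1
    · exact absurd rfl hj
    · exact Or.inl h2
  · refine ⟨2, hempty 2 h1 h2, fun j hj => htwo j ?_⟩
    fin_cases j
    · exact Or.inl h2
    · exact Or.inr h1
    · exact absurd rfl hj

/-! ### The singular locus of a canonical system -/

namespace TrilinearPair

/-- Dividing the three curve polynomials by abc brings them to the normal form and determines δ, K,
M, N. -/
theorem singularLocus_eq_quartics {a b c : ℝ} (h : a * b * c ≠ 0) (hσ : a + b + c ≠ 0) :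
    (canonicalPair a b c).singularLocus = (fun x : E3 => (x : OnePoint E3)) '' (⋃ i,
      quartic (-((a + b + c) / (a * b * c))) ((c * (a + b + c) - a * b) / (2 * (a * b * c)))
        ((b * (a + b + c) - c * a) / (2 * (a * b * c)))
        ((a * (a + b + c) - b * c) / (2 * (a * b * c))) i) := by
  ext p
  rw [mem_singularLocus_iff hσ]
  simp only [h, and_false, false_or, Set.mem_image, Set.mem_iUnion]
  refine exists_congr fun x => ?_
  rw [and_comm, @eq_comm _ p]
  refine and_congr_left fun _ => ?_
  rw [exists_fin_three]
  have key : ∀ {P Q : ℝ}, P = a * b * c * Q → (P = 0 ↔ Q = 0) := fun e => by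
    rw [e, mul_eq_zero, or_iff_right h]
  have ha : a ≠ 0 := by rintro rfl; simp at h
  have hb : b ≠ 0 := by rintro rfl; simp at h
  have hc : c ≠ 0 := by rintro rfl; simp at h
  have e1 : x ∈ quartic (-((a + b + c) / (a * b * c)))
      ((c * (a + b + c) - a * b) / (2 * (a * b * c)))
        ((b * (a + b + c) - c * a) / (2 * (a * b * c)))
        ((a * (a + b + c) - b * c) / (2 * (a * b * c))) 2 ↔
      x 0 = 0 ∧ curveForm a b c (x 1) (x 2) = 0 :=
    and_congr_right fun _ => (key (by unfold curveForm; field_simp; ring)).symm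
  have e2 : x ∈ quartic (-((a + b + c) / (a * b * c)))
      ((c * (a + b + c) - a * b) / (2 * (a * b * c)))
        ((b * (a + b + c) - c * a) / (2 * (a * b * c)))
        ((a * (a + b + c) - b * c) / (2 * (a * b * c))) 1 ↔
      x 1 = 0 ∧ curveForm b c a (x 2) (x 0) = 0 :=
    and_congr_right fun _ => (key (by unfold curveForm; field_simp; ring)).symm
  have e3 : x ∈ quartic (-((a + b + c) / (a * b * c)))
      ((c * (a + b + c) - a * b) / (2 * (a * b * c)))
        ((b * (a + b + c) - c * a) / (2 * (a * b * c)))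
        ((a * (a + b + c) - b * c) / (2 * (a * b * c))) 0 ↔
      x 2 = 0 ∧ curveForm c a b (x 0) (x 1) = 0 :=
    and_congr_right fun _ => (key (by unfold curveForm; field_simp; ring)).symm
  rw [e1, e2, e3]
  tauto

theorem isThreeFocalOneOval_singularLocus {a b c : ℝ} (h : a * b * c ≠ 0)
    (hσ : a + b + c = a * b * c) : IsThreeFocalOneOval (canonicalPair a b c).singularLocus := by
  have hσ0 : a + b + c ≠ 0 := hσ ▸ h
  have ha : a ≠ 0 := by rintro rfl; simp at h
  have hb : b ≠ 0 := by rintro rfl; simp at h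
  have hc : c ≠ 0 := by rintro rfl; simp at h
  have e : -((a + b + c) / (a * b * c)) = -1 := by rw [hσ, div_self h]
  have hfocal : (c * (a + b + c) - a * b) / (2 * (a * b * c)) *
        ((b * (a + b + c) - c * a) / (2 * (a * b * c))) +
      (b * (a + b + c) - c * a) / (2 * (a * b * c)) *
        ((a * (a + b + c) - b * c) / (2 * (a * b * c))) +
      (a * (a + b + c) - b * c) / (2 * (a * b * c)) *
        ((c * (a + b + c) - a * b) / (2 * (a * b * c))) + (-1) = 0 := by
    rw [← e]
    field_simp
    ring
  refine ⟨_, _, _, hfocal, isOneOval_quartic _ _ _, ?_⟩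
  rw [singularLocus_eq_quartics h hσ0, e]

theorem isTwoFocalTwoOval_singularLocus {a b c : ℝ} (h : a * b * c ≠ 0) (h1 : a + b ≠ 0)
    (h2 : b + c ≠ 0) (h3 : c + a ≠ 0) (hσ : a + b + c = -(a * b * c)) :
    IsTwoFocalTwoOval (canonicalPair a b c).singularLocus := by
  have hσ0 : a + b + c ≠ 0 := hσ ▸ neg_ne_zero.2 h
  have ha : a ≠ 0 := by rintro rfl; simp at h
  have hb : b ≠ 0 := by rintro rfl; simp at h
  have hc : c ≠ 0 := by rintro rfl; simp at h
  have e : -((a + b + c) / (a * b * c)) = 1 := by rw [hσ, neg_div, neg_neg, div_self h]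
  have hfocal : (c * (a + b + c) - a * b) / (2 * (a * b * c)) *
        ((b * (a + b + c) - c * a) / (2 * (a * b * c))) +
      (b * (a + b + c) - c * a) / (2 * (a * b * c)) *
        ((a * (a + b + c) - b * c) / (2 * (a * b * c))) +
      (a * (a + b + c) - b * c) / (2 * (a * b * c)) *
        ((c * (a + b + c) - a * b) / (2 * (a * b * c))) + 1 = 0 := by
    rw [← e]
    field_simp
    ring
  -- K + M, M + N and N + K are nonzero squares over the common denominator 2abc, so all their
  -- products are positive. By focality K² − 1 = (K + M)(K + N), and likewise for M and N.
  have eKM : (c * (a + b + c) - a * b) / (2 * (a * b * c)) +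
      (b * (a + b + c) - c * a) / (2 * (a * b * c)) = (b + c) ^ 2 / (2 * (a * b * c)) := by
    field_simp; ring
  have eMN : (b * (a + b + c) - c * a) / (2 * (a * b * c)) +
      (a * (a + b + c) - b * c) / (2 * (a * b * c)) = (a + b) ^ 2 / (2 * (a * b * c)) := by
    field_simp; ring
  have eNK : (a * (a + b + c) - b * c) / (2 * (a * b * c)) +
      (c * (a + b + c) - a * b) / (2 * (a * b * c)) = (c + a) ^ 2 / (2 * (a * b * c)) := by
    field_simp; ring
  have hp : ∀ {x y : ℝ}, x ≠ 0 → y ≠ 0 →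
      0 < x ^ 2 / (2 * (a * b * c)) * (y ^ 2 / (2 * (a * b * c))) := fun {x y} hx hy => by
    have : x ^ 2 / (2 * (a * b * c)) * (y ^ 2 / (2 * (a * b * c))) =
        (x * y / (2 * (a * b * c))) ^ 2 := by ring
    rw [this]
    have : x * y / (2 * (a * b * c)) ≠ 0 := div_ne_zero (mul_ne_zero hx hy) (by simpa using h)
    positivity
  have gK := hp h2 h3
  have gM := hp h2 h1
  have gN := hp h1 h3
  rw [← eKM, ← eNK] at gK
  rw [← eKM, ← eMN] at gM
  rw [← eMN, ← eNK] at gN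
  refine ⟨_, _, _, hfocal, exists_quartic_eq_empty ?_ ?_ ?_ hfocal, ?_⟩
  · linarith
  · linarith
  · linarith
  · rw [singularLocus_eq_quartics h hσ0, e]

end TrilinearPair

/-! ### The case abc = 0 and the normalization of δ -/

namespace TrilinearPair

theorem isFocalEllipseHyperbola_singularLocus {a b c : ℝ} (h : a * b * c = 0) (h1 : a + b ≠ 0)
    (h2 : b + c ≠ 0) (h3 : c + a ≠ 0) (hσ : a + b + c ≠ 0) :
    IsFocalEllipseHyperbola (canonicalPair a b c).singularLocus := by
  obtain ⟨p, hp⟩ : ∃ p, p = b * c - a * (a + b + c) := ⟨_, rfl⟩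
  obtain ⟨q, hq⟩ : ∃ q, q = c * (a + b + c) - a * b := ⟨_, rfl⟩
  obtain ⟨r, hr⟩ : ∃ r, r = c * a - b * (a + b + c) := ⟨_, rfl⟩
  obtain ⟨s, hs⟩ : ∃ s, s = a + b + c := ⟨_, rfl⟩
  have hs0 : s ≠ 0 := hs ▸ hσ
  -- With abc = 0 the fourth-degree terms disappear, and p, q, r are the remaining quadratic
  -- coefficients up to sign. The relation pr = q(p + r) makes the three conics a single focal
  -- family.
  obtain ⟨hp0, hq0, hr0, hpqr⟩ : p ≠ 0 ∧ q ≠ 0 ∧ r ≠ 0 ∧ p * r = q * (p + r) := by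
    rw [mul_eq_zero, mul_eq_zero] at h
    rcases h with (rfl | rfl) | rfl
    · have hb : b ≠ 0 := by simpa using h1
      have hc : c ≠ 0 := by simpa using h3
      refine ⟨?_, ?_, ?_, by rw [hp, hq, hr]; ring⟩
      · rw [hp]; simpa using ⟨hb, hc⟩
      · rw [hq]; simpa using ⟨hc, h2⟩
      · rw [hr]; simpa using ⟨hb, h2⟩
    · have ha : a ≠ 0 := by simpa using h1
      have hc : c ≠ 0 := by simpa using h2
      rw [add_comm] at h3
      refine ⟨?_, ?_, ?_, by rw [hp, hq, hr]; ring⟩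
      · rw [hp]; simpa using ⟨ha, h3⟩
      · rw [hq]; simpa using ⟨hc, h3⟩
      · rw [hr]; simpa using ⟨hc, ha⟩
    · have ha : a ≠ 0 := by simpa using h3
      have hb : b ≠ 0 := by simpa using h2
      refine ⟨?_, ?_, ?_, by rw [hp, hq, hr]; ring⟩
      · rw [hp]; simpa using ⟨ha, h1⟩
      · rw [hq]; simpa using ⟨ha, hb⟩
      · rw [hr]; simpa using ⟨hb, h1⟩
  have h21 : s / q - s / p = s / r := by
    field_simp
    linear_combination hpqr
  have h12 : s / p - s / q = -(s / r) := by rw [← h21]; ring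
  -- In the plane x = 0 the conic is py² + qz² = s, so the entries are its squared semi-axes with
  -- sign, measured from 0; the other two conics use their differences.
  have hA : Function.Injective (![0, s / p, s / q] : Fin 3 → ℝ) := by
    have n1 : s / p ≠ 0 := div_ne_zero hs0 hp0
    have n2 : s / q ≠ 0 := div_ne_zero hs0 hq0
    have n3 : s / p ≠ s / q := fun h => div_ne_zero hs0 hr0 (by rw [← h21, h, sub_self])
    intro i j hij
    fin_cases i <;> fin_cases j <;> first | rfl | exfalso
    · exact n1 hij.symm
    · exact n2 hij.symm
    · exact n1 hij
    · exact n3 hij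
    · exact n2 hij
    · exact n3 hij.symm
  refine isFocalEllipseHyperbola_of_injective hA fun z => ?_
  rw [mem_singularLocus_iff hσ]
  simp only [h, and_true]
  refine or_congr_right (exists_congr fun x => and_congr_right fun _ => ?_)
  rw [exists_fin_three]
  have key : ∀ {P Q : ℝ}, P = s * Q → (P = 0 ↔ Q + 1 = 1) := fun e => by
    rw [e, mul_eq_zero, or_iff_right hs0, add_eq_right]
  refine or_congr (and_congr_right fun h0 => ?_) (or_congr (and_congr_right fun h0 => ?_)
    (and_congr_right fun h0 => ?_))
  · rw [Fin.sum_univ_three]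
    simp only [Matrix.cons_val_zero, Matrix.cons_val_one, Matrix.cons_val, sub_zero, h0]
    rw [← sub_add_cancel (_ + _) (1 : ℝ)]
    refine key ?_
    unfold curveForm
    rw [h, ← hp, ← hq, ← hs]
    field_simp
    ring
  · rw [Fin.sum_univ_three]
    simp only [Matrix.cons_val_zero, Matrix.cons_val_one, Matrix.cons_val, sub_self, zero_sub, h0,
      h21]
    rw [← sub_add_cancel (_ + _) (1 : ℝ)]
    refine key ?_
    have e1 : b * c * a = 0 := by linear_combination h
    have e2 : c * a - b * (b + c + a) = r := by rw [hr]; ring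
    have e3 : a * (b + c + a) - b * c = -p := by rw [hp]; ring
    have e4 : b + c + a = s := by rw [hs]; ring
    unfold curveForm
    rw [e1, e2, e3, e4]
    field_simp
    ring
  · rw [Fin.sum_univ_three]
    simp only [Matrix.cons_val_zero, Matrix.cons_val_one, Matrix.cons_val, sub_self, zero_sub, h0,
      h12]
    rw [← sub_add_cancel (_ + _) (1 : ℝ)]
    refine key ?_
    have e1 : c * a * b = 0 := by linear_combination h
    have e2 : a * b - c * (c + a + b) = -q := by rw [hq]; ring
    have e3 : b * (c + a + b) - c * a = -r := by rw [hr]; ring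
    have e4 : c + a + b = s := by rw [hs]; ring
    unfold curveForm
    rw [e1, e2, e3, e4]
    field_simp
    ring

/-- The rescaling that normalizes the constant terms of the singular quartics. -/
theorem exists_scaling {a b c : ℝ} (h : a * b * c ≠ 0) (hσ : a + b + c ≠ 0) : ∃ l : ℝ, 0 < l ∧
    (l ^ 2 * a + l ^ 2 * b + l ^ 2 * c = (l ^ 2 * a) * (l ^ 2 * b) * (l ^ 2 * c) ∨
      l ^ 2 * a + l ^ 2 * b + l ^ 2 * c = -((l ^ 2 * a) * (l ^ 2 * b) * (l ^ 2 * c))) := by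
  have hx : 0 < |(a + b + c) / (a * b * c)| := abs_pos.2 (div_ne_zero hσ h)
  -- The requirement l²(a + b + c) = ±l⁶abc determines l⁴.
  refine ⟨√√|(a + b + c) / (a * b * c)|, by positivity, ?_⟩
  obtain ⟨l, hl⟩ : ∃ l, l = √√|(a + b + c) / (a * b * c)| := ⟨_, rfl⟩
  rw [← hl]
  have hl4 : l ^ 4 = |(a + b + c) / (a * b * c)| := by
    rw [show l ^ 4 = (l ^ 2) ^ 2 by ring, hl, Real.sq_sqrt (Real.sqrt_nonneg _),
      Real.sq_sqrt hx.le]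
  have e : (a + b + c) / (a * b * c) * (a * b * c) = a + b + c := div_mul_cancel₀ _ h
  rcases abs_choice ((a + b + c) / (a * b * c)) with h' | h' <;> rw [h'] at hl4
  · left
    linear_combination -(l ^ 2) * e - l ^ 2 * (a * b * c) * hl4
  · right
    linear_combination -(l ^ 2) * e + l ^ 2 * (a * b * c) * hl4

end TrilinearPair

end DupinCyclidic

theorem mainTheorem3 (F : DupinCyclidic.TrilinearPair) (hF : F.IsDCSystem)
    (hns : ¬ F.IsSpherical)
    (S : Fin 3 → DupinCyclidic.MSphere)
    (hfamily : ∀ i, F.HasMSphere i (S i))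
    (hsymm : ∀ i, F.IsSymmetrySphere (S i))
    (hregular : ∃ p, (∀ i, p ∈ (S i).carrier) ∧ p ∉ F.singularLocus) :
    ∃ a b c : ℝ, F.MoebiusEquivalent (DupinCyclidic.canonicalPair a b c) ∧
      (DupinCyclidic.IsThreeFocalOneOval (DupinCyclidic.canonicalPair a b c).singularLocus ∨
       DupinCyclidic.IsTwoFocalTwoOval (DupinCyclidic.canonicalPair a b c).singularLocus ∨
       DupinCyclidic.IsFocalEllipseHyperbola
         (DupinCyclidic.canonicalPair a b c).singularLocus) := by
  obtain ⟨p, hpS, hp⟩ := hregular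
  obtain ⟨a, b, c, h, hns', h0⟩ :=
    DupinCyclidic.TrilinearPair.exists_canonicalPair hF hns S hfamily hpS hp
  have h1 : a + b ≠ 0 := fun h => hns' (DupinCyclidic.TrilinearPair.isSpherical_second h)
  have h2 : b + c ≠ 0 := fun h => hns' (DupinCyclidic.TrilinearPair.isSpherical_third h)
  have h3 : c + a ≠ 0 := fun h => hns' (DupinCyclidic.TrilinearPair.isSpherical_first h)
  -- If a + b + c = 0, then b = 0 would give c + a = 0 and a spherical system, while b ≠ 0 would
  -- make the origin a singular value.
  have hσ : a + b + c ≠ 0 := fun hσ => by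
    by_cases hb : b = 0
    · exact h3 (by rw [hb] at hσ; linarith)
    · exact h0 (DupinCyclidic.TrilinearPair.zero_mem_singularLocus hσ hb)
  by_cases habc : a * b * c = 0
  · exact ⟨a, b, c, h, Or.inr (Or.inr
      (DupinCyclidic.TrilinearPair.isFocalEllipseHyperbola_singularLocus habc h1 h2 h3 hσ))⟩
  · obtain ⟨l, hl, hl'⟩ := DupinCyclidic.TrilinearPair.exists_scaling habc hσ
    have hl2 : l ^ 2 ≠ 0 := (pow_pos hl 2).ne'
    have habc' : l ^ 2 * a * (l ^ 2 * b) * (l ^ 2 * c) ≠ 0 := by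
      have : l ^ 2 * a * (l ^ 2 * b) * (l ^ 2 * c) = (l ^ 2) ^ 3 * (a * b * c) := by ring
      rw [this]
      exact mul_ne_zero (pow_ne_zero 3 hl2) habc
    refine ⟨_, _, _, h.scale hl, ?_⟩
    rcases hl' with hl' | hl'
    · exact Or.inl (DupinCyclidic.TrilinearPair.isThreeFocalOneOval_singularLocus habc' hl')
    · refine Or.inr (Or.inl
        (DupinCyclidic.TrilinearPair.isTwoFocalTwoOval_singularLocus habc' ?_ ?_ ?_ hl'))
      · rw [← mul_add]; exact mul_ne_zero hl2 h1
      · rw [← mul_add]; exact mul_ne_zero hl2 h2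
      · rw [← mul_add]; exact mul_ne_zero hl2 h3
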